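/- Let $d\ge 2$ be an integer and let $\mathcal K$ be a compact subset of $\{1,\dots,d-1\}\times \mathrm{GL}(d,\mathbb R)\times M_d(\mathbb R)\times M_d(\mathbb R)$, whose elements are written $\sigma=(\ell,P,\Lambda,R)$. For $\sigma\in\mathcal K$ write $$\Lambda P^{-1}=\begin{pmatrix}A(\sigma)&B(\sigma)\\ C(\sigma)&D(\sigma)\end{pmatrix},\qquad A(\sigma)\in M_\ell(\mathbb R),$$ and assume that $D(\sigma)$ is Hurwitz (all its eigenvalues have negative real part) for every $\sigma\in\mathcal K$ (the $D$-Hurwitz assumption). Put $$M(\sigma)=A-BD^{-1}C,\qquad T(\sigma)=\begin{pmatrix}I_\ell&0\\ D^{-1}C&I_{d-\ell}\end{pmatrix}P ,$$ and for $\varepsilon>0$ let $E^\varepsilon_\ell$ be the $d\times d$ diagonal matrix whose first $\ell$ diagonal entries are $1$ and whose other diagonal entries are $\varepsilon$. Let $\tau>0$. Let $\mathcal S_{\mathcal K,\tau}$ be the set of right-continuous piecewise-constant signals $\sigma:[0,\infty)\to\mathcal K$ with finitely or infinitely many (possibly no) switching times $0=t_0<t_1<t_2<\cdots$, without accumulation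 point, with $t_{k+1}\ge t_k+\tau$ for every $k\ge 0$ such that $t_{k+1}$ is a switching time; $\sigma$ takes the constant value $\sigma_k=(\ell_k,P_k,\Lambda_k,R_k)$ on $[t_k,t_{k+1})$ (on $[t_k,\infty)$ if $t_k$ is the last switching time). The switching times are part of the signal, and $\sigma_k=\sigma_{k-1}$ is allowed. Consider, for $\sigma\in\mathcal S_{\mathcal K,\tau}$, the system in $\mathbb R^d$ $$\Sigma^\varepsilon_{\mathcal K,\tau}:\quad E^\varepsilon_{\ell_k}P_k\dot X(t)=\Lambda_kX(t)\ \text{ on } [t_k,t_{k+1}),\qquad X(t_k)=R_{k-1}X(t_k^-)\ \ (k\ge1),$$ and the reduced slow system, whose state $\bar x(t)$ is in $\mathbb R^{\ell_k}$ for $t\in[t_k,t_{k+1})$, $$\bar\Sigma_\tau:\quad \dot{\bar x}(t)=M_k\bar x(t)\ \text{ on } [t_k,t_{k+1}),\qquad \bar x(t_k)=\big(T_kR_{k-1}T_{k-1}^{-1}\big)_{\ell_k,\ell_{k-1}}\bar x(t_k^-)\ \ (k\ge1),$$ where $M_k=M(\sigma_k)$, $T_k=T(\sigma_k)$ and $(Q)_{\ell,c}$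 consists of the first $\ell$ rows and first $c$ columns of $Q$. For each of these systems $\Sigma$, let $\Phi^\Sigma_\sigma(t,0)$ be the flow from time $0$ to time $t$ along $\sigma$, and let its maximal Lyapunov exponent be $$\lambda(\Sigma)=\limsup_{t\to+\infty}\ \sup_{\sigma\in\mathcal S_{\mathcal K,\tau}}\frac{\log\|\Phi^\Sigma_\sigma(t,0)\|}{t}\in[-\infty,+\infty],$$ where $\|\cdot\|$ is the operator norm induced by the Euclidean norms and $\log 0=-\infty$. Then $$\lambda(\bar\Sigma_\tau)=\lim_{\varepsilon\searrow0}\lambda(\Sigma^\varepsilon_{\mathcal K,\tau}).$$ -/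

import Mathlib

open Filter Topology

noncomputable section

/-! ## Switching signals -/

/-- A right-continuous piecewise-constant signal with values in `α`, given together with its
switching times.  It has `num ∈ {0, 1, 2, …, ∞}` switching times
`0 < time 1 < time 2 < ⋯` (while `time 0 = 0`), which do not accumulate, and it is equal to
`value k` on `[time k, time (k + 1))` (on `[time k, ∞)` if `k = num`).
The entries with index `k > num` carry no meaning. -/
structure SwitchingSignal (α : Type*) where
  num : ℕ∞
  time : ℕ → ℝ
  value : ℕ → α
  time_zero : time 0 = 0
  time_lt : ∀ k : ℕ, ((k + 1 : ℕ) : ℕ∞) ≤ num → time k < time (k + 1)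
  locally_finite : num = ⊤ → Tendsto time atTop atTop

namespace SwitchingSignal

variable {α : Type*}

/-- The index `k` of the interval `[time k, time (k + 1))` that contains `t ≥ 0`:
the largest `k ≤ num` with `time k ≤ t`. -/
def index (Z : SwitchingSignal α) (t : ℝ) : ℕ :=
  sSup {k : ℕ | (k : ℕ∞) ≤ Z.num ∧ Z.time k ≤ t}

/-- The value `Z(t)` of the signal at time `t ≥ 0`. -/
def eval (Z : SwitchingSignal α) (t : ℝ) : α := Z.value (Z.index t)

/-- The set of signals with values in `K` and dwell time `τ`, that is, with
`t_{k+1} ≥ t_k + τ` for all `k ≥ 0` such that `t_{k+1}` is a switching time. -/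
def withDwell (K : Set α) (τ : ℝ) : Set (SwitchingSignal α) :=
  {Z | (∀ k : ℕ, (k : ℕ∞) ≤ Z.num → Z.value k ∈ K) ∧
    ∀ k : ℕ, ((k + 1 : ℕ) : ℕ∞) ≤ Z.num → Z.time k + τ ≤ Z.time (k + 1)}

theorem time_lt_time (Z : SwitchingSignal α) {j k : ℕ} (hjk : j < k) (hk : (k : ℕ∞) ≤ Z.num) :
    Z.time j < Z.time k := by
  induction k, hjk using Nat.le_induction with
  | base => exact Z.time_lt j hk
  | succ n hn ih =>
    refine lt_trans (ih (le_trans ?_ hk)) (Z.time_lt n hk)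
    exact_mod_cast Nat.le_succ n

/-- `index` does what it should: it is `k` on `[time k, time (k + 1))`, and `num` on the last,
unbounded interval. -/
theorem index_eq (Z : SwitchingSignal α) {t : ℝ} {k : ℕ} (hk : (k : ℕ∞) ≤ Z.num)
    (h₁ : Z.time k ≤ t) (h₂ : ((k + 1 : ℕ) : ℕ∞) ≤ Z.num → t < Z.time (k + 1)) :
    Z.index t = k := by
  have hup : k ∈ upperBounds {k : ℕ | (k : ℕ∞) ≤ Z.num ∧ Z.time k ≤ t} := by
    rintro j ⟨hj, hjt⟩
    by_contra! hlt
    have hk1 : ((k + 1 : ℕ) : ℕ∞) ≤ Z.num := le_trans (by exact_mod_cast hlt) hj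
    have h := h₂ hk1
    rcases Nat.lt_or_ge (k + 1) j with h' | h'
    · have := Z.time_lt_time h' hj
      linarith
    · have : j = k + 1 := by omega
      subst this
      linarith
  exact IsGreatest.csSup_eq ⟨⟨hk, h₁⟩, hup⟩

/-- Every `t ≥ 0` lies in exactly one of the intervals of the signal. -/
theorem index_spec (Z : SwitchingSignal α) {t : ℝ} (ht : 0 ≤ t) :
    (Z.index t : ℕ∞) ≤ Z.num ∧ Z.time (Z.index t) ≤ t ∧
      (((Z.index t + 1 : ℕ) : ℕ∞) ≤ Z.num → t < Z.time (Z.index t + 1)) := by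
  set s : Set ℕ := {k : ℕ | (k : ℕ∞) ≤ Z.num ∧ Z.time k ≤ t}
  have hne : s.Nonempty := ⟨0, by simp, by rw [Z.time_zero]; exact ht⟩
  have hbdd : BddAbove s := by
    by_cases hN : Z.num = ⊤
    · obtain ⟨b, hb⟩ := ((Z.locally_finite hN).eventually_gt_atTop t).exists_forall_of_atTop
      exact ⟨b, fun j hj => by
        by_contra! hlt
        have := hb j hlt.le
        linarith [hj.2]⟩
    · obtain ⟨n, hn⟩ := ENat.ne_top_iff_exists.mp hN
      refine ⟨n, fun j hj => ?_⟩
      have := hj.1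
      rw [← hn] at this
      exact_mod_cast this
  have hmem : Z.index t ∈ s := Nat.sSup_mem hne hbdd
  refine ⟨hmem.1, hmem.2, fun h => ?_⟩
  by_contra! hle
  have : Z.index t + 1 ≤ Z.index t := le_csSup hbdd ⟨h, hle⟩
  omega

end SwitchingSignal

/-! ## Impulsive switched linear systems, with mode-dependent state space -/

/-- The data of an impulsive switched linear system whose modes are the elements of `α`.
In mode `a` the state lives in `ℝ^(Idx a)` and evolves by `ẋ = (gen a) x`; when the mode
switches from `a` to `b`, the state is multiplied by `jump a b`. -/
structure ImpulsiveSystem (α : Type*) where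
  Idx : α → Type
  [fintype : ∀ a, Fintype (Idx a)]
  [decEq : ∀ a, DecidableEq (Idx a)]
  gen : ∀ a, Matrix (Idx a) (Idx a) ℝ
  jump : ∀ a b, Matrix (Idx b) (Idx a) ℝ

attribute [instance] ImpulsiveSystem.fintype ImpulsiveSystem.decEq

namespace ImpulsiveSystem

variable {α : Type*} (S : ImpulsiveSystem α) (Z : SwitchingSignal α)

/-- The flow from time `0` to the time `t_k` of the `k`-th switching (jump included). -/
def switchFlow : (k : ℕ) → Matrix (S.Idx (Z.value k)) (S.Idx (Z.value 0)) ℝ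
  | 0 => 1
  | k + 1 => S.jump (Z.value k) (Z.value (k + 1)) *
      (NormedSpace.exp ((Z.time (k + 1) - Z.time k) • S.gen (Z.value k)) * switchFlow k)

/-- The flow from time `0` to time `t` when `t` belongs to the `k`-th interval
`[t_k, t_{k+1})` of the signal. -/
def pieceFlow (k : ℕ) (t : ℝ) : Matrix (S.Idx (Z.value k)) (S.Idx (Z.value 0)) ℝ :=
  NormedSpace.exp ((t - Z.time k) • S.gen (Z.value k)) * S.switchFlow Z k

/-- The flow `Φ_Z(t, 0)` of the system along the signal `Z`. -/
def flow (t : ℝ) : Matrix (S.Idx (Z.eval t)) (S.Idx (Z.value 0)) ℝ :=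
  S.pieceFlow Z (Z.index t) t

/-- The flow starts at the identity. -/
theorem pieceFlow_zero : S.pieceFlow Z 0 0 = 1 := by
  simp [pieceFlow, switchFlow, Z.time_zero]

/-- On each interval the flow solves the differential equation of the current mode. -/
theorem hasDerivAt_pieceFlow (k : ℕ) (t : ℝ) (x₀ : S.Idx (Z.value 0) → ℝ) :
    HasDerivAt (fun s => (S.pieceFlow Z k s).mulVec x₀)
      ((S.gen (Z.value k)).mulVec ((S.pieceFlow Z k t).mulVec x₀)) t := by
  open scoped Matrix.Norms.Operator in
  have h := ((hasDerivAt_exp_smul_const' (𝕂 := ℝ) (S.gen (Z.value k))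
    (t - Z.time k)).comp_sub_const t (Z.time k))
  let L : Matrix (S.Idx (Z.value k)) (S.Idx (Z.value k)) ℝ →ₗ[ℝ] (S.Idx (Z.value k) → ℝ) :=
    (Matrix.mulVecBilin ℝ ℝ).flip ((S.switchFlow Z k).mulVec x₀)
  have h2 := L.toContinuousLinearMap.hasFDerivAt.comp_hasDerivAt t h
  have h3 : L (S.gen (Z.value k) * NormedSpace.exp ((t - Z.time k) • S.gen (Z.value k))) =
      (S.gen (Z.value k)).mulVec ((S.pieceFlow Z k t).mulVec x₀) := by
    simp [L, pieceFlow, Matrix.mulVec_mulVec]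
  have h4 : (fun s => (S.pieceFlow Z k s).mulVec x₀) =
      fun s => L (NormedSpace.exp ((s - Z.time k) • S.gen (Z.value k))) := by
    funext s
    simp [L, pieceFlow, Matrix.mulVec_mulVec]
  rw [h4, ← h3]
  exact h2

/-- At a switching time, the state is the image under the jump matrix of its left limit. -/
theorem pieceFlow_succ (k : ℕ) :
    S.pieceFlow Z (k + 1) (Z.time (k + 1)) =
      S.jump (Z.value k) (Z.value (k + 1)) * S.pieceFlow Z k (Z.time (k + 1)) := by
  simp [pieceFlow, switchFlow]

/-- The maximal Lyapunov exponent
`limsup_{t → ∞} sup_Z log ‖Φ_Z(t, 0)‖ / t` over the signals `Z` with values in `K` and dwell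
time `τ`.  It is an extended real number, the norm is the one induced by the Euclidean norms,
and `log 0 = -∞`. -/
def lyapunovExponent (K : Set α) (τ : ℝ) : EReal :=
  limsup (fun t : ℝ => ⨆ Z ∈ SwitchingSignal.withDwell K τ,
    ENNReal.log ‖(S.flow Z t).toEuclideanLin.toContinuousLinearMap‖ₑ / (t : EReal)) atTop

end ImpulsiveSystem

/-! ## The singularly perturbed system and the reduced system -/

/-- Modes `σ = (ℓ, P, Λ, R)` in `{1, …, d - 1} × GL(d, ℝ) × M_d(ℝ) × M_d(ℝ)`, with the product
topology. -/
abbrev SPMode (d : ℕ) : Type :=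
  Set.Icc 1 (d - 1) × GL (Fin d) ℝ × Matrix (Fin d) (Fin d) ℝ × Matrix (Fin d) (Fin d) ℝ

namespace SPMode

variable {d : ℕ} (σ : SPMode d)

/-- The number `ℓ` of slow variables. -/
abbrev ell : ℕ := σ.1

/-- The change of variables `P`. -/
abbrev P : Matrix (Fin d) (Fin d) ℝ := (σ.2.1 : Matrix (Fin d) (Fin d) ℝ)

/-- The matrix `Λ` of the dynamics. -/
abbrev Lam : Matrix (Fin d) (Fin d) ℝ := σ.2.2.1

/-- The jump matrix `R`. -/
abbrev R : Matrix (Fin d) (Fin d) ℝ := σ.2.2.2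

/-- The first `ℓ` coordinates. -/
abbrev Slow : Type := {i : Fin d // (i : ℕ) < σ.ell}

/-- The last `d - ℓ` coordinates. -/
abbrev Fast : Type := {i : Fin d // ¬ (i : ℕ) < σ.ell}

/-- `E^ε_ℓ = diag(1, …, 1, ε, …, ε)`, with `ℓ` entries equal to `1`. -/
def E (ε : ℝ) : Matrix (Fin d) (Fin d) ℝ :=
  Matrix.diagonal fun i => if (i : ℕ) < σ.ell then 1 else ε

/-- The block `A` of `Λ P⁻¹ = (A B; C D)`. -/
def A : Matrix σ.Slow σ.Slow ℝ := (σ.Lam * σ.P⁻¹).submatrix Subtype.val Subtype.val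

/-- The block `B` of `Λ P⁻¹ = (A B; C D)`. -/
def B : Matrix σ.Slow σ.Fast ℝ := (σ.Lam * σ.P⁻¹).submatrix Subtype.val Subtype.val

/-- The block `C` of `Λ P⁻¹ = (A B; C D)`. -/
def C : Matrix σ.Fast σ.Slow ℝ := (σ.Lam * σ.P⁻¹).submatrix Subtype.val Subtype.val

/-- The block `D` of `Λ P⁻¹ = (A B; C D)`. -/
def D : Matrix σ.Fast σ.Fast ℝ := (σ.Lam * σ.P⁻¹).submatrix Subtype.val Subtype.val

/-- The reduced slow dynamics `M = A - B D⁻¹ C`. -/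
def M : Matrix σ.Slow σ.Slow ℝ := σ.A - σ.B * σ.D⁻¹ * σ.C

/-- The matrix `T = (I 0; D⁻¹C I) P`. -/
def T : Matrix (Fin d) (Fin d) ℝ :=
  Matrix.reindex (Equiv.sumCompl fun i : Fin d => (i : ℕ) < σ.ell)
    (Equiv.sumCompl fun i : Fin d => (i : ℕ) < σ.ell)
    (Matrix.fromBlocks 1 0 (σ.D⁻¹ * σ.C) 1) * σ.P

end SPMode

/-- A real square matrix is Hurwitz if all its complex eigenvalues have negative real part. -/
def Matrix.IsHurwitz {n : Type*} [Fintype n] [DecidableEq n] (N : Matrix n n ℝ) : Prop :=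
  ∀ z ∈ spectrum ℂ (N.map (algebraMap ℝ ℂ)), z.re < 0

/-- The velocity matrix `(E^ε_ℓ P)⁻¹ Λ` of the equation `E^ε_ℓ P Ẋ = Λ X`. -/
def SPMode.velocity {d : ℕ} (σ : SPMode d) (ε : ℝ) : Matrix (Fin d) (Fin d) ℝ :=
  (σ.E ε * σ.P)⁻¹ * σ.Lam

/-- For `ε > 0`, the equation `E^ε_ℓ P Ẋ = Λ X` is indeed `Ẋ = (E^ε_ℓ P)⁻¹ Λ X`. -/
theorem SPMode.velocity_iff {d : ℕ} {ε : ℝ} (hε : 0 < ε) (σ : SPMode d) (X V : Fin d → ℝ) :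
    (σ.E ε * σ.P).mulVec V = σ.Lam.mulVec X ↔ V = (σ.velocity ε).mulVec X := by
  have hE : IsUnit (σ.E ε).det := by
    rw [SPMode.E, Matrix.det_diagonal, isUnit_iff_ne_zero, Finset.prod_ne_zero_iff]
    intro i _
    split_ifs
    · exact one_ne_zero
    · exact hε.ne'
  have hP : IsUnit σ.P.det := (Matrix.isUnit_iff_isUnit_det _).mp σ.2.1.isUnit
  have hEP : IsUnit (σ.E ε * σ.P).det := by
    rw [Matrix.det_mul]
    exact hE.mul hP
  constructor
  · intro h
    rw [velocity, ← Matrix.mulVec_mulVec, ← h, Matrix.mulVec_mulVec,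
      Matrix.nonsing_inv_mul _ hEP, Matrix.one_mulVec]
  · rintro rfl
    rw [velocity, Matrix.mulVec_mulVec, Matrix.mul_nonsing_inv_cancel_left _ _ hEP]

/-- The singularly perturbed system `Σ^ε`: `E^ε_ℓ P Ẋ = Λ X` between the switchings, and
`X(t_k) = R_{k-1} X(t_k⁻)` at the switchings. -/
def perturbedSystem (d : ℕ) (ε : ℝ) : ImpulsiveSystem (SPMode d) where
  Idx _ := Fin d
  gen σ := σ.velocity ε
  jump σ _ := σ.R

/-- The reduced slow system `Σ̄`: `ẋ = M x` in `ℝ^ℓ` between the switchings, and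
`x(t_k) = (T_k R_{k-1} T_{k-1}⁻¹)_{ℓ_k, ℓ_{k-1}} x(t_k⁻)` at the switchings, where the index
means that only the first `ℓ_k` rows and the first `ℓ_{k-1}` columns are kept. -/
def reducedSystem (d : ℕ) : ImpulsiveSystem (SPMode d) where
  Idx σ := σ.Slow
  gen σ := σ.M
  jump σ σ' := (σ'.T * σ.R * σ.T⁻¹).submatrix Subtype.val Subtype.val

end

/-! Write κ = ε⁻¹. In the coordinates given by T, the perturbed generator is H + κN, where H
(`boundedPart`) does not depend on ε and N (`fastPart`) is 0 ⊕ D. Since D is Hurwitz, uniformly on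
the compact set of modes, the fast component collapses: for durations in [τ, t₁] the flow of a mode
is within O(ε) of `limitFlow`, that is T⁻¹(e^{tM} ⊕ 0)T (`exists_flow_estimates`). Near t = 0 this
fails, because the limit starts from a projection and not from the identity; the dwell time makes
every completed stay long enough. The limit flow factors through ℝ^ℓ, so the hybrid system in ℝ^d
built from it has the same growth as the reduced system (`exists_norm_reducedSystem_le`). What
remains is the continuity of a growth rate when the flows of the modes converge for durations at
least τ.

Upper semicontinuity (`exists_growth_bound_of_close`) uses an extremal norm. A state is measured by
the supremum of its images under all normalized products that may follow it in the limit system.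
Along the limit flow this quantity grows at most like e^{μt}. Replacing the limit flow by a nearby
one over a duration in [τ, 2τ] adds a small multiple, which a slightly larger exponent absorbs. As
pieces last at least τ, the errors do not accumulate beyond that exponent.

Lower semicontinuity (`eventually_exists_signal_of_tendsto`) rests on the Berger–Wang theorem:
growth faster than e^{μ₂t} with μ₂ > μ forces a single word, or a single mode, whose spectral radius
exceeds e^{μt} over its duration t. Spectral radii are lower semicontinuous, so the same word or
mode works for small ε, and repeating it produces signals that grow at least like e^{μt}. -/

noncomputable section

/-! ### Burnside's theorem and a trace bound -/

section BergerWang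

open Module

variable {V : Type*} [AddCommGroup V] [Module ℂ V] [FiniteDimensional ℂ V] {ι : Type*}

/-- **Burnside's theorem**: an irreducible family of operators spans all operators. -/
theorem span_words_eq_top [Nontrivial V] (a : ι → End ℂ V)
    (hirr : ∀ W : Submodule ℂ V, (∀ i, ∀ v ∈ W, a i v ∈ W) → W = ⊥ ∨ W = ⊤) :
    Submodule.span ℂ (Set.range fun w : List ι => (w.map a).prod) = ⊤ := by
  set S := Algebra.adjoin ℂ (Set.range a) with hS
  have hspan : Subalgebra.toSubmodule S =
      Submodule.span ℂ (Set.range fun w : List ι => (w.map a).prod) := by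
    rw [hS, Algebra.adjoin_eq_span]
    congr 1
    rw [← FreeMonoid.mrange_lift]
    ext x
    constructor
    · rintro ⟨w, rfl⟩
      exact ⟨FreeMonoid.toList w, by simp [FreeMonoid.lift_apply]⟩
    · rintro ⟨w, rfl⟩
      exact ⟨FreeMonoid.ofList w, by simp [FreeMonoid.lift_apply]⟩
  have hsimple : IsSimpleModule S V := by
    rw [isSimpleModule_iff, ]
    refine { exists_pair_ne := ⟨⊥, ⊤, bot_ne_top⟩, eq_bot_or_eq_top := fun W => ?_ }
    have := hirr (W.restrictScalars ℂ) (fun i v hv =>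
      W.smul_mem (⟨a i, Algebra.subset_adjoin ⟨i, rfl⟩⟩ : S) hv)
    rcases this with h | h
    · left
      exact (Submodule.restrictScalars_eq_bot_iff ..).mp h
    · right
      exact (Submodule.restrictScalars_eq_top_iff ..).mp h
  rw [← hspan, eq_top_iff]
  intro f _
  -- Schur's lemma: the commutant of `S` consists of scalars, so every ℂ-linear `f` commutes with
  -- it. Jacobson density then makes `f` agree with an element of `S` on a basis.
  have hsc := (IsSimpleModule.algebraMap_end_bijective_of_isAlgClosed (A := S) (V := V) ℂ).2
  let f' : End (End S V) V :=
    { toFun := f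
      map_add' := f.map_add
      map_smul' := fun g v => by
        obtain ⟨c, rfl⟩ := hsc g
        simp }
  classical
  let b := Module.finBasis ℂ V
  obtain ⟨r, hr⟩ := jacobson_density f' (Finset.univ.image b)
  have : f = r := b.ext fun i => hr (b i) (Finset.mem_image_of_mem _ (Finset.mem_univ i))
  rw [this]
  exact r.2

theorem norm_trace_le_finrank (f : End ℂ V) (h : ∀ z, f.HasEigenvalue z → ‖z‖ ≤ 1) :
    ‖LinearMap.trace ℂ V f‖ ≤ finrank ℂ V := by
  rw [End.trace_eq_sum_roots_charpoly_of_splits (IsAlgClosed.splits _)]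
  calc ‖f.charpoly.roots.sum‖ ≤ (f.charpoly.roots.map fun z => ‖z‖).sum := by
        exact norm_multiset_sum_le _
    _ ≤ (f.charpoly.roots.map fun _ => (1 : ℝ)).sum := by
        refine Multiset.sum_map_le_sum_map _ _ fun z hz => h z ?_
        rw [End.hasEigenvalue_iff_isRoot_charpoly]
        exact (Polynomial.mem_roots'.mp hz).2
    _ = (f.charpoly.roots.card : ℝ) := by simp
    _ ≤ finrank ℂ V := by
        rw [← LinearMap.charpoly_natDegree f]
        exact_mod_cast Polynomial.card_roots' _

end BergerWang

/-! ### The Berger–Wang theorem for operators -/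

section BergerWangNormed

open Module

universe u
variable {ι : Type*}

/-- By Burnside, every operator B is a combination of words, so tr(wB) is a combination of traces of
words, each at most dim V in modulus. Taking B of rank one turns these traces into the coordinates
of w v. The resulting pointwise bounds become uniform by Banach–Steinhaus. -/
theorem words_bounded_of_irreducible {V : Type u} [NormedAddCommGroup V] [NormedSpace ℂ V]
    [FiniteDimensional ℂ V] (a : ι → End ℂ V)
    (hirr : ∀ W : Submodule ℂ V, (∀ i, ∀ v ∈ W, a i v ∈ W) → W = ⊥ ∨ W = ⊤)
    (h : ∀ (w : List ι) z, ((w.map a).prod).HasEigenvalue z → ‖z‖ ≤ 1) :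
    ∃ C, ∀ (w : List ι) v, ‖(w.map a).prod v‖ ≤ C * ‖v‖ := by
  rcases subsingleton_or_nontrivial V with hV | hV
  · exact ⟨0, fun w v => by simp [Subsingleton.elim _ (0 : V)]⟩
  have htr : ∀ B : End ℂ V, ∃ C, ∀ w : List ι,
      ‖LinearMap.trace ℂ V ((w.map a).prod * B)‖ ≤ C := by
    intro B
    have hB : B ∈ Submodule.span ℂ (Set.range fun w : List ι => (w.map a).prod) := by
      rw [span_words_eq_top a hirr]; trivial
    induction hB using Submodule.span_induction with
    | mem x hx =>
      obtain ⟨u, rfl⟩ := hx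
      refine ⟨finrank ℂ V, fun w => ?_⟩
      have : (w.map a).prod * (u.map a).prod = ((w ++ u).map a).prod := by simp
      simp only [this]
      exact norm_trace_le_finrank _ (h _)
    | zero => exact ⟨0, by simp⟩
    | add x y _ _ hx hy =>
      obtain ⟨C, hC⟩ := hx
      obtain ⟨C', hC'⟩ := hy
      refine ⟨C + C', fun w => ?_⟩
      rw [mul_add, map_add]
      exact (norm_add_le _ _).trans (add_le_add (hC w) (hC' w))
    | smul c x _ hx =>
      obtain ⟨C, hC⟩ := hx
      refine ⟨‖c‖ * C, fun w => ?_⟩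
      rw [mul_smul_comm, map_smul, norm_smul]
      exact mul_le_mul_of_nonneg_left (hC w) (norm_nonneg c)
  let b := Module.finBasis ℂ V
  have hentry : ∀ v : V, ∃ C, ∀ w : List ι, ‖(w.map a).prod v‖ ≤ C := by
    intro v
    choose C hC using fun j => htr ((b.coord j).smulRight v)
    refine ⟨∑ j, C j * ‖b j‖, fun w => ?_⟩
    have key : ∀ j, b.coord j ((w.map a).prod v) =
        LinearMap.trace ℂ V ((w.map a).prod * ((b.coord j).smulRight v)) := by
      intro j
      have : (w.map a).prod * ((b.coord j).smulRight v) =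
          (b.coord j).smulRight ((w.map a).prod v) := by
        ext u; simp
      rw [this, LinearMap.trace_smulRight]
    calc ‖(w.map a).prod v‖ = ‖∑ j, b.coord j ((w.map a).prod v) • b j‖ := by
          congr 1; exact (b.sum_repr _).symm
      _ ≤ ∑ j, ‖b.coord j ((w.map a).prod v) • b j‖ := norm_sum_le _ _
      _ ≤ ∑ j, C j * ‖b j‖ := by
          refine Finset.sum_le_sum fun j _ => ?_
          rw [norm_smul, key]
          exact mul_le_mul_of_nonneg_right (hC j w) (norm_nonneg _)
  obtain ⟨C, hC⟩ := banach_steinhaus (g := fun w : List ι =>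
    LinearMap.toContinuousLinearMap ((w.map a).prod)) hentry
  exact ⟨C, fun w v => (LinearMap.toContinuousLinearMap ((w.map a).prod)).le_of_opNorm_le (hC w) v⟩

/-- The operators are block triangular with respect to W. In the expansion of a product, the
off-diagonal block occurs at most once, at one of `w.length` places, whence the linear factor. -/
theorem berger_wang_of_invariant {V : Type u} [NormedAddCommGroup V] [NormedSpace ℂ V]
    [FiniteDimensional ℂ V] (a : ι → End ℂ V) (W : Submodule ℂ V)
    (hW : ∀ i, ∀ v ∈ W, a i v ∈ W) [IsClosed (W : Set V)] {β r CW CQ : ℝ} (hr : 1 ≤ r)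
    (hβ : ∀ i v, ‖a i v‖ ≤ β * ‖v‖)
    (hCW : ∀ (w : List ι) (v : W),
      ‖(w.map fun i => (a i).restrict (hW i)).prod v‖ ≤ CW * r ^ w.length * ‖v‖)
    (hCQ : ∀ (w : List ι) (v : V ⧸ W),
      ‖(w.map fun i => W.mapQ W (a i) (hW i)).prod v‖ ≤ CQ * r ^ w.length * ‖v‖) :
    ∃ C, ∀ (w : List ι) v, ‖(w.map a).prod v‖ ≤ C * (1 + w.length) * r ^ w.length * ‖v‖ := by
  have hWw : ∀ (w : List ι) (v : W),
      (((w.map fun i => (a i).restrict (hW i)).prod v : W) : V) = (w.map a).prod v := by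
    intro w v
    induction w with
    | nil => simp
    | cons i w ih => simp [ih]
  have hQw : ∀ (w : List ι) (v : V),
      (w.map fun i => W.mapQ W (a i) (hW i)).prod (W.mkQ v) = W.mkQ ((w.map a).prod v) := by
    intro w v
    induction w with
    | nil => simp
    | cons i w ih => 
      simp only [List.map_cons, List.prod_cons, End.mul_apply, ih]
      simp
  obtain ⟨s, hs⟩ := W.mkQ.exists_rightInverse_of_surjective W.range_mkQ
  have hs' : ∀ q, W.mkQ (s q) = q := fun q => by
    have := congrArg (fun f => f q) hs; simpa using this
  set s' := LinearMap.toContinuousLinearMap s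
  let p : V →ₗ[ℂ] W := (LinearMap.id - s ∘ₗ W.mkQ).codRestrict W (fun v => by
    rw [← Submodule.Quotient.mk_eq_zero, ← Submodule.mkQ_apply]
    simp [hs', -Submodule.mkQ_apply])
  have hp : ∀ v, (p v : V) = v - s (W.mkQ v) := fun v => rfl
  have hpW : ∀ v : W, p v = v := fun v => by
    apply Subtype.ext; rw [hp]
    have : W.mkQ (v : V) = 0 := by simp
    rw [this]; simp
  set p' := LinearMap.toContinuousLinearMap p
  have hs1 : ∀ q, ‖s q‖ ≤ ‖s'‖ * ‖q‖ := s'.le_opNorm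
  have hp1 : ∀ q, ‖p q‖ ≤ ‖p'‖ * ‖q‖ := p'.le_opNorm
  have hmk : ∀ v, ‖W.mkQ v‖ ≤ ‖v‖ := fun v => Submodule.Quotient.norm_mk_le W v
  set β' := max β 0
  set CW' := max CW 0
  set CQ' := max CQ 0
  have hβ' : ∀ i v, ‖a i v‖ ≤ β' * ‖v‖ := fun i v => (hβ i v).trans (by gcongr; exact le_max_left _ _)
  have hCW' : ∀ (w : List ι) (v : W), ‖(w.map a).prod v‖ ≤ CW' * r ^ w.length * ‖v‖ := fun w v => by
    rw [← hWw]
    exact (hCW w v).trans (by gcongr; exact le_max_left _ _)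
  have hCQ' : ∀ (w : List ι) (v : V), ‖W.mkQ ((w.map a).prod v)‖ ≤ CQ' * r ^ w.length * ‖v‖ :=
    fun w v => by
      rw [← hQw]
      refine (hCQ w _).trans ?_
      gcongr
      · exact le_max_left _ _
      · exact hmk v
  have hβ0 : 0 ≤ β' := le_max_right _ _
  have hCW0 : 0 ≤ CW' := le_max_right _ _
  have hCQ0 : 0 ≤ CQ' := le_max_right _ _
  set K := CW' * ‖p'‖ + CW' * (‖p'‖ * (β' * (‖s'‖ * CQ'))) with hK
  have hK0 : 0 ≤ K := by positivity
  have hr0 : 0 ≤ r := by linarith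
  -- The prefix `u` is carried through the induction so that the bound on W is applied once to a
  -- whole word; applying it letter by letter would raise the constant `CW'` to the power of the
  -- length.
  have key : ∀ (w u : List ι) v, ‖(u.map a).prod (p ((w.map a).prod v) : V)‖ ≤
      K * (1 + w.length) * r ^ (u.length + w.length) * ‖v‖ := by
    intro w
    induction w with
    | nil =>
      intro u v
      simp only [List.map_nil, List.prod_nil, End.one_apply, List.length_nil, Nat.cast_zero,
        add_zero, mul_one]
      calc _ ≤ CW' * r ^ u.length * ‖p v‖ := hCW' u _
        _ ≤ CW' * r ^ u.length * (‖p'‖ * ‖v‖) := by gcongr; exact hp1 v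
        _ = (CW' * ‖p'‖) * r ^ u.length * ‖v‖ := by ring
        _ ≤ K * r ^ u.length * ‖v‖ := by
          gcongr
          rw [hK]
          have : 0 ≤ CW' * (‖p'‖ * (β' * (‖s'‖ * CQ'))) := by positivity
          linarith
    | cons i w ih =>
      intro u v
      set y := (w.map a).prod v
      have hsplit : (p (((i :: w).map a).prod v) : V) =
          a i (p y) + p (a i (s (W.mkQ y))) := by
        have h1 : a i y = ((⟨a i (p y), hW i _ (p y).2⟩ : W) : V) + a i (s (W.mkQ y)) := by
          simp only [hp, map_sub]; abel
        have h2 : ((i :: w).map a).prod v = a i y := by simp [y]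
        rw [h2, h1, map_add, hpW]
        rfl
      rw [hsplit, map_add]
      have t1 : ‖(u.map a).prod (a i (p y))‖ ≤
          K * (1 + w.length) * r ^ (u.length + (i :: w).length) * ‖v‖ := by
        have := ih (u ++ [i]) v
        simpa [add_assoc, add_comm, add_left_comm] using this
      have t2 : ‖(u.map a).prod (p (a i (s (W.mkQ y))) : V)‖ ≤
          K * r ^ (u.length + (i :: w).length) * ‖v‖ := by
        calc _ ≤ CW' * r ^ u.length * ‖p (a i (s (W.mkQ y)))‖ := hCW' u _
          _ ≤ CW' * r ^ u.length * (‖p'‖ * (β' * (‖s'‖ * (CQ' * r ^ w.length * ‖v‖)))) := by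
            gcongr
            refine (hp1 _).trans ?_
            gcongr
            refine (hβ' _ _).trans ?_
            gcongr
            refine (hs1 _).trans ?_
            gcongr
            exact hCQ' w v
          _ = CW' * (‖p'‖ * (β' * (‖s'‖ * CQ'))) * r ^ (u.length + w.length) * ‖v‖ := by
            rw [pow_add]; ring
          _ ≤ K * r ^ (u.length + (i :: w).length) * ‖v‖ := by
            gcongr
            · rw [hK]
              have : 0 ≤ CW' * ‖p'‖ := by positivity
              linarith
            · simp
      calc _ ≤ _ := norm_add_le _ _
        _ ≤ _ := add_le_add t1 t2
        _ = _ := by push_cast [List.length_cons]; ring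
  refine ⟨K + ‖s'‖ * CQ', fun w v => ?_⟩
  have h1 := key w [] v
  simp only [List.map_nil, List.prod_nil, End.one_apply, List.length_nil, zero_add] at h1
  have h2 : (w.map a).prod v = p ((w.map a).prod v) + s (W.mkQ ((w.map a).prod v)) := by
    rw [hp]; abel
  have h3 : ‖s (W.mkQ ((w.map a).prod v))‖ ≤ ‖s'‖ * CQ' * (1 + w.length) * r ^ w.length * ‖v‖ := by
    calc _ ≤ ‖s'‖ * (CQ' * r ^ w.length * ‖v‖) := (hs1 _).trans (by gcongr; exact hCQ' w v)
      _ = ‖s'‖ * CQ' * 1 * r ^ w.length * ‖v‖ := by ring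
      _ ≤ _ := by gcongr; simp
  rw [h2]
  calc _ ≤ _ := norm_add_le _ _
    _ ≤ _ := add_le_add h1 h3
    _ = _ := by ring

theorem hasEigenvalue_of_restrict {V : Type u} [AddCommGroup V] [Module ℂ V] {f : End ℂ V}
    {W : Submodule ℂ V} (hW : ∀ v ∈ W, f v ∈ W) {z : ℂ} (h : End.HasEigenvalue (f.restrict hW) z) :
    f.HasEigenvalue z := by
  obtain ⟨v, hv⟩ := h.exists_hasEigenvector
  refine End.hasEigenvalue_of_hasEigenvector (x := (v : V)) ?_
  refine ⟨End.mem_eigenspace_iff.mpr ?_, fun h0 => hv.2 (Subtype.ext h0)⟩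
  have := congrArg (Subtype.val) hv.apply_eq_smul
  simpa using this

/-- If f − z were injective, its restriction to W would be surjective. For a representative v of an
eigenvector of the quotient, (f − z)v lies in W, so it has a preimage in W, which must be v; then v
is zero in the quotient. -/
theorem hasEigenvalue_of_mapQ {V : Type u} [AddCommGroup V] [Module ℂ V] [FiniteDimensional ℂ V]
    {f : End ℂ V} {W : Submodule ℂ V} (hW : ∀ v ∈ W, f v ∈ W) {z : ℂ}
    (h : End.HasEigenvalue (W.mapQ W f hW) z) : f.HasEigenvalue z := by
  by_contra hcon
  obtain ⟨q, hq⟩ := h.exists_hasEigenvector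
  obtain ⟨v, rfl⟩ := W.mkQ_surjective q
  have hinj : Function.Injective (f - algebraMap ℂ (End ℂ V) z) := by
    rw [← LinearMap.ker_eq_bot]
    by_contra hne
    exact hcon (by rw [End.HasEigenvalue, End.HasUnifEigenvalue, End.genEigenspace_one]; exact hne)
  have hgW : ∀ u ∈ W, (f - algebraMap ℂ (End ℂ V) z) u ∈ W := fun u hu =>
    W.sub_mem (hW u hu) (W.smul_mem z hu)
  have hsurj : Function.Surjective ((f - algebraMap ℂ (End ℂ V) z).restrict hgW) := by
    rw [← LinearMap.injective_iff_surjective]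
    intro x y hxy
    exact Subtype.ext (hinj (congrArg Subtype.val hxy))
  have hmem : (f - algebraMap ℂ (End ℂ V) z) v ∈ W := by
    rw [← Submodule.Quotient.mk_eq_zero]
    have := hq.apply_eq_smul
    simp only [Submodule.mkQ_apply, Submodule.mapQ_apply] at this
    simp [this]
  obtain ⟨u, hu⟩ := hsurj ⟨_, hmem⟩
  have : (u : V) = v := hinj (congrArg Subtype.val hu)
  exact hq.2 (by simp [← this])

/-- Strong induction on the dimension: an irreducible family has bounded words, and otherwise the
restriction to an invariant subspace and the quotient by it have smaller dimension and inherit the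
bound on eigenvalues. -/
theorem berger_wang_aux (n : ℕ) : ∀ (V : Type u) [NormedAddCommGroup V] [NormedSpace ℂ V]
    [FiniteDimensional ℂ V], finrank ℂ V = n → ∀ (a : ι → End ℂ V) (β : ℝ)
    (_ : ∀ i v, ‖a i v‖ ≤ β * ‖v‖)
    (_ : ∀ (w : List ι) z, ((w.map a).prod).HasEigenvalue z → ‖z‖ ≤ 1) (r : ℝ) (_ : 1 < r),
    ∃ C, ∀ (w : List ι) v, ‖(w.map a).prod v‖ ≤ C * r ^ w.length * ‖v‖ := by
  induction n using Nat.strong_induction_on with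
  | _ n ih =>
  intro V _ _ _ hn a β hβ h r hr
  by_cases hirr : ∀ W : Submodule ℂ V, (∀ i, ∀ v ∈ W, a i v ∈ W) → W = ⊥ ∨ W = ⊤
  · obtain ⟨C, hC⟩ := words_bounded_of_irreducible a hirr h
    refine ⟨max C 0, fun w v => (hC w v).trans ?_⟩
    gcongr
    calc C ≤ max C 0 := le_max_left _ _
      _ ≤ max C 0 * r ^ w.length :=
        le_mul_of_one_le_right (le_max_right _ _) (one_le_pow₀ hr.le)
  · push Not at hirr
    obtain ⟨W, hW, hbot, htop⟩ := hirr
    have : IsClosed (W : Set V) := W.closed_of_finiteDimensional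
    have hWlt : finrank ℂ W < n := hn ▸ Submodule.finrank_lt htop
    have hQlt : finrank ℂ (V ⧸ W) < n := by
      have h1 := Submodule.finrank_quotient_add_finrank W
      have h2 : 0 < finrank ℂ W := by
        rw [Module.finrank_pos_iff]; exact (Submodule.nontrivial_iff_ne_bot).mpr hbot
      omega
    -- Both pieces are bounded at rate q = √r; the second factor q^n in r^n = q^n q^n pays for the
    -- linear factor 1 + n.
    set q := √r
    have hq : 1 < q := Real.lt_sqrt_of_sq_lt (by simpa using hr)
    have hqq : q * q = r := Real.mul_self_sqrt (by linarith)
    have hWw : ∀ (w : List ι), ∃ hw : ∀ v ∈ W, (w.map a).prod v ∈ W,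
        (w.map fun i => (a i).restrict (hW i)).prod = ((w.map a).prod).restrict hw := by
      intro w
      induction w with
      | nil => exact ⟨fun v hv => by simpa using hv, by ext; simp⟩
      | cons i w ihw =>
        obtain ⟨hw, he⟩ := ihw
        exact ⟨fun v hv => by simpa using hW i _ (hw v hv), by ext; simp [he]⟩
    have hQw : ∀ (w : List ι), ∃ hw : ∀ v ∈ W, (w.map a).prod v ∈ W,
        (w.map fun i => W.mapQ W (a i) (hW i)).prod = W.mapQ W (w.map a).prod hw := by
      intro w
      induction w with
      | nil => exact ⟨fun v hv => by simpa using hv, by ext; simp⟩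
      | cons i w ihw =>
        obtain ⟨hw, he⟩ := ihw
        exact ⟨fun v hv => by simpa using hW i _ (hw v hv), by ext; simp [he]⟩
    obtain ⟨CW, hCW⟩ := ih _ hWlt W rfl (fun i => (a i).restrict (hW i)) β
      (fun i v => hβ i v) (fun w z hz => by
        obtain ⟨hw, he⟩ := hWw w
        rw [he] at hz
        exact h w z (hasEigenvalue_of_restrict hw hz)) q hq
    obtain ⟨CQ, hCQ⟩ := ih _ hQlt (V ⧸ W) rfl (fun i => W.mapQ W (a i) (hW i)) (max β 0)
      (fun i v => by
        refine le_of_forall_pos_le_add fun ε hε => ?_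
        have hδ : 0 < ε / (max β 0 + 1) := by positivity
        -- The quotient norm is an infimum, so the lift exceeds it by an excess δ chosen to cost at
        -- most ε after multiplication by the operator bound.
        obtain ⟨x, hx, hxn⟩ := Submodule.Quotient.norm_mk_lt v hδ
        rw [← hx, Submodule.mapQ_apply]
        calc _ ≤ ‖a i x‖ := Submodule.Quotient.norm_mk_le W _
          _ ≤ max β 0 * ‖x‖ := (hβ i x).trans (by gcongr; exact le_max_left _ _)
          _ ≤ max β 0 * (‖v‖ + ε / (max β 0 + 1)) := by gcongr
          _ = max β 0 * ‖v‖ + max β 0 / (max β 0 + 1) * ε := by ring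
          _ ≤ max β 0 * ‖v‖ + 1 * ε := by
            gcongr
            rw [div_le_one (by positivity)]; linarith
          _ = _ := by rw [hx, one_mul])
      (fun w z hz => by
        obtain ⟨hw, he⟩ := hQw w
        rw [he] at hz
        exact h w z (hasEigenvalue_of_mapQ hw hz)) q hq
    obtain ⟨C, hC⟩ := berger_wang_of_invariant a W hW hq.le hβ hCW hCQ
    refine ⟨max C 0 * (1 + 1 / (q - 1)), fun w v => (hC w v).trans ?_⟩
    have hq1 : 0 < q - 1 := by linarith
    have hbern : (1 + w.length : ℝ) ≤ (1 + 1 / (q - 1)) * q ^ w.length := by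
      have h1 : 1 + (w.length : ℝ) * (q - 1) ≤ q ^ w.length := by
        have := one_add_mul_le_pow (a := q - 1) (by linarith) w.length
        simpa using this
      have h2 : (w.length : ℝ) ≤ 1 / (q - 1) * q ^ w.length := by
        rw [one_div, ← div_eq_inv_mul, le_div_iff₀ hq1]
        linarith
      have h3 : 1 ≤ q ^ w.length := one_le_pow₀ hq.le
      linarith
    calc C * (1 + w.length) * q ^ w.length * ‖v‖
        ≤ max C 0 * ((1 + 1 / (q - 1)) * q ^ w.length) * q ^ w.length * ‖v‖ := by
          gcongr
          exact le_max_left _ _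
      _ = max C 0 * (1 + 1 / (q - 1)) * r ^ w.length * ‖v‖ := by
          rw [← hqq, mul_pow]; ring

/-- **Berger–Wang theorem**, for operators on a finite-dimensional complex space: if all products of
a bounded family of operators have spectral radius at most one, then products of length `n`
are `O(r ^ n)` for all `r > 1`. -/
theorem berger_wang {V : Type u} [NormedAddCommGroup V] [NormedSpace ℂ V]
    [FiniteDimensional ℂ V] (a : ι → End ℂ V) {β : ℝ} (hβ : ∀ i v, ‖a i v‖ ≤ β * ‖v‖)
    (h : ∀ (w : List ι) z, ((w.map a).prod).HasEigenvalue z → ‖z‖ ≤ 1) {r : ℝ} (hr : 1 < r) :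
    ∃ C, ∀ (w : List ι) v, ‖(w.map a).prod v‖ ≤ C * r ^ w.length * ‖v‖ :=
  berger_wang_aux _ V rfl a β hβ h r hr

end BergerWangNormed

/-! ### Spectra, powers and exponentials of real matrices -/

section MatrixSpectrum

open scoped Matrix.Norms.L2Operator
open Matrix

variable {m n : Type*} [Fintype m] [DecidableEq m] [Fintype n] [DecidableEq n]

/-- The complex spectrum of a real matrix. -/
abbrev Matrix.complexSpectrum (A : Matrix n n ℝ) : Set ℂ :=
  spectrum ℂ (A.map (algebraMap ℝ ℂ))

/-- Termwise in the exponential series. The rectangular `I` covers conjugations, projections, block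
inclusions and eigenvectors at once. -/
theorem Matrix.exp_mul_of_intertwine {𝕜 : Type*} [RCLike 𝕜] {X : Matrix m m 𝕜} {Y : Matrix n n 𝕜}
    {I : Matrix m n 𝕜} (h : X * I = I * Y) : NormedSpace.exp X * I = I * NormedSpace.exp Y := by
  have hpow : ∀ k : ℕ, X ^ k * I = I * Y ^ k := by
    intro k
    induction k with
    | zero => simp
    | succ k ih => rw [pow_succ, Matrix.mul_assoc, h, ← Matrix.mul_assoc, ih, pow_succ,
        Matrix.mul_assoc]
  have h1 := (NormedSpace.exp_series_hasSum_exp' (𝕂 := 𝕜) X).map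
    (AddMonoidHom.mk' (fun A : Matrix m m 𝕜 => A * I) fun A B => Matrix.add_mul A B I)
    (continuous_id.matrix_mul continuous_const)
  have h2 := (NormedSpace.exp_series_hasSum_exp' (𝕂 := 𝕜) Y).map
    (AddMonoidHom.mk' (fun A : Matrix n n 𝕜 => I * A) fun A B => Matrix.mul_add I A B)
    (continuous_const.matrix_mul continuous_id)
  refine h1.unique ?_
  convert! h2 using 1
  funext k
  simp [hpow]

theorem Matrix.exists_norm_le_norm_map :
    ∃ c : ℝ, 0 < c ∧ ∀ A : Matrix n n ℝ, ‖A‖ ≤ c * ‖A.map (algebraMap ℝ ℂ)‖ := by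
  let L : Matrix n n ℂ →ₗ[ℝ] Matrix n n ℝ := Complex.reLm.mapMatrix
  let L' := LinearMap.toContinuousLinearMap L
  refine ⟨‖L'‖ + 1, by positivity, fun A => ?_⟩
  have h : L' (A.map (algebraMap ℝ ℂ)) = A := by
    ext i j; simp [L', L]
  calc ‖A‖ = ‖L' (A.map (algebraMap ℝ ℂ))‖ := by rw [h]
    _ ≤ ‖L'‖ * ‖A.map (algebraMap ℝ ℂ)‖ := L'.le_opNorm _
    _ ≤ _ := by gcongr; linarith

theorem Matrix.exists_norm_map_le_norm :
    ∃ c : ℝ, 0 < c ∧ ∀ A : Matrix n n ℝ, ‖A.map (algebraMap ℝ ℂ)‖ ≤ c * ‖A‖ := by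
  let L : Matrix n n ℝ →ₗ[ℝ] Matrix n n ℂ := (Algebra.linearMap ℝ ℂ).mapMatrix
  let L' := LinearMap.toContinuousLinearMap L
  refine ⟨‖L'‖ + 1, by positivity, fun A => ?_⟩
  calc ‖A.map (algebraMap ℝ ℂ)‖ = ‖L' A‖ := rfl
    _ ≤ ‖L'‖ * ‖A‖ := L'.le_opNorm _
    _ ≤ _ := by gcongr; linarith

theorem Matrix.map_pow_algebraMap (A : Matrix n n ℝ) (k : ℕ) :
    (A ^ k).map (algebraMap ℝ ℂ) = (A.map (algebraMap ℝ ℂ)) ^ k :=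
  map_pow (algebraMap ℝ ℂ).mapMatrix A k

/-- Spectral values of a real matrix bound the growth of its powers from below. -/
theorem Matrix.exists_pow_norm_le_norm_pow :
    ∃ c : ℝ, 0 < c ∧ ∀ (A : Matrix n n ℝ), ∀ z ∈ A.complexSpectrum, ∀ k : ℕ,
      ‖z‖ ^ k ≤ c * ‖A ^ k‖ := by
  obtain ⟨c, hc, h⟩ := Matrix.exists_norm_map_le_norm (n := n)
  refine ⟨c * (‖(1 : Matrix n n ℂ)‖ + 1), by positivity, fun A z hz k => ?_⟩
  have h1 := spectrum.norm_le_norm_mul_of_mem (spectrum.pow_mem_pow _ k hz)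
  rw [← Matrix.map_pow_algebraMap, norm_pow] at h1
  calc ‖z‖ ^ k ≤ _ := h1
    _ ≤ (c * ‖A ^ k‖) * (‖(1 : Matrix n n ℂ)‖ + 1) := by
      gcongr
      · exact h _
      · linarith
    _ = _ := by ring

/-- Powers of a matrix with spectral radius less than one tend to zero. -/
theorem Matrix.tendsto_pow_of_complexSpectrum_lt_one [Nonempty n] (A : Matrix n n ℝ)
    (h : ∀ z ∈ A.complexSpectrum, ‖z‖ < 1) : Tendsto (fun k : ℕ => ‖A ^ k‖) atTop (𝓝 0) := by
  set B := A.map (algebraMap ℝ ℂ)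
  have hρ : spectralRadius ℂ B < (1 : NNReal) :=
    spectrum.spectralRadius_lt_of_forall_lt B fun z hz => by
      have := h z hz
      rw [← NNReal.coe_lt_coe]; simpa using this
  obtain ⟨q, hq1, hq2⟩ := ENNReal.lt_iff_exists_nnreal_btwn.mp hρ
  have hq2' : q < 1 := by exact_mod_cast hq2
  have hev := (spectrum.pow_nnnorm_pow_one_div_tendsto_nhds_spectralRadius B).eventually_lt_const hq1
  obtain ⟨c, hc, hcA⟩ := Matrix.exists_norm_le_norm_map (n := n)
  have hle : ∀ᶠ k : ℕ in atTop, ‖A ^ k‖ ≤ c * (q : ℝ) ^ k := by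
    filter_upwards [hev, eventually_gt_atTop 0] with k hk hk0
    refine (hcA _).trans ?_
    rw [Matrix.map_pow_algebraMap]
    gcongr
    have h1 : (‖B ^ k‖₊ : ENNReal) ≤ (q : ENNReal) ^ k := by
      have := ENNReal.rpow_le_rpow hk.le (z := (k : ℝ)) (by positivity)
      rw [← ENNReal.rpow_mul, one_div, inv_mul_cancel₀ (by positivity), ENNReal.rpow_one,
        ENNReal.rpow_natCast] at this
      exact this
    have h2 : ‖B ^ k‖₊ ≤ q ^ k := by exact_mod_cast h1
    exact_mod_cast h2
  refine squeeze_zero' (Eventually.of_forall fun k => norm_nonneg _) hle ?_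
  have := (tendsto_pow_atTop_nhds_zero_of_lt_one q.coe_nonneg (by exact_mod_cast hq2')).const_mul c
  simpa using this

/-- Lower semicontinuity of the spectral radius. -/
theorem Matrix.eventually_exists_complexSpectrum_gt {ι : Type*} {l : Filter ι}
    {A : ι → Matrix n n ℝ} {A₀ : Matrix n n ℝ} (hA : Tendsto A l (𝓝 A₀)) {z : ℂ} {r : ℝ}
    (hz : z ∈ A₀.complexSpectrum) (hr : r < ‖z‖) :
    ∀ᶠ i in l, ∃ y ∈ (A i).complexSpectrum, r < ‖y‖ := by
  set p : Matrix n n ℝ → ℂ := fun B => (B.map (algebraMap ℝ ℂ)).charpoly.eval z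
  have hp : Continuous p := by
    simp only [p, Matrix.eval_charpoly]
    refine Continuous.matrix_det (continuous_const.sub ?_)
    exact continuous_id.matrix_map Complex.continuous_ofReal
  have hp0 : p A₀ = 0 := Matrix.mem_spectrum_iff_isRoot_charpoly.mp hz
  have hpos : 0 < (‖z‖ - r) ^ Fintype.card n := pow_pos (by linarith) _
  have hlim : Tendsto (fun i => ‖p (A i)‖) l (𝓝 0) := by
    have := (hp.norm.tendsto A₀).comp hA
    rwa [hp0, norm_zero] at this
  filter_upwards [hlim.eventually_lt_const hpos] with i hi
  -- If all spectral values of `A i` had modulus at most r, every factor z − y of its characteristic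
  -- polynomial at z would have modulus at least ‖z‖ − r, whereas the value at z tends to 0.
  by_contra! hcon
  refine absurd hi (not_lt.mpr ?_)
  set B := (A i).map (algebraMap ℝ ℂ)
  have hs : B.charpoly.Splits := IsAlgClosed.splits _
  have hcard : B.charpoly.roots.card = Fintype.card n := by
    rw [← hs.natDegree_eq_card_roots, Matrix.charpoly_natDegree_eq_dim]
  simp only [p]
  rw [hs.eval_eq_prod_roots_of_monic (Matrix.charpoly_monic B), ← hcard]
  have hroots : ∀ y ∈ B.charpoly.roots, ‖z‖ - r ≤ ‖z - y‖ := fun y hy => by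
    have h1 : ‖y‖ ≤ r := hcon y
      (Matrix.mem_spectrum_iff_isRoot_charpoly.mpr (Polynomial.mem_roots'.mp hy).2)
    have := norm_sub_norm_le z y
    linarith
  generalize B.charpoly.roots = s at hroots
  induction s using Multiset.induction_on with
  | empty => simp
  | cons y s ih =>
    rw [Multiset.card_cons, pow_succ, Multiset.map_cons, Multiset.prod_cons, norm_mul, mul_comm]
    exact mul_le_mul (hroots y (Multiset.mem_cons_self y s))
      (ih fun x hx => hroots x (Multiset.mem_cons_of_mem hx)) (pow_nonneg (by linarith) _)
      (norm_nonneg _)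

/-- **Berger–Wang theorem** for real matrices. -/
theorem Matrix.berger_wang {ι : Type*} (a : ι → Matrix n n ℝ) {β : ℝ} (hβ : ∀ i, ‖a i‖ ≤ β)
    (h : ∀ (w : List ι), ∀ z ∈ ((w.map a).prod).complexSpectrum, ‖z‖ ≤ 1) {r : ℝ} (hr : 1 < r) :
    ∃ C, ∀ w : List ι, ‖(w.map a).prod‖ ≤ C * r ^ w.length := by
  let e : Matrix n n ℝ → Module.End ℂ (EuclideanSpace ℂ n) := fun A =>
    Matrix.toLpLin 2 2 (A.map (algebraMap ℝ ℂ))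
  have hmul : ∀ A B, e (A * B) = e A * e B := fun A B => by
    have : (A * B).map (algebraMap ℝ ℂ) = A.map (algebraMap ℝ ℂ) * B.map (algebraMap ℝ ℂ) :=
      Matrix.map_mul
    ext x i
    simp only [e, this, Matrix.toLpLin_apply, Module.End.mul_apply, Matrix.mulVec_mulVec]
  have hone : e 1 = 1 := by
    ext x i
    simp [e, Matrix.map_one]
  have hprod : ∀ w : List ι, (w.map fun i => e (a i)).prod = e (w.map a).prod := by
    intro w
    induction w with
    | nil => simp [hone]
    | cons i w ih => simp [ih, hmul]
  have hnorm : ∀ A x, ‖e A x‖ ≤ ‖A.map (algebraMap ℝ ℂ)‖ * ‖x‖ := fun A x =>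
    Matrix.l2_opNorm_mulVec _ x
  obtain ⟨c, hc, hc'⟩ := Matrix.exists_norm_map_le_norm (n := n)
  obtain ⟨c2, hc2, hc2'⟩ := Matrix.exists_norm_le_norm_map (n := n)
  obtain ⟨C, hC⟩ := _root_.berger_wang (fun i => e (a i)) (β := c * β) (fun i v => by
      refine (hnorm _ v).trans ?_
      gcongr
      exact (hc' _).trans (by gcongr; exact hβ i)) (fun w z hz => by
      rw [hprod, Module.End.hasEigenvalue_iff_mem_spectrum, Matrix.spectrum_toLpLin] at hz
      exact h w z hz) hr
  refine ⟨c2 * max C 0, fun w => (hc2' _).trans ?_⟩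
  rw [mul_assoc]
  gcongr
  rw [Matrix.l2_opNorm_def]
  refine ContinuousLinearMap.opNorm_le_bound _ (by positivity) fun v => ?_
  have := hC w v
  rw [hprod] at this
  refine this.trans ?_
  gcongr
  exact le_max_left _ _

theorem Matrix.map_exp_algebraMap (A : Matrix n n ℝ) :
    (NormedSpace.exp A).map (algebraMap ℝ ℂ) = NormedSpace.exp (A.map (algebraMap ℝ ℂ)) := by
  let : NormedAlgebra ℚ (Matrix n n ℝ) := .restrictScalars ℚ ℝ _
  exact NormedSpace.map_exp (algebraMap ℝ ℂ).mapMatrix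
    (continuous_id.matrix_map Complex.continuous_ofReal) A

/-- The matrix commutes with its exponential, hence preserves the eigenspace for z and has an
eigenvector v there, with eigenvalue y say. On v the exponential acts both as z and as e^y. -/
theorem Matrix.exists_exp_eq_of_mem_complexSpectrum_exp {A : Matrix n n ℝ} {z : ℂ}
    (hz : z ∈ (NormedSpace.exp A).complexSpectrum) : ∃ y ∈ A.complexSpectrum, z = Complex.exp y := by
  unfold complexSpectrum at *
  rw [Matrix.map_exp_algebraMap] at hz
  set B := A.map (algebraMap ℝ ℂ)
  rw [← Matrix.spectrum_toLin', ← Module.End.hasEigenvalue_iff_mem_spectrum] at hz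
  set E := Module.End.genEigenspace (toLin' (NormedSpace.exp B)) z 1
  have hcomm : Commute (toLin' (NormedSpace.exp B)) (toLin' B) := by
    have : NormedSpace.exp B * B = B * NormedSpace.exp B := Matrix.exp_mul_of_intertwine rfl
    rw [Commute, SemiconjBy, Module.End.mul_eq_comp, Module.End.mul_eq_comp, ← Matrix.toLin'_mul,
      ← Matrix.toLin'_mul, this]
  have hmaps := Module.End.mapsTo_genEigenspace_of_comm hcomm z 1
  have hne : Nontrivial E := (Submodule.nontrivial_iff_ne_bot).mpr hz
  obtain ⟨y, hy⟩ := Module.End.exists_eigenvalue ((toLin' B).restrict hmaps)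
  obtain ⟨v, hv⟩ := hy.exists_hasEigenvector
  have hBv : B *ᵥ (v : n → ℂ) = y • (v : n → ℂ) :=
    congrArg Subtype.val hv.apply_eq_smul
  have hEv : NormedSpace.exp B *ᵥ (v : n → ℂ) = z • (v : n → ℂ) := by
    have := v.2
    rw [Module.End.mem_genEigenspace_one] at this
    simpa using this
  have hv0 : (v : n → ℂ) ≠ 0 := fun h => hv.2 (Subtype.ext h)
  refine ⟨y, ?_, ?_⟩
  · rw [← Matrix.spectrum_toLin', ← Module.End.hasEigenvalue_iff_mem_spectrum]
    refine Module.End.hasEigenvalue_of_hasEigenvector (x := (v : n → ℂ))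
      ⟨Module.End.mem_eigenspace_iff.mpr ?_, hv0⟩
    simpa using hBv
  · have hint : B * replicateCol Unit (v : n → ℂ) =
        replicateCol Unit (v : n → ℂ) * diagonal fun _ : Unit => y := by
      ext i j
      have := congrFun hBv i
      simp only [Matrix.mul_diagonal, replicateCol_apply]
      rw [mul_comm]
      exact this
    have h2 := Matrix.exp_mul_of_intertwine hint
    rw [Matrix.exp_diagonal] at h2
    obtain ⟨i, hi⟩ := Function.ne_iff.mp hv0
    have h3 := congrFun (congrFun h2 i) ()
    have h4 : (NormedSpace.exp B * replicateCol Unit (v : n → ℂ)) i () =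
        (NormedSpace.exp B *ᵥ (v : n → ℂ)) i := rfl
    rw [h4, hEv, Matrix.mul_diagonal, Pi.coe_exp, ← Complex.exp_eq_exp_ℂ] at h3
    simp only [replicateCol_apply, Pi.smul_apply, smul_eq_mul] at h3
    have h5 : (v : n → ℂ) i ≠ 0 := hi
    exact mul_right_cancel₀ h5 (h3.trans (mul_comm _ _))

/-- On a compact set, powers of matrices with spectral radius less than one decay uniformly. -/
theorem exists_norm_pow_le_of_isCompact {X : Type*} [TopologicalSpace X] [Nonempty n] {K : Set X}
    (hK : IsCompact K) {b : X → Matrix n n ℝ} (hb : ContinuousOn b K)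
    (h : ∀ x ∈ K, ∀ z ∈ (b x).complexSpectrum, ‖z‖ < 1) :
    ∃ C ρ : ℝ, 0 < C ∧ 0 < ρ ∧ ρ < 1 ∧ ∀ x ∈ K, ∀ k : ℕ, ‖b x ^ k‖ ≤ C * ρ ^ k := by
  refine hK.induction_on (p := fun S => ∃ C ρ : ℝ, 0 < C ∧ 0 < ρ ∧ ρ < 1 ∧
    ∀ x ∈ S, ∀ k : ℕ, ‖b x ^ k‖ ≤ C * ρ ^ k) ⟨1, 1 / 2, by norm_num, by norm_num, by norm_num,
      fun x hx => hx.elim⟩ ?_ ?_ ?_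
  · rintro S S' hS ⟨C, ρ, h1, h2, h3, h4⟩
    exact ⟨C, ρ, h1, h2, h3, fun x hx => h4 x (hS hx)⟩
  · rintro S S' ⟨C, ρ, h1, h2, h3, h4⟩ ⟨C', ρ', h1', h2', h3', h4'⟩
    refine ⟨max C C', max ρ ρ', lt_max_of_lt_left h1, lt_max_of_lt_left h2, max_lt h3 h3', ?_⟩
    rintro x (hx | hx) k
    · exact (h4 x hx k).trans (by gcongr <;> exact le_max_left _ _)
    · exact (h4' x hx k).trans (by gcongr <;> exact le_max_right _ _)
  · intro x hx
    have ht := Matrix.tendsto_pow_of_complexSpectrum_lt_one (b x) (h x hx)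
    obtain ⟨k, hk, hk0⟩ := ((ht.eventually_lt_const (show (0 : ℝ) < 1 / 2 by norm_num)).and
      (eventually_gt_atTop 0)).exists
    set β := max 1 (‖b x‖ + 1)
    have hβ1 : 1 ≤ β := le_max_left _ _
    -- ρ is the k-th root of 1/2, so that the bound ‖b y ^ k‖ < 1/2, which persists near x, reads as
    -- decay at rate ρ per step.
    obtain ⟨ρ, hρ0, hρ1, hρk⟩ : ∃ ρ : ℝ, 0 < ρ ∧ ρ < 1 ∧ 1 / 2 ≤ ρ ^ k := by
      refine ⟨(1 / 2 : ℝ) ^ ((1 : ℝ) / k), by positivity, ?_, ?_⟩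
      · exact Real.rpow_lt_one (by norm_num) (by norm_num) (by positivity)
      · rw [← Real.rpow_natCast, ← Real.rpow_mul (by norm_num), one_div (k : ℝ),
          inv_mul_cancel₀ (by positivity), Real.rpow_one]
    have hcont : ContinuousWithinAt b K x := hb x hx
    have hnear : ∀ᶠ y in 𝓝[K] x, ‖b y ^ k‖ < 1 / 2 ∧ ‖b y‖ < ‖b x‖ + 1 :=
      ((hcont.pow k).norm.eventually_lt_const hk).and
        (hcont.norm.eventually_lt_const (by linarith))
    -- The constant pays for the remainder of the exponent modulo k: at most k factors, each bounded
    -- by β instead of ρ.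
    refine ⟨_, hnear, (β / ρ) ^ k, ρ, by positivity, hρ0, hρ1, ?_⟩
    rintro y ⟨hy1, hy2⟩ j
    have hyβ : ‖b y‖ ≤ β := hy2.le.trans (le_max_right _ _)
    obtain ⟨q, i, hi, rfl⟩ : ∃ q i, i ≤ k ∧ j = k * q + i :=
      ⟨j / k, j % k, (Nat.mod_lt j hk0).le, (Nat.div_add_mod j k).symm⟩
    calc ‖b y ^ (k * q + i)‖ = ‖(b y ^ k) ^ q * b y ^ i‖ := by rw [← pow_mul, ← pow_add]
      _ ≤ (ρ ^ k) ^ q * β ^ i := by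
          refine (norm_mul_le _ _).trans ?_
          gcongr
          · refine (norm_pow_le _ _).trans ?_
            gcongr
            exact hy1.le.trans hρk
          · refine (norm_pow_le _ _).trans ?_
            gcongr
      _ = (β / ρ) ^ i * ρ ^ (k * q + i) := by
          rw [pow_add, pow_mul, div_pow]
          field_simp
      _ ≤ _ := by
          gcongr
          rw [le_div_iff₀ hρ0]; linarith

end MatrixSpectrum

/-! ### Singular perturbation of one linear flow -/

section SingularPerturbation

open scoped Matrix.Norms.L2Operator
open Matrix NormedSpace

variable {n : Type*} [Fintype n] [DecidableEq n]

/-- Variation of constants in differential form: the estimates below compare derivatives of norms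
and avoid matrix-valued integrals. -/
theorem Matrix.hasDerivAt_exp_sub_smul_mul (X A : Matrix n n ℝ) {f : ℝ → Matrix n n ℝ}
    {s : ℝ} (t : ℝ) (hf : HasDerivAt f (X * f s + A) s) :
    HasDerivAt (fun u => exp ((t - u) • X) * f u) (exp ((t - s) • X) * A) s := by
  have h1 : HasDerivAt (fun u => exp ((t - u) • X)) (-(exp ((t - s) • X) * X)) s := by
    have := (hasDerivAt_exp_smul_const (𝕂 := ℝ) X (t - s)).scomp s
      ((hasDerivAt_id s).const_sub t)
    simpa using! this
  convert! h1.mul hf using 1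
  rw [mul_add, neg_mul, mul_assoc]
  abel

theorem Matrix.norm_exp_smul_le [Nonempty n] (A : Matrix n n ℝ) {h t : ℝ} (hA : ‖A‖ ≤ h)
    (ht : 0 ≤ t) : ‖exp (t • A)‖ ≤ Real.exp (h * t) := by
  have := norm_le_gronwallBound_of_norm_deriv_right_le (f := fun s => exp (s • A))
    (f' := fun s => A * exp (s • A)) (δ := 1) (K := h) (ε := 0) (a := 0) (b := t)
    (fun s _ => (hasDerivAt_exp_smul_const' (𝕂 := ℝ) A s).continuousAt.continuousWithinAt)
    (fun s _ => (hasDerivAt_exp_smul_const' (𝕂 := ℝ) A s).hasDerivWithinAt)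
    (by simp) (fun s _ => (norm_mul_le _ _).trans (by simpa using by gcongr)) t
    (Set.right_mem_Icc.mpr ht)
  simpa [gronwallBound_ε0] using this

/-- Bounded perturbation of a bounded semigroup. -/
theorem Matrix.norm_exp_add_smul_le (X H : Matrix n n ℝ) {C h t : ℝ}
    (hX : ∀ s : ℝ, 0 ≤ s → ‖exp (s • X)‖ ≤ C) (hH : ‖H‖ ≤ h) (ht : 0 ≤ t) :
    ‖exp (t • (H + X))‖ ≤ C * Real.exp (C * h * t) := by
  have hC : 0 ≤ C := (norm_nonneg _).trans (hX 0 le_rfl)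
  have hh : 0 ≤ h := (norm_nonneg _).trans hH
  set Y : ℝ → Matrix n n ℝ := fun s => exp (s • (H + X)) with hY
  have hYd : ∀ s, HasDerivAt Y (X * Y s + H * Y s) s := fun s => by
    have := hasDerivAt_exp_smul_const' (𝕂 := ℝ) (H + X) s
    convert! this using 1
    rw [add_mul, add_comm]
  have hYc : Continuous Y := continuous_iff_continuousAt.mpr fun s => (hYd s).continuousAt
  -- The right-hand side of Duhamel's inequality. It dominates ‖Y‖, hence g' ≤ C h g, and Grönwall's
  -- lemma is applied to g.
  set g : ℝ → ℝ := fun t => C + ∫ s in (0 : ℝ)..t, C * h * ‖Y s‖ with hg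
  have hgd : ∀ s, HasDerivAt g (C * h * ‖Y s‖) s := fun s =>
    (Continuous.integral_hasStrictDerivAt (by fun_prop) 0 s).hasDerivAt.const_add C
  have hYg : ∀ t, 0 ≤ t → ‖Y t‖ ≤ g t := by
    intro t ht
    have hd := fun s => Matrix.hasDerivAt_exp_sub_smul_mul X (H * Y s) t (hYd s)
    have := image_norm_le_of_norm_deriv_right_le_deriv_boundary (a := 0) (b := t)
      (f := fun s => exp ((t - s) • X) * Y s) (f' := fun s => exp ((t - s) • X) * (H * Y s))
      (B := g) (B' := fun s => C * h * ‖Y s‖)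
      (fun s _ => (hd s).continuousAt.continuousWithinAt)
      (fun s _ => (hd s).hasDerivWithinAt) (by simpa [hg, hY] using hX t ht) hgd
      (fun s hs => by
        refine (norm_mul_le _ _).trans ?_
        rw [mul_assoc]
        gcongr
        · exact hX _ (by linarith [hs.2])
        · exact (norm_mul_le _ _).trans (by gcongr)) (Set.right_mem_Icc.mpr ht)
    simpa using this
  refine (hYg t ht).trans ?_
  have := norm_le_gronwallBound_of_norm_deriv_right_le (f := g)
    (f' := fun s => C * h * ‖Y s‖) (δ := C) (K := C * h) (ε := 0) (a := 0) (b := t)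
    (fun s _ => (hgd s).continuousAt.continuousWithinAt)
    (fun s _ => (hgd s).hasDerivWithinAt)
    (by simp [hg, abs_of_nonneg hC]) (fun s hs => by
      rw [add_zero, Real.norm_of_nonneg (by positivity)]
      gcongr
      exact (hYg s hs.1).trans (le_abs_self _)) t (Set.right_mem_Icc.mpr ht)
  rw [gronwallBound_ε0, sub_zero] at this
  exact (le_abs_self _).trans this

/-- The fast part of a singularly perturbed linear flow decays to the size of `1 / κ`. -/
theorem Matrix.norm_fast_exp_le (Q N H : Matrix n n ℝ) {C c h Y₁ t κ : ℝ}
    (hdecay : ∀ s : ℝ, 0 ≤ s → ‖(1 - Q) * exp (s • N)‖ ≤ C * Real.exp (-c * s))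
    (hc : 0 < c) (hκ : 0 < κ) (ht : 0 ≤ t) (hH : ‖H‖ ≤ h)
    (hY : ∀ s ∈ Set.Icc 0 t, ‖exp (s • (H + κ • N))‖ ≤ Y₁) :
    ‖(1 - Q) * exp (t • (H + κ • N))‖ ≤
      C * Real.exp (-c * (κ * t)) + C * h * Y₁ / (c * κ) := by
  have hC : 0 ≤ C := by simpa using (norm_nonneg _).trans (hdecay 0 le_rfl)
  have hh : 0 ≤ h := (norm_nonneg _).trans hH
  have hY₁ : 0 ≤ Y₁ := (norm_nonneg _).trans (hY t (Set.right_mem_Icc.mpr ht))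
  set Y : ℝ → Matrix n n ℝ := fun s => exp (s • (H + κ • N)) with hYdef
  have hYd : ∀ s, HasDerivAt Y ((κ • N) * Y s + H * Y s) s := fun s => by
    have := hasDerivAt_exp_smul_const' (𝕂 := ℝ) (H + κ • N) s
    convert! this using 1
    rw [add_mul, add_comm]
  have hd := fun s => (Matrix.hasDerivAt_exp_sub_smul_mul (κ • N) (H * Y s) t
    (hYd s)).const_mul (1 - Q)
  have hexp : ∀ s, s ≤ t → ‖(1 - Q) * exp ((t - s) • κ • N)‖ ≤
      C * Real.exp (-c * (κ * (t - s))) := fun s hs => by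
    rw [smul_smul, mul_comm (t - s)]
    exact hdecay _ (mul_nonneg hκ.le (by linarith))
  -- An explicit antiderivative of the Duhamel integrand C h Y₁ e^{-cκ(t - s)}; the decay of the
  -- fast semigroup is what produces the factor 1/(cκ).
  have hB : ∀ s, HasDerivAt (fun s => C * Real.exp (-c * (κ * t)) +
      C * h * Y₁ / (c * κ) * Real.exp (-c * (κ * (t - s))))
      (C * h * Y₁ * Real.exp (-c * (κ * (t - s)))) s := fun s => by
    have h1 : HasDerivAt (fun s => -c * (κ * (t - s))) (c * κ) s := by
      have := (((hasDerivAt_id s).const_sub t).const_mul κ).const_mul (-c)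
      simpa using! this
    have := (h1.exp.const_mul (C * h * Y₁ / (c * κ))).const_add (C * Real.exp (-c * (κ * t)))
    convert! this using 1
    field_simp
  have := image_norm_le_of_norm_deriv_right_le_deriv_boundary (a := 0) (b := t)
    (fun s _ => (hd s).continuousAt.continuousWithinAt)
    (fun s _ => (hd s).hasDerivWithinAt)
    (by
      have := hexp 0 ht
      simp only [sub_zero] at this
      simp only [sub_zero, hYdef, zero_smul, exp_zero, mul_one]
      refine this.trans (le_add_of_nonneg_right (by positivity))) hB
    (fun s hs => by
      rw [← mul_assoc]
      calc _ ≤ ‖(1 - Q) * exp ((t - s) • κ • N)‖ * ‖H * Y s‖ := norm_mul_le _ _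
        _ ≤ (C * Real.exp (-c * (κ * (t - s)))) * (h * Y₁) := by
          gcongr
          · exact hexp s hs.2.le
          · exact (norm_mul_le _ _).trans (by gcongr; exact hY s ⟨hs.1, hs.2.le⟩)
        _ = _ := by ring) (Set.right_mem_Icc.mpr ht)
  simpa only [sub_self, mul_zero, Real.exp_zero, mul_one, zero_smul, exp_zero, one_mul] using this

/-- The slow part of a singularly perturbed linear flow is close to the reduced flow. -/
theorem Matrix.norm_slow_exp_sub_le [Nonempty n] (Q N H : Matrix n n ℝ) {C c h Y₁ t κ : ℝ}
    (hQQ : Q * Q = Q) (hQN : Q * N = 0) (hQ : ‖Q‖ ≤ 1)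
    (hdecay : ∀ s : ℝ, 0 ≤ s → ‖(1 - Q) * exp (s • N)‖ ≤ C * Real.exp (-c * s))
    (hc : 0 < c) (hκ : 0 < κ) (ht : 0 ≤ t) (hH : ‖H‖ ≤ h)
    (hY : ∀ s ∈ Set.Icc 0 t, ‖exp (s • (H + κ • N))‖ ≤ Y₁) :
    ‖Q * exp (t • (H + κ • N)) - exp (t • (Q * H * Q)) * Q‖ ≤
      Real.exp (h * t) * h * (C + C * h * Y₁ * t) / (c * κ) := by
  have hC : 0 ≤ C := by simpa using (norm_nonneg _).trans (hdecay 0 le_rfl)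
  have hh : 0 ≤ h := (norm_nonneg _).trans hH
  have hY₁ : 0 ≤ Y₁ := (norm_nonneg _).trans (hY t (Set.right_mem_Icc.mpr ht))
  set Y : ℝ → Matrix n n ℝ := fun s => exp (s • (H + κ • N)) with hYdef
  set G := Q * H * Q with hG
  have hGn : ‖G‖ ≤ h := by
    calc ‖G‖ ≤ ‖Q‖ * ‖H‖ * ‖Q‖ := (norm_mul_le _ _).trans (by gcongr; exact norm_mul_le _ _)
      _ ≤ 1 * h * 1 := by gcongr
      _ = h := by ring
  set Δ : ℝ → Matrix n n ℝ := fun s => Q * Y s - exp (s • G) * Q with hΔ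
  have hYd : ∀ s, HasDerivAt Y ((H + κ • N) * Y s) s :=
    hasDerivAt_exp_smul_const' (𝕂 := ℝ) (H + κ • N)
  -- Since QN = 0, the large term disappears and only the fast component forces Δ. That component
  -- need not be small near s = 0, but its integral is O(1/κ).
  have hΔd : ∀ s, HasDerivAt Δ (G * Δ s + Q * H * ((1 - Q) * Y s)) s := fun s => by
    have h1 := ((hYd s).const_mul Q).sub
      ((hasDerivAt_exp_smul_const' (𝕂 := ℝ) G s).mul_const Q)
    convert! h1 using 1
    have e1 : Q * ((H + κ • N) * Y s) = Q * H * Y s := by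
      rw [← mul_assoc, mul_add, mul_smul_comm, hQN, smul_zero, add_zero]
    have e2 : G * (Q * Y s) = Q * H * (Q * Y s) := by
      rw [hG, mul_assoc (Q * H) Q, ← mul_assoc Q Q, hQQ]
    rw [e1, hΔ]
    simp only [mul_sub, sub_mul, e2, one_mul]
    rw [mul_assoc G]
    abel
  have hd := fun s => Matrix.hasDerivAt_exp_sub_smul_mul G _ t (hΔd s)
  have hB : ∀ s, HasDerivAt (fun s => Real.exp (h * t) * h * (C / (c * κ) *
      (1 - Real.exp (-c * (κ * s))) + C * h * Y₁ / (c * κ) * s))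
      (Real.exp (h * t) * h * (C * Real.exp (-c * (κ * s)) + C * h * Y₁ / (c * κ))) s :=
    fun s => by
    have h1 : HasDerivAt (fun s => -c * (κ * s)) (-c * κ) s := by
      have := ((hasDerivAt_id s).const_mul κ).const_mul (-c)
      simpa using! this
    have h2 := ((h1.exp.const_sub 1).const_mul (C / (c * κ))).add
      ((hasDerivAt_id s).const_mul (C * h * Y₁ / (c * κ)))
    have := h2.const_mul (Real.exp (h * t) * h)
    convert! this using 1
    field_simp
  have := image_norm_le_of_norm_deriv_right_le_deriv_boundary (a := 0) (b := t)
    (fun s _ => (hd s).continuousAt.continuousWithinAt)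
    (fun s _ => (hd s).hasDerivWithinAt) (by simp [hΔ, hYdef]) hB
    (fun s hs => by
      have hfast := Matrix.norm_fast_exp_le Q N H hdecay hc hκ hs.1 hH
        (fun u hu => hY u ⟨hu.1, hu.2.trans hs.2.le⟩)
      have hexp : ‖exp ((t - s) • G)‖ ≤ Real.exp (h * t) :=
        (Matrix.norm_exp_smul_le G hGn (by linarith [hs.2])).trans (by
          gcongr; linarith [hs.1])
      calc _ ≤ ‖exp ((t - s) • G)‖ * (‖Q‖ * ‖H‖ * ‖(1 - Q) * Y s‖) := by
            refine (norm_mul_le _ _).trans ?_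
            gcongr
            refine (norm_mul_le _ _).trans ?_
            gcongr
            exact norm_mul_le _ _
        _ ≤ Real.exp (h * t) * (1 * h *
            (C * Real.exp (-c * (κ * s)) + C * h * Y₁ / (c * κ))) := by gcongr
        _ = _ := by ring) (Set.right_mem_Icc.mpr ht)
  have hend : exp ((t - t) • G) * Δ t = Δ t := by simp
  simp only [hend] at this
  refine this.trans ?_
  have he : 0 < Real.exp (-c * (κ * t)) := Real.exp_pos _
  calc _ ≤ Real.exp (h * t) * h * (C / (c * κ) * 1 + C * h * Y₁ / (c * κ) * t) := by
        gcongr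
        linarith
    _ = _ := by ring

/-- **Singular perturbation estimate**, with constants that depend only on the bounds. -/
theorem Matrix.exists_norm_exp_sub_le [Nonempty n] {C c h τ t₁ : ℝ} (hc : 0 < c) (hτ : 0 < τ)
    (hC : 0 ≤ C) (hh : 0 ≤ h) :
    ∃ Y₁ k : ℝ, ∀ Q N H : Matrix n n ℝ, Q * Q = Q → Q * N = 0 → N * Q = 0 → ‖Q‖ ≤ 1 →
      (∀ s : ℝ, 0 ≤ s → ‖(1 - Q) * exp (s • N)‖ ≤ C * Real.exp (-c * s)) → ‖H‖ ≤ h →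
      ∀ κ : ℝ, 0 < κ → ∀ t : ℝ, 0 ≤ t → t ≤ t₁ →
        ‖exp (t • (H + κ • N))‖ ≤ Y₁ ∧
        (τ ≤ t → ‖exp (t • (H + κ • N)) - exp (t • (Q * H * Q)) * Q‖ ≤ k / κ) := by
  set Y₁ := (1 + C) * Real.exp ((1 + C) * h * t₁) with hY₁
  refine ⟨Y₁, (Real.exp (h * t₁) * h * (C + C * h * Y₁ * t₁) / c) + (C / (c * τ) + C * h * Y₁ / c),
    fun Q N H hQQ hQN hNQ hQ hdecay hH κ hκ t ht htt₁ => ?_⟩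
  have hbase : ∀ s : ℝ, 0 ≤ s → ‖exp (s • κ • N)‖ ≤ 1 + C := by
    intro s hs
    have h1 : exp (s • κ • N) = Q + (1 - Q) * exp ((κ * s) • N) := by
      have : Q * exp ((κ * s) • N) = Q := by
        have h2 := Matrix.exp_mul_of_intertwine (X := (0 : Matrix n n ℝ)) (Y := (κ * s) • N) (I := Q)
          (by rw [zero_mul, mul_smul_comm, hQN, smul_zero])
        rw [← h2, exp_zero, one_mul]
      rw [sub_mul, this, smul_smul, mul_comm s]
      simp
    rw [h1]
    refine (norm_add_le _ _).trans (add_le_add hQ ((hdecay _ (by positivity)).trans ?_))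
    refine mul_le_of_le_one_right hC (Real.exp_le_one_iff.mpr ?_)
    have : 0 ≤ κ * s := by positivity
    nlinarith
  have hY : ∀ s ∈ Set.Icc 0 t, ‖exp (s • (H + κ • N))‖ ≤ Y₁ := fun s hs => by
    refine (Matrix.norm_exp_add_smul_le (κ • N) H hbase hH hs.1).trans ?_
    rw [hY₁]
    gcongr
    linarith [hs.2]
  have hY₁0 : 0 ≤ Y₁ := by positivity
  have ht₁ : 0 ≤ t₁ := ht.trans htt₁
  refine ⟨hY t (Set.right_mem_Icc.mpr ht), fun hτt => ?_⟩
  have hfast := Matrix.norm_fast_exp_le Q N H hdecay hc hκ ht hH hY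
  have hslow := Matrix.norm_slow_exp_sub_le Q N H hQQ hQN hQ hdecay hc hκ ht hH hY
  -- This is where t ≥ τ enters: the initial layer e^{-cκt} is O(1/κ) only away from t = 0.
  have hexp : Real.exp (-c * (κ * t)) ≤ 1 / (c * τ) / κ := by
    have h1 : c * τ * κ ≤ Real.exp (c * (κ * t)) := by
      have h2 := Real.add_one_le_exp (c * (κ * t))
      have h3 : c * τ * κ ≤ c * (κ * t) := by
        calc c * τ * κ = c * (κ * τ) := by ring
          _ ≤ _ := by gcongr
      linarith
    rw [div_div, neg_mul, Real.exp_neg, ← one_div]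
    gcongr
  calc ‖exp (t • (H + κ • N)) - exp (t • (Q * H * Q)) * Q‖
      = ‖(Q * exp (t • (H + κ • N)) - exp (t • (Q * H * Q)) * Q) +
          (1 - Q) * exp (t • (H + κ • N))‖ := by
        congr 1; rw [sub_mul, one_mul]; abel
    _ ≤ _ := norm_add_le _ _
    _ ≤ _ := add_le_add hslow hfast
    _ ≤ Real.exp (h * t₁) * h * (C + C * h * Y₁ * t₁) / (c * κ) +
        (C * (1 / (c * τ) / κ) + C * h * Y₁ / (c * κ)) := by gcongr
    _ = _ := by field_simp

end SingularPerturbation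

/-! ### Decoupling slow and fast variables with matrices of fixed size d -/

section SlowFastSplitting

open scoped Matrix.Norms.L2Operator
open Matrix NormedSpace

theorem Matrix.mem_spectrum_iff_exists_mulVec {n : Type*} [Fintype n] [DecidableEq n]
    {A : Matrix n n ℂ} {z : ℂ} : z ∈ spectrum ℂ A ↔ ∃ v, v ≠ 0 ∧ A *ᵥ v = z • v := by
  rw [← Matrix.spectrum_toLin', ← Module.End.hasEigenvalue_iff_mem_spectrum]
  constructor
  · intro h
    obtain ⟨v, hv⟩ := h.exists_hasEigenvector
    exact ⟨v, hv.2, by simpa using hv.apply_eq_smul⟩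
  · rintro ⟨v, hv, h⟩
    exact Module.End.hasEigenvalue_of_hasEigenvector (x := v)
      ⟨Module.End.mem_eigenspace_iff.mpr (by simpa using h), hv⟩

theorem Matrix.IsHurwitz.isUnit_det {n : Type*} [Fintype n] [DecidableEq n] {A : Matrix n n ℝ}
    (h : A.IsHurwitz) : IsUnit A.det := by
  have h0 : (0 : ℂ) ∉ spectrum ℂ (A.map (algebraMap ℝ ℂ)) := fun h0 => by simpa using h 0 h0
  rw [spectrum.zero_notMem_iff, Matrix.isUnit_iff_isUnit_det] at h0
  have h1 : (A.map (algebraMap ℝ ℂ)).det = algebraMap ℝ ℂ A.det :=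
    ((algebraMap ℝ ℂ).map_det A).symm
  rw [h1, isUnit_iff_ne_zero] at h0
  rw [isUnit_iff_ne_zero]
  exact fun h => h0 (by simp [h])

theorem Matrix.continuousAt_inv {n : Type*} [Fintype n] [DecidableEq n] {A : Matrix n n ℝ}
    (h : IsUnit A.det) : ContinuousAt (fun B : Matrix n n ℝ => B⁻¹) A := by
  obtain ⟨u, rfl⟩ := (Matrix.isUnit_iff_isUnit_det A).mpr h
  have h1 : (fun B : Matrix n n ℝ => B⁻¹) = Ring.inverse :=
    funext fun B => Matrix.nonsing_inv_eq_ringInverse B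
  rw [h1]
  exact NormedRing.inverse_continuousAt u

namespace SPMode

variable {d : ℕ} (σ : SPMode d)

/-- The inclusion of the slow variables. -/
def slowIncl : Matrix (Fin d) σ.Slow ℝ := (1 : Matrix (Fin d) (Fin d) ℝ).submatrix id Subtype.val

/-- The inclusion of the fast variables. -/
def fastIncl : Matrix (Fin d) σ.Fast ℝ := (1 : Matrix (Fin d) (Fin d) ℝ).submatrix id Subtype.val

/-- The projection onto the slow variables. -/
def slowProj : Matrix (Fin d) (Fin d) ℝ := diagonal fun i => if (i : ℕ) < σ.ell then 1 else 0

/-- The matrix `Λ P⁻¹`. -/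
def L : Matrix (Fin d) (Fin d) ℝ := σ.Lam * σ.P⁻¹

/-- The fast block of `Λ P⁻¹`, as a matrix of full size. -/
def fastPart : Matrix (Fin d) (Fin d) ℝ := (1 - σ.slowProj) * σ.L * (1 - σ.slowProj)

/-- A matrix of full size whose fast block is `D⁻¹`. -/
def fastInv : Matrix (Fin d) (Fin d) ℝ := (σ.fastPart - σ.slowProj)⁻¹

/-- The nilpotent part of the shear `(I 0; D⁻¹C I)`. -/
def shearPart : Matrix (Fin d) (Fin d) ℝ :=
  σ.fastInv * (1 - σ.slowProj) * σ.L * σ.slowProj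

/-- The bounded part of the dynamics in the coordinates given by `T`. -/
def boundedPart : Matrix (Fin d) (Fin d) ℝ :=
  (1 + σ.shearPart) * (σ.slowProj * σ.L) * (1 - σ.shearPart)

/-- The slow dynamics as a matrix of full size. -/
def slowGen : Matrix (Fin d) (Fin d) ℝ := σ.slowProj * σ.boundedPart * σ.slowProj

theorem slowIncl_mul_transpose : σ.slowIncl * σ.slowInclᵀ = σ.slowProj := by
  ext i j
  simp only [slowIncl, slowProj, mul_apply, submatrix_apply, id, transpose_apply, one_apply,
    diagonal_apply]
  by_cases hi : (i : ℕ) < σ.ell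
  · rw [Finset.sum_eq_single (⟨i, hi⟩ : σ.Slow)]
    · simp [hi, eq_comm]
    · intro b _ hb
      rw [if_neg (fun h => hb (Subtype.ext h.symm)), zero_mul]
    · simp
  · rw [Finset.sum_eq_zero]
    · simp [hi]
    · intro b _
      rw [if_neg (fun h => hi (by rw [h]; exact b.2)), zero_mul]

theorem fastIncl_mul_transpose : σ.fastIncl * σ.fastInclᵀ = 1 - σ.slowProj := by
  ext i j
  simp only [fastIncl, slowProj, mul_apply, submatrix_apply, id, transpose_apply, one_apply,
    diagonal_apply, Matrix.sub_apply]
  by_cases hi : (i : ℕ) < σ.ell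
  · rw [Finset.sum_eq_zero]
    · simp [hi]
    · intro b _
      rw [if_neg (fun h => b.2 (by rw [← h]; exact hi)), zero_mul]
  · rw [Finset.sum_eq_single (⟨i, hi⟩ : σ.Fast)]
    · simp [hi, eq_comm]
    · intro b _ hb
      rw [if_neg (fun h => hb (Subtype.ext h.symm)), zero_mul]
    · simp

theorem transpose_mul_slowIncl : σ.slowInclᵀ * σ.slowIncl = 1 := by
  ext i j
  simp [slowIncl, mul_apply, one_apply, Subtype.ext_iff]

theorem transpose_mul_fastIncl : σ.fastInclᵀ * σ.fastIncl = 1 := by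
  ext i j
  simp [fastIncl, mul_apply, one_apply, Subtype.ext_iff]

theorem slowIncl_transpose_mul_fastIncl : σ.slowInclᵀ * σ.fastIncl = 0 := by
  ext i j
  have : (i : Fin d) ≠ j := fun h => j.2 (h ▸ i.2)
  simp [slowIncl, fastIncl, mul_apply, one_apply, this]

theorem fastIncl_transpose_mul_slowIncl : σ.fastInclᵀ * σ.slowIncl = 0 := by
  rw [← transpose_transpose σ.slowIncl, ← transpose_mul, slowIncl_transpose_mul_fastIncl,
    transpose_zero]

theorem slowProj_mul_self : σ.slowProj * σ.slowProj = σ.slowProj := by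
  simp [slowProj, diagonal_mul_diagonal]

theorem norm_slowProj_le : ‖σ.slowProj‖ ≤ 1 := by
  rw [slowProj, Matrix.l2_opNorm_diagonal, pi_norm_le_iff_of_nonneg zero_le_one]
  intro i
  split_ifs <;> simp

theorem slowProj_mul_compl : σ.slowProj * (1 - σ.slowProj) = 0 := by
  rw [mul_sub, mul_one, slowProj_mul_self, sub_self]

theorem compl_mul_slowProj : (1 - σ.slowProj) * σ.slowProj = 0 := by
  rw [sub_mul, one_mul, slowProj_mul_self, sub_self]

theorem slowProj_mul_fastPart : σ.slowProj * σ.fastPart = 0 := by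
  rw [fastPart, mul_assoc, ← mul_assoc, slowProj_mul_compl, zero_mul]

theorem fastPart_mul_slowProj : σ.fastPart * σ.slowProj = 0 := by
  rw [fastPart, mul_assoc, compl_mul_slowProj, mul_zero]

theorem A_eq : σ.A = σ.slowInclᵀ * (σ.L * σ.slowIncl) := by
  ext i j; simp [A, L, slowIncl, mul_apply, one_apply]

theorem B_eq : σ.B = σ.slowInclᵀ * (σ.L * σ.fastIncl) := by
  ext i j; simp [B, L, slowIncl, fastIncl, mul_apply, one_apply]

theorem C_eq : σ.C = σ.fastInclᵀ * (σ.L * σ.slowIncl) := by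
  ext i j; simp [C, L, slowIncl, fastIncl, mul_apply, one_apply]

theorem D_eq : σ.D = σ.fastInclᵀ * (σ.L * σ.fastIncl) := by
  ext i j; simp [D, L, fastIncl, mul_apply, one_apply]

theorem fastIncl_transpose_mul_compl : σ.fastInclᵀ * (1 - σ.slowProj) = σ.fastInclᵀ := by
  rw [← fastIncl_mul_transpose, ← Matrix.mul_assoc, transpose_mul_fastIncl, Matrix.one_mul]

theorem compl_mul_fastIncl : (1 - σ.slowProj) * σ.fastIncl = σ.fastIncl := by
  rw [← fastIncl_mul_transpose, Matrix.mul_assoc, transpose_mul_fastIncl, Matrix.mul_one]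

theorem slowIncl_transpose_mul_slowProj : σ.slowInclᵀ * σ.slowProj = σ.slowInclᵀ := by
  rw [← slowIncl_mul_transpose, ← Matrix.mul_assoc, transpose_mul_slowIncl, Matrix.one_mul]

/-- The shift puts −I in the slow block that `fastPart` leaves at zero. The result −I ⊕ D is Hurwitz
and invertible when D is Hurwitz, and has a size that does not vary with the mode. -/
theorem fastIncl_transpose_mul_shifted :
    σ.fastInclᵀ * (σ.fastPart - σ.slowProj) = σ.D * σ.fastInclᵀ := by
  rw [Matrix.mul_sub, fastPart, D_eq]
  nth_rewrite 3 [← slowIncl_mul_transpose]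
  rw [← Matrix.mul_assoc, ← Matrix.mul_assoc, ← Matrix.mul_assoc, fastIncl_transpose_mul_slowIncl,
    Matrix.zero_mul, sub_zero, fastIncl_transpose_mul_compl, ← fastIncl_mul_transpose]
  simp only [Matrix.mul_assoc]

theorem shifted_mul_fastIncl :
    (σ.fastPart - σ.slowProj) * σ.fastIncl = σ.fastIncl * σ.D := by
  rw [Matrix.sub_mul, fastPart, D_eq]
  nth_rewrite 3 [← slowIncl_mul_transpose]
  rw [Matrix.mul_assoc, compl_mul_fastIncl, Matrix.mul_assoc, Matrix.mul_assoc,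
    slowIncl_transpose_mul_fastIncl, Matrix.mul_zero, sub_zero, ← fastIncl_mul_transpose]
  simp only [Matrix.mul_assoc]

theorem slowIncl_transpose_mul_shifted :
    σ.slowInclᵀ * (σ.fastPart - σ.slowProj) = -σ.slowInclᵀ := by
  have : σ.slowInclᵀ * σ.fastPart = 0 := by
    rw [← slowIncl_transpose_mul_slowProj, Matrix.mul_assoc, slowProj_mul_fastPart,
      Matrix.mul_zero]
  rw [Matrix.mul_sub, this, slowIncl_transpose_mul_slowProj, zero_sub]

variable {σ}

/-- The matrix `-I ⊕ D` is Hurwitz if `D` is. -/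
theorem isHurwitz_shifted (hD : σ.D.IsHurwitz) : (σ.fastPart - σ.slowProj).IsHurwitz := by
  intro z hz
  obtain ⟨v, hv, h⟩ := Matrix.mem_spectrum_iff_exists_mulVec.mp hz
  have hmap : ∀ {a b c : Type} [Fintype b] (X : Matrix a b ℝ) (Y : Matrix b c ℝ),
      (X * Y).map (algebraMap ℝ ℂ) = X.map (algebraMap ℝ ℂ) * Y.map (algebraMap ℝ ℂ) :=
    fun X Y => Matrix.map_mul
  have hf := congrArg (fun X => X.map (algebraMap ℝ ℂ) *ᵥ v) σ.fastIncl_transpose_mul_shifted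
  have hs := congrArg (fun X => X.map (algebraMap ℝ ℂ) *ᵥ v) σ.slowIncl_transpose_mul_shifted
  simp only [hmap, ← Matrix.mulVec_mulVec, h, Matrix.mulVec_smul] at hf hs
  -- A nonzero fast component of v is an eigenvector of D; if it vanishes, the slow component is
  -- nonzero and the eigenvalue is −1.
  by_cases h0 : (σ.fastInclᵀ.map (algebraMap ℝ ℂ)) *ᵥ v = 0
  · have hneg : (-σ.slowInclᵀ).map (algebraMap ℝ ℂ) = -(σ.slowInclᵀ.map (algebraMap ℝ ℂ)) := by
      ext; simp
    rw [hneg, Matrix.neg_mulVec] at hs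
    have hdec : v = σ.slowIncl.map (algebraMap ℝ ℂ) *ᵥ (σ.slowInclᵀ.map (algebraMap ℝ ℂ) *ᵥ v) +
        σ.fastIncl.map (algebraMap ℝ ℂ) *ᵥ (σ.fastInclᵀ.map (algebraMap ℝ ℂ) *ᵥ v) := by
      rw [Matrix.mulVec_mulVec, Matrix.mulVec_mulVec, ← hmap, ← hmap, ← Matrix.add_mulVec,
        slowIncl_mul_transpose, fastIncl_mul_transpose]
      have : (σ.slowProj.map (algebraMap ℝ ℂ)) + (1 - σ.slowProj).map (algebraMap ℝ ℂ) = 1 := by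
        rw [← Matrix.map_add _ (map_add _)]
        simp
      rw [this, Matrix.one_mulVec]
    have hs0 : (σ.slowInclᵀ.map (algebraMap ℝ ℂ)) *ᵥ v ≠ 0 := fun hs0 => hv (by
      rw [hdec, hs0, h0]; simp)
    obtain ⟨i, hi⟩ := Function.ne_iff.mp hs0
    have := congrFun hs i
    simp only [Pi.smul_apply, Pi.neg_apply, smul_eq_mul] at this
    have hz1 : z = -1 := by
      refine mul_right_cancel₀ hi ?_
      rw [this]; simp
    rw [hz1]; simp
  · exact hD z (Matrix.mem_spectrum_iff_exists_mulVec.mpr ⟨_, h0, hf.symm⟩)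

theorem fastInv_mul_fastIncl (hD : σ.D.IsHurwitz) :
    σ.fastInv * σ.fastIncl = σ.fastIncl * σ.D⁻¹ := by
  have h1 := (isHurwitz_shifted hD).isUnit_det
  have h2 := hD.isUnit_det
  have h3 : (σ.fastPart - σ.slowProj) * (σ.fastIncl * σ.D⁻¹) = σ.fastIncl := by
    rw [← Matrix.mul_assoc, shifted_mul_fastIncl, Matrix.mul_assoc, Matrix.mul_nonsing_inv _ h2,
      Matrix.mul_one]
  rw [fastInv]
  nth_rewrite 1 [← h3]
  rw [Matrix.nonsing_inv_mul_cancel_left _ _ h1]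

theorem shearPart_eq (hD : σ.D.IsHurwitz) :
    σ.shearPart = σ.fastIncl * (σ.D⁻¹ * σ.C) * σ.slowInclᵀ := by
  rw [shearPart, ← fastIncl_mul_transpose, ← slowIncl_mul_transpose, ← Matrix.mul_assoc,
    ← Matrix.mul_assoc, fastInv_mul_fastIncl hD, C_eq]
  simp only [Matrix.mul_assoc]

/-- An expression in d × d matrices only, from which continuity in the mode can be read even though
the blocks change size with ℓ. -/
theorem T_eq (hD : σ.D.IsHurwitz) : σ.T = (1 + σ.shearPart) * σ.P := by
  rw [T]
  congr 1
  rw [shearPart_eq hD]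
  have hs : ∀ i : σ.Slow, ∀ j : σ.Slow, (σ.fastIncl * (σ.D⁻¹ * σ.C) * σ.slowInclᵀ) i j = 0 := by
    intro i j
    simp only [Matrix.mul_assoc]
    rw [mul_apply]
    refine Finset.sum_eq_zero fun b _ => ?_
    have : (i : Fin d) ≠ b := fun h => b.2 (h ▸ i.2)
    simp [fastIncl, one_apply, this]
  have hsf : ∀ i : σ.Slow, ∀ j : σ.Fast, (σ.fastIncl * (σ.D⁻¹ * σ.C) * σ.slowInclᵀ) i j = 0 := by
    intro i j
    simp only [Matrix.mul_assoc]
    rw [mul_apply]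
    refine Finset.sum_eq_zero fun b _ => ?_
    have : (i : Fin d) ≠ b := fun h => b.2 (h ▸ i.2)
    simp [fastIncl, one_apply, this]
  have hff : ∀ i : σ.Fast, ∀ j : σ.Fast, (σ.fastIncl * (σ.D⁻¹ * σ.C) * σ.slowInclᵀ) i j = 0 := by
    intro i j
    rw [mul_apply]
    refine Finset.sum_eq_zero fun b _ => ?_
    have : (j : Fin d) ≠ b := fun h => j.2 (h ▸ b.2)
    simp [slowIncl, one_apply, this]
  have hfs : ∀ i : σ.Fast, ∀ j : σ.Slow,
      (σ.fastIncl * (σ.D⁻¹ * σ.C) * σ.slowInclᵀ) i j = (σ.D⁻¹ * σ.C) i j := by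
    intro i j
    rw [mul_apply, Finset.sum_eq_single j]
    · rw [mul_apply, Finset.sum_eq_single i]
      · simp [slowIncl, fastIncl, one_apply]
      · intro b _ hb
        have : (i : Fin d) ≠ b := fun h => hb (Subtype.ext h.symm)
        simp [fastIncl, one_apply, this]
      · simp
    · intro b _ hb
      have : (j : Fin d) ≠ b := fun h => hb (Subtype.ext h.symm)
      simp [slowIncl, one_apply, this]
    · simp
  rw [← (Matrix.reindex (Equiv.sumCompl fun i : Fin d => (i : ℕ) < σ.ell)
    (Equiv.sumCompl fun i : Fin d => (i : ℕ) < σ.ell)).symm.injective.eq_iff]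
  rw [Equiv.symm_apply_apply]
  ext (i | i) (j | j)
  · simp [hs, one_apply, Subtype.ext_iff]
  · have : (i : Fin d) ≠ j := fun h => j.2 (h ▸ i.2)
    simp [hsf, one_apply, this]
  · have : (i : Fin d) ≠ j := fun h => i.2 (h ▸ j.2)
    simp [hfs, one_apply, this]
  · simp [hff, one_apply, Subtype.ext_iff]

variable (σ) in
theorem P_mul_inv : σ.P * σ.P⁻¹ = 1 :=
  Matrix.mul_nonsing_inv _ ((Matrix.isUnit_iff_isUnit_det _).mp σ.2.1.isUnit)

variable (σ) in
theorem P_inv_mul : σ.P⁻¹ * σ.P = 1 :=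
  Matrix.nonsing_inv_mul _ ((Matrix.isUnit_iff_isUnit_det _).mp σ.2.1.isUnit)

theorem shearPart_mul_self (hD : σ.D.IsHurwitz) : σ.shearPart * σ.shearPart = 0 := by
  rw [shearPart_eq hD]
  have : ∀ X Y : Matrix σ.Fast σ.Slow ℝ,
      σ.fastIncl * X * σ.slowInclᵀ * (σ.fastIncl * Y * σ.slowInclᵀ) = 0 := fun X Y => by
    rw [Matrix.mul_assoc, Matrix.mul_assoc σ.fastIncl Y, ← Matrix.mul_assoc σ.slowInclᵀ,
      slowIncl_transpose_mul_fastIncl, Matrix.zero_mul, Matrix.mul_zero]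
  exact this _ _

theorem T_mul_inv_eq (hD : σ.D.IsHurwitz) : σ.T * (σ.P⁻¹ * (1 - σ.shearPart)) = 1 := by
  rw [T_eq hD, mul_assoc, ← mul_assoc σ.P, P_mul_inv, one_mul, mul_sub, add_mul, add_mul,
    shearPart_mul_self hD]
  simp

theorem T_inv_eq (hD : σ.D.IsHurwitz) : σ.T⁻¹ = σ.P⁻¹ * (1 - σ.shearPart) :=
  Matrix.inv_eq_right_inv (T_mul_inv_eq hD)

theorem T_mul_inv (hD : σ.D.IsHurwitz) : σ.T * σ.T⁻¹ = 1 := by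
  rw [T_inv_eq hD, T_mul_inv_eq hD]

theorem T_inv_mul (hD : σ.D.IsHurwitz) : σ.T⁻¹ * σ.T = 1 :=
  mul_eq_one_comm.mp (T_mul_inv hD)

theorem slowProj_mul_shearPart (hD : σ.D.IsHurwitz) : σ.slowProj * σ.shearPart = 0 := by
  have h1 : σ.slowProj * σ.fastIncl = 0 := by
    rw [← slowIncl_mul_transpose, Matrix.mul_assoc, slowIncl_transpose_mul_fastIncl,
      Matrix.mul_zero]
  rw [shearPart_eq hD, ← Matrix.mul_assoc, ← Matrix.mul_assoc, h1, Matrix.zero_mul,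
    Matrix.zero_mul]

theorem shearPart_mul_compl : σ.shearPart * (1 - σ.slowProj) = 0 := by
  rw [shearPart, mul_assoc, slowProj_mul_compl, mul_zero]

/-- D(D⁻¹C) = C: this is the purpose of the shear, which cancels the block C that would otherwise be
multiplied by ε⁻¹. -/
theorem compl_mul_L_mul_shearPart (hD : σ.D.IsHurwitz) :
    (1 - σ.slowProj) * σ.L * σ.shearPart = (1 - σ.slowProj) * σ.L * σ.slowProj := by
  rw [shearPart_eq hD, ← fastIncl_mul_transpose]
  have h1 : σ.fastIncl * σ.fastInclᵀ * σ.L * (σ.fastIncl * (σ.D⁻¹ * σ.C) * σ.slowInclᵀ) =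
      σ.fastIncl * (σ.D * (σ.D⁻¹ * σ.C)) * σ.slowInclᵀ := by
    rw [D_eq]; simp only [Matrix.mul_assoc]
  rw [h1, Matrix.mul_nonsing_inv_cancel_left _ _ hD.isUnit_det, C_eq, ← slowIncl_mul_transpose]
  simp only [Matrix.mul_assoc]

/-- In the coordinates given by `T`, the velocity is a bounded matrix plus `ε⁻¹` times the fast
part. -/
theorem velocity_eq (hD : σ.D.IsHurwitz) {ε : ℝ} (hε : 0 < ε) :
    σ.velocity ε = σ.T⁻¹ * (σ.boundedPart + ε⁻¹ • σ.fastPart) * σ.T := by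
  have hE : σ.E ε * (σ.slowProj + ε⁻¹ • (1 - σ.slowProj)) = 1 := by
    rw [E, slowProj, ← diagonal_one, diagonal_sub, ← diagonal_smul, diagonal_add,
      diagonal_mul_diagonal]
    congr 1
    funext i
    simp only [Pi.smul_apply]
    split_ifs <;> simp [hε.ne']
  have hinv : (σ.E ε * σ.P)⁻¹ = σ.P⁻¹ * (σ.slowProj + ε⁻¹ • (1 - σ.slowProj)) := by
    refine Matrix.inv_eq_right_inv ?_
    rw [mul_assoc, ← mul_assoc σ.P, P_mul_inv, one_mul, hE]
  have hLam : σ.Lam = σ.L * σ.P := by rw [L, mul_assoc, P_inv_mul, mul_one]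
  have key : (1 - σ.shearPart) * (σ.boundedPart + ε⁻¹ • σ.fastPart) * (1 + σ.shearPart) =
      (σ.slowProj + ε⁻¹ • (1 - σ.slowProj)) * σ.L := by
    have a1 : (1 - σ.shearPart) * (1 + σ.shearPart) = 1 := by
      rw [mul_add, sub_mul, sub_mul, shearPart_mul_self hD]; simp
    have a2 : (1 - σ.shearPart) * σ.fastPart = σ.fastPart := by
      rw [sub_mul, one_mul, fastPart, ← mul_assoc, ← mul_assoc, shearPart_mul_compl]; simp
    have a3 : σ.fastPart * (1 + σ.shearPart) = (1 - σ.slowProj) * σ.L := by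
      have : (1 - σ.slowProj) * σ.shearPart = σ.shearPart := by
        rw [sub_mul, slowProj_mul_shearPart hD]; simp
      rw [mul_add, mul_one, fastPart, mul_assoc _ _ σ.shearPart, this,
        compl_mul_L_mul_shearPart hD, ← mul_add]
      simp
    rw [mul_add (1 - σ.shearPart), add_mul _ _ (1 + σ.shearPart), mul_smul_comm, a2,
      smul_mul_assoc, a3, add_mul _ _ σ.L, smul_mul_assoc]
    congr 1
    rw [boundedPart, ← mul_assoc, ← mul_assoc, a1, one_mul, mul_assoc, a1, mul_one]
  rw [velocity, hinv, hLam, T_inv_eq hD, T_eq hD]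
  calc _ = σ.P⁻¹ * ((σ.slowProj + ε⁻¹ • (1 - σ.slowProj)) * σ.L) * σ.P := by
        simp only [mul_assoc]
    _ = _ := by rw [← key]; simp only [mul_assoc]

/-- `slowProj` kills the shear on its left, so only Q L (1 − S) Q survives, with Q the slow
projection and S the shear part; its slow block is A − B D⁻¹ C. -/
theorem slowGen_eq (hD : σ.D.IsHurwitz) :
    σ.slowGen = σ.slowIncl * σ.M * σ.slowInclᵀ := by
  have h1 : σ.slowGen = σ.slowProj * σ.L * ((1 - σ.shearPart) * σ.slowProj) := by
    rw [slowGen, boundedPart, ← mul_assoc, ← mul_assoc, mul_add, slowProj_mul_shearPart hD]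
    simp only [mul_one, add_zero, ← mul_assoc, slowProj_mul_self]
  rw [h1, sub_mul, one_mul, shearPart_eq hD, ← slowIncl_mul_transpose, M, A_eq, B_eq]
  have h2 : σ.fastIncl * (σ.D⁻¹ * σ.C) * σ.slowInclᵀ * (σ.slowIncl * σ.slowInclᵀ) =
      σ.fastIncl * (σ.D⁻¹ * σ.C) * σ.slowInclᵀ := by
    rw [Matrix.mul_assoc, slowIncl_mul_transpose, slowIncl_transpose_mul_slowProj]
  rw [h2, Matrix.mul_sub, Matrix.mul_sub, Matrix.sub_mul]
  simp only [Matrix.mul_assoc]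

theorem exp_slowGen_mul_slowIncl (hD : σ.D.IsHurwitz) (s : ℝ) :
    exp (s • σ.slowGen) * σ.slowIncl = σ.slowIncl * exp (s • σ.M) := by
  refine Matrix.exp_mul_of_intertwine ?_
  rw [slowGen_eq hD, Matrix.smul_mul, Matrix.mul_assoc, transpose_mul_slowIncl, Matrix.mul_one,
    Matrix.mul_smul]

/-- The limit as `ε → 0` of the flow in a given mode. -/
def limitFlow (σ : SPMode d) (s : ℝ) : Matrix (Fin d) (Fin d) ℝ :=
  σ.T⁻¹ * (exp (s • σ.slowGen) * σ.slowProj) * σ.T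

/-- The factorization V e^{sM} U through ℝ^ℓ that ties the limit flow to the reduced system. -/
theorem limitFlow_eq (hD : σ.D.IsHurwitz) (s : ℝ) :
    σ.limitFlow s = σ.T⁻¹ * σ.slowIncl * exp (s • σ.M) * (σ.slowInclᵀ * σ.T) := by
  rw [limitFlow, ← slowIncl_mul_transpose, ← Matrix.mul_assoc (exp _),
    exp_slowGen_mul_slowIncl hD]
  simp only [Matrix.mul_assoc]

/-- The middle factor U V is the identity of ℝ^ℓ. At time 0, however, the limit flow is the
projection T⁻¹QT and not the identity of ℝ^d, so the arguments about growth rates may use additivity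
of the limit flow but not its value at 0. -/
theorem limitFlow_add (hD : σ.D.IsHurwitz) (s t : ℝ) :
    σ.limitFlow (s + t) = σ.limitFlow s * σ.limitFlow t := by
  have h1 : exp ((s + t) • σ.M) = exp (s • σ.M) * exp (t • σ.M) := by
    rw [add_smul]
    exact Matrix.exp_add_of_commute _ _ (((Commute.refl _).smul_left _).smul_right _)
  rw [limitFlow_eq hD, limitFlow_eq hD, limitFlow_eq hD, h1]
  have h2 : σ.slowInclᵀ * σ.T * (σ.T⁻¹ * σ.slowIncl) = 1 := by
    rw [Matrix.mul_assoc, ← Matrix.mul_assoc σ.T, T_mul_inv hD, Matrix.one_mul,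
      transpose_mul_slowIncl]
  calc _ = σ.T⁻¹ * σ.slowIncl * exp (s • σ.M) * (1 : Matrix σ.Slow σ.Slow ℝ) * exp (t • σ.M) *
          (σ.slowInclᵀ * σ.T) := by
        simp only [Matrix.mul_assoc, Matrix.one_mul]
    _ = _ := by rw [← h2]; simp only [Matrix.mul_assoc]

theorem exp_velocity_eq (hD : σ.D.IsHurwitz) {ε : ℝ} (hε : 0 < ε) (s : ℝ) :
    exp (s • σ.velocity ε) =
      σ.T⁻¹ * exp (s • (σ.boundedPart + ε⁻¹ • σ.fastPart)) * σ.T := by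
  have h1 : (s • σ.velocity ε) * σ.T⁻¹ =
      σ.T⁻¹ * (s • (σ.boundedPart + ε⁻¹ • σ.fastPart)) := by
    rw [velocity_eq hD hε, smul_mul_assoc, mul_assoc, T_mul_inv hD, mul_one, mul_smul_comm]
  rw [← Matrix.exp_mul_of_intertwine h1, mul_assoc, T_inv_mul hD, mul_one]

end SPMode

end SlowFastSplitting

/-! ### Estimates uniform over a compact set of modes -/

section UniformEstimates

open scoped Matrix.Norms.L2Operator
open Matrix NormedSpace

namespace SPMode

variable {d : ℕ} {K : Set (SPMode d)}

/-- The index ℓ ranges over a discrete space, so any dependence on it is continuous. -/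
theorem continuous_slowProj : Continuous (slowProj (d := d)) :=
  (continuous_of_discreteTopology (f := fun l : Set.Icc 1 (d - 1) =>
    (diagonal fun i : Fin d => if (i : ℕ) < (l : ℕ) then (1 : ℝ) else 0))).comp continuous_fst

theorem continuous_P : Continuous (P (d := d)) :=
  Units.continuous_val.comp (continuous_fst.comp continuous_snd)

theorem continuous_P_inv : Continuous fun σ : SPMode d => σ.P⁻¹ := by
  have : (fun σ : SPMode d => σ.P⁻¹) =
      fun σ : SPMode d => ((σ.2.1⁻¹ : GL (Fin d) ℝ) : Matrix (Fin d) (Fin d) ℝ) := by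
    funext σ
    exact (Matrix.coe_units_inv σ.2.1).symm
  rw [this]
  exact Units.continuous_val.comp (continuous_inv.comp (continuous_fst.comp continuous_snd))

theorem continuous_R : Continuous (R (d := d)) :=
  continuous_snd.comp (continuous_snd.comp continuous_snd)

theorem continuous_L : Continuous (L (d := d)) :=
  (continuous_fst.comp (continuous_snd.comp continuous_snd)).mul continuous_P_inv

theorem continuous_fastPart : Continuous (fastPart (d := d)) :=
  ((continuous_const.sub continuous_slowProj).mul continuous_L).mul
    (continuous_const.sub continuous_slowProj)

theorem continuousOn_fastInv (hD : ∀ σ ∈ K, σ.D.IsHurwitz) : ContinuousOn (fastInv (d := d)) K :=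
  fun σ hσ => (ContinuousAt.comp (f := fun σ : SPMode d => σ.fastPart - σ.slowProj)
    (g := fun B : Matrix (Fin d) (Fin d) ℝ => B⁻¹)
    (Matrix.continuousAt_inv (isHurwitz_shifted (hD σ hσ)).isUnit_det)
    (continuous_fastPart.sub continuous_slowProj).continuousAt).continuousWithinAt

theorem continuousOn_shearPart (hD : ∀ σ ∈ K, σ.D.IsHurwitz) :
    ContinuousOn (shearPart (d := d)) K :=
  (((continuousOn_fastInv hD).mul (continuous_const.sub continuous_slowProj).continuousOn).mul
    continuous_L.continuousOn).mul continuous_slowProj.continuousOn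

theorem continuousOn_boundedPart (hD : ∀ σ ∈ K, σ.D.IsHurwitz) :
    ContinuousOn (boundedPart (d := d)) K :=
  ((continuousOn_const.add (continuousOn_shearPart hD)).mul
    (continuous_slowProj.mul continuous_L).continuousOn).mul
    (continuousOn_const.sub (continuousOn_shearPart hD))

theorem continuousOn_slowGen (hD : ∀ σ ∈ K, σ.D.IsHurwitz) :
    ContinuousOn (slowGen (d := d)) K :=
  (continuous_slowProj.continuousOn.mul (continuousOn_boundedPart hD)).mul
    continuous_slowProj.continuousOn

theorem continuousOn_T (hD : ∀ σ ∈ K, σ.D.IsHurwitz) : ContinuousOn (T (d := d)) K :=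
  ((continuousOn_const.add (continuousOn_shearPart hD)).mul continuous_P.continuousOn).congr
    fun σ hσ => T_eq (hD σ hσ)

theorem continuousOn_T_inv (hD : ∀ σ ∈ K, σ.D.IsHurwitz) :
    ContinuousOn (fun σ : SPMode d => σ.T⁻¹) K :=
  (continuous_P_inv.continuousOn.mul (continuousOn_const.sub (continuousOn_shearPart hD))).congr
    fun σ hσ => T_inv_eq (hD σ hσ)

theorem continuousOn_exp {X : Type*} [TopologicalSpace X] {S : Set X}
    {f : X → Matrix (Fin d) (Fin d) ℝ} (hf : ContinuousOn f S) :
    ContinuousOn (fun x => exp (f x)) S := by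
  let : NormedAlgebra ℚ (Matrix (Fin d) (Fin d) ℝ) := .restrictScalars ℚ ℝ _
  exact exp_continuous.comp_continuousOn hf

theorem continuousOn_limitFlow (hD : ∀ σ ∈ K, σ.D.IsHurwitz) (s : ℝ) :
    ContinuousOn (fun σ : SPMode d => σ.limitFlow s) K :=
  ((continuousOn_T_inv hD).mul ((continuousOn_exp ((continuousOn_slowGen hD).const_smul s)).mul
    continuous_slowProj.continuousOn)).mul (continuousOn_T hD)

/-- The fast dynamics decays uniformly on a compact set of modes with Hurwitz fast block. -/
theorem exists_fast_decay [Nonempty (Fin d)] (hK : IsCompact K) (hD : ∀ σ ∈ K, σ.D.IsHurwitz) :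
    ∃ C c : ℝ, 0 ≤ C ∧ 0 < c ∧ ∀ σ ∈ K, ∀ s : ℝ, 0 ≤ s →
      ‖(1 - σ.slowProj) * exp (s • σ.fastPart)‖ ≤ C * Real.exp (-c * s) := by
  have hcont : ContinuousOn (fun σ : SPMode d => exp (σ.fastPart - σ.slowProj)) K :=
    continuousOn_exp (continuous_fastPart.sub continuous_slowProj).continuousOn
  obtain ⟨C, ρ, hC, hρ0, hρ1, h⟩ := exists_norm_pow_le_of_isCompact hK hcont
    (fun σ hσ z hz => by
      obtain ⟨y, hy, rfl⟩ := Matrix.exists_exp_eq_of_mem_complexSpectrum_exp hz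
      rw [Complex.norm_exp, Real.exp_lt_one_iff]
      exact isHurwitz_shifted (hD σ hσ) y hy)
  obtain ⟨b, hb⟩ := hK.exists_bound_of_continuousOn
    (continuous_fastPart.sub continuous_slowProj).continuousOn
  set b' := max b 0
  have hq : ∀ σ : SPMode d, ‖1 - σ.slowProj‖ ≤ 2 := fun σ => by
    refine (norm_sub_le _ _).trans ?_
    have := σ.norm_slowProj_le
    rw [norm_one]; linarith
  refine ⟨2 * (C * ρ⁻¹ * Real.exp b'), -Real.log ρ, by positivity,
    neg_pos.mpr (Real.log_neg hρ0 hρ1), fun σ hσ s hs => ?_⟩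
  -- The shift affects only the slow block, which the factor on the left removes; it makes the whole
  -- exponent Hurwitz.
  have hswap : (1 - σ.slowProj) * exp (s • σ.fastPart) =
      (1 - σ.slowProj) * exp (s • (σ.fastPart - σ.slowProj)) := by
    have e1 : σ.fastPart * (1 - σ.slowProj) = (1 - σ.slowProj) * (σ.fastPart - σ.slowProj) := by
      rw [mul_sub, mul_sub, sub_mul, sub_mul, slowProj_mul_fastPart, fastPart_mul_slowProj,
        slowProj_mul_self]
      simp
    have e2 : σ.fastPart * (1 - σ.slowProj) = (1 - σ.slowProj) * σ.fastPart := by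
      rw [mul_sub, sub_mul, slowProj_mul_fastPart, fastPart_mul_slowProj]
      simp
    rw [← Matrix.exp_mul_of_intertwine (X := s • σ.fastPart) (Y := s • σ.fastPart),
      Matrix.exp_mul_of_intertwine (X := s • σ.fastPart) (Y := s • (σ.fastPart - σ.slowProj))]
    · rw [smul_mul_assoc, e1, mul_smul_comm]
    · rw [smul_mul_assoc, e2, mul_smul_comm]
  set G := σ.fastPart - σ.slowProj
  set k := ⌊s⌋₊
  have hk : (k : ℝ) ≤ s := Nat.floor_le hs
  have hk' : s < k + 1 := Nat.lt_floor_add_one s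
  have hsplit : exp (s • G) = exp G ^ k * exp ((s - k) • G) := by
    rw [← Matrix.exp_nsmul, ← Matrix.exp_add_of_commute, ← Nat.cast_smul_eq_nsmul ℝ, ← add_smul]
    · congr 2; ring
    · rw [← Nat.cast_smul_eq_nsmul ℝ]
      exact ((Commute.refl _).smul_left _).smul_right _
  have hGb : ‖G‖ ≤ b' := (hb σ hσ).trans (le_max_left _ _)
  have hfrac : ‖exp ((s - k) • G)‖ ≤ Real.exp b' := by
    refine (Matrix.norm_exp_smul_le G hGb (by linarith)).trans (Real.exp_le_exp.mpr ?_)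
    exact mul_le_of_le_one_right (le_max_right _ _) (by linarith)
  -- Rounding s down to the integer k loses less than one step, hence the single factor ρ⁻¹.
  have hρk : ρ ^ k ≤ ρ⁻¹ * Real.exp (-(-Real.log ρ) * s) := by
    have h1 : ρ⁻¹ * Real.exp (-(-Real.log ρ) * s) = Real.exp (Real.log ρ * (s - 1)) := by
      rw [mul_sub, Real.exp_sub, mul_one, Real.exp_log hρ0, neg_neg]
      field_simp
    have h2 : ρ ^ k = Real.exp (Real.log ρ * k) := by
      rw [mul_comm, Real.exp_nat_mul, Real.exp_log hρ0]
    rw [h1, h2]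
    refine Real.exp_le_exp.mpr (mul_le_mul_of_nonpos_left (by linarith) ?_)
    exact (Real.log_neg hρ0 hρ1).le
  rw [hswap, hsplit]
  calc _ ≤ 2 * ((C * ρ ^ k) * Real.exp b') := by
        refine (norm_mul_le _ _).trans ?_
        gcongr
        · exact hq σ
        · refine (norm_mul_le _ _).trans ?_
          gcongr
          exact h σ hσ k
    _ ≤ 2 * ((C * (ρ⁻¹ * Real.exp (-(-Real.log ρ) * s))) * Real.exp b') := by gcongr
    _ = _ := by ring

/-- The perturbed flow in a given mode is uniformly bounded, and converges uniformly to the limit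
flow away from the initial time. -/
theorem exists_flow_estimates [Nonempty (Fin d)] (hK : IsCompact K)
    (hD : ∀ σ ∈ K, σ.D.IsHurwitz) {τ : ℝ} (hτ : 0 < τ) (t₁ : ℝ) :
    ∃ C k : ℝ, 0 ≤ C ∧ 0 ≤ k ∧ ∀ σ ∈ K, ∀ ε : ℝ, 0 < ε → ∀ t : ℝ, 0 ≤ t → t ≤ t₁ →
      ‖exp (t • σ.velocity ε)‖ ≤ C ∧
      (τ ≤ t → ‖exp (t • σ.velocity ε) - σ.limitFlow t‖ ≤ k * ε) := by
  obtain ⟨C, c, hC, hc, hdecay⟩ := exists_fast_decay hK hD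
  obtain ⟨h, hh⟩ := hK.exists_bound_of_continuousOn (continuousOn_boundedPart hD)
  obtain ⟨a, ha⟩ := hK.exists_bound_of_continuousOn (continuousOn_T hD)
  obtain ⟨b, hb⟩ := hK.exists_bound_of_continuousOn (continuousOn_T_inv hD)
  obtain ⟨Y₁, k, hest⟩ := Matrix.exists_norm_exp_sub_le (n := Fin d) (C := C) (c := c)
    (h := max h 0) (τ := τ) (t₁ := t₁) hc hτ hC (le_max_right _ _)
  set a' := max a 0
  set b' := max b 0
  have ha' : ∀ σ ∈ K, ‖σ.T‖ ≤ a' := fun σ hσ => (ha σ hσ).trans (le_max_left _ _)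
  have hb' : ∀ σ ∈ K, ‖σ.T⁻¹‖ ≤ b' := fun σ hσ => (hb σ hσ).trans (le_max_left _ _)
  have hconj : ∀ σ ∈ K, ∀ X : Matrix (Fin d) (Fin d) ℝ, ∀ y : ℝ, ‖X‖ ≤ y →
      ‖σ.T⁻¹ * X * σ.T‖ ≤ b' * y * a' := fun σ hσ X y hX => by
    have hb0 : 0 ≤ b' := le_max_right _ _
    refine (norm_mul_le _ _).trans ?_
    gcongr
    · exact mul_nonneg hb0 ((norm_nonneg _).trans hX)
    · refine (norm_mul_le _ _).trans ?_
      gcongr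
      exact hb' σ hσ
    · exact ha' σ hσ
  refine ⟨b' * max Y₁ 0 * a', b' * max k 0 * a', by positivity, by positivity,
    fun σ hσ ε hε t ht htt₁ => ?_⟩
  obtain ⟨h1, h2⟩ := hest σ.slowProj σ.fastPart σ.boundedPart σ.slowProj_mul_self
    σ.slowProj_mul_fastPart σ.fastPart_mul_slowProj σ.norm_slowProj_le (hdecay σ hσ)
    ((hh σ hσ).trans (le_max_left _ _)) ε⁻¹ (inv_pos.mpr hε) t ht htt₁
  rw [exp_velocity_eq (hD σ hσ) hε]
  refine ⟨hconj σ hσ _ _ (h1.trans (le_max_left _ _)), fun hτt => ?_⟩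
  rw [limitFlow, ← sub_mul, ← mul_sub]
  have h3 : k / ε⁻¹ ≤ max k 0 * ε := by
    rw [div_inv_eq_mul]; gcongr; exact le_max_left _ _
  refine (hconj σ hσ _ _ ((h2 hτt).trans h3)).trans (le_of_eq (by ring))

theorem exists_norm_limitFlow_le [Nonempty (Fin d)] (hK : IsCompact K)
    (hD : ∀ σ ∈ K, σ.D.IsHurwitz) (t₁ : ℝ) :
    ∃ C : ℝ, 0 ≤ C ∧ ∀ σ ∈ K, ∀ t : ℝ, 0 ≤ t → t ≤ t₁ → ‖σ.limitFlow t‖ ≤ C := by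
  obtain ⟨h, hh⟩ := hK.exists_bound_of_continuousOn (continuousOn_slowGen hD)
  obtain ⟨a, ha⟩ := hK.exists_bound_of_continuousOn (continuousOn_T hD)
  obtain ⟨b, hb⟩ := hK.exists_bound_of_continuousOn (continuousOn_T_inv hD)
  refine ⟨max b 0 * (Real.exp (max h 0 * t₁) * 1) * max a 0, by positivity,
    fun σ hσ t ht htt₁ => ?_⟩
  have h1 : ‖exp (t • σ.slowGen)‖ ≤ Real.exp (max h 0 * t₁) :=
    (Matrix.norm_exp_smul_le _ ((hh σ hσ).trans (le_max_left _ _)) ht).trans (by gcongr)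
  refine (norm_mul_le _ _).trans ?_
  gcongr
  · refine (norm_mul_le _ _).trans ?_
    gcongr
    · exact (hb σ hσ).trans (le_max_left _ _)
    · refine (norm_mul_le _ _).trans ?_
      gcongr
      exact σ.norm_slowProj_le
  · exact (ha σ hσ).trans (le_max_left _ _)

end SPMode

end UniformEstimates

/-! ### Signals as words of modes with durations -/

section HybridFlow

open scoped Matrix.Norms.L2Operator
open Matrix

variable {α n : Type*} [Fintype n] [DecidableEq n]

/-- The flow up to the `k`-th switching time when the mode `a` has the flow `F a` and is left
through the jump `R a`. -/
def switchProd (F : α → ℝ → Matrix n n ℝ) (R : α → Matrix n n ℝ) (Z : SwitchingSignal α) :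
    ℕ → Matrix n n ℝ
  | 0 => 1
  | k + 1 => R (Z.value k) * F (Z.value k) (Z.time (k + 1) - Z.time k) * switchProd F R Z k

/-- The flow from time `0` to time `t` when the mode `a` has the flow `F a` and is left through the
jump `R a`. -/
def hybridFlow (F : α → ℝ → Matrix n n ℝ) (R : α → Matrix n n ℝ) (Z : SwitchingSignal α) (t : ℝ) :
    Matrix n n ℝ :=
  F (Z.eval t) (t - Z.time (Z.index t)) * switchProd F R Z (Z.index t)

/-- The product along a word of modes with durations; the head of the list is the last letter in
time. -/
def wordFlow (F : α → ℝ → Matrix n n ℝ) (R : α → Matrix n n ℝ) (w : List (α × ℝ)) :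
    Matrix n n ℝ :=
  (w.map fun l => R l.1 * F l.1 l.2).prod

/-- The total duration of a word. -/
def wordTime (w : List (α × ℝ)) : ℝ := (w.map Prod.snd).sum

/-- The words over `K` with durations at least `τ`. -/
def IsDwellWord (K : Set α) (τ : ℝ) (w : List (α × ℝ)) : Prop := ∀ l ∈ w, l.1 ∈ K ∧ τ ≤ l.2

variable {F G : α → ℝ → Matrix n n ℝ} {R : α → Matrix n n ℝ} {K : Set α} {τ : ℝ}

@[simp] theorem wordFlow_nil : wordFlow F R [] = 1 := rfl

@[simp] theorem wordFlow_cons (l : α × ℝ) (w : List (α × ℝ)) :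
    wordFlow F R (l :: w) = R l.1 * F l.1 l.2 * wordFlow F R w := by simp [wordFlow]

@[simp] theorem wordTime_nil : wordTime ([] : List (α × ℝ)) = 0 := rfl

@[simp] theorem wordTime_cons (l : α × ℝ) (w : List (α × ℝ)) :
    wordTime (l :: w) = l.2 + wordTime w := by simp [wordTime]

theorem isDwellWord_nil : IsDwellWord K τ [] := by simp [IsDwellWord]

theorem isDwellWord_cons {l : α × ℝ} {w : List (α × ℝ)} :
    IsDwellWord K τ (l :: w) ↔ (l.1 ∈ K ∧ τ ≤ l.2) ∧ IsDwellWord K τ w := by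
  simp [IsDwellWord]

theorem IsDwellWord.length_mul_le {w : List (α × ℝ)} (hw : IsDwellWord K τ w) :
    w.length * τ ≤ wordTime w := by
  induction w with
  | nil => simp
  | cons l w ih =>
    rw [isDwellWord_cons] at hw
    have := ih hw.2
    simp only [List.length_cons, wordTime_cons]
    push_cast
    linarith [hw.1.2]

theorem IsDwellWord.wordTime_nonneg {w : List (α × ℝ)} (hτ : 0 ≤ τ) (hw : IsDwellWord K τ w) :
    0 ≤ wordTime w :=
  le_trans (by positivity) hw.length_mul_le

theorem switchProd_congr {Z Z' : SwitchingSignal α} {k : ℕ} (hv : ∀ j < k, Z.value j = Z'.value j)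
    (ht : ∀ j ≤ k, Z.time j = Z'.time j) : switchProd F R Z k = switchProd F R Z' k := by
  induction k with
  | zero => rfl
  | succ k ih =>
    rw [switchProd, switchProd, ih (fun j hj => hv j (by omega)) (fun j hj => ht j (by omega)),
      hv k (by omega), ht k (by omega), ht (k + 1) le_rfl]

/-- Every word is followed by a signal. -/
theorem exists_signal_of_word (hτ : 0 < τ) (w : List (α × ℝ)) (hw : IsDwellWord K τ w) :
    ∀ σ ∈ K, ∃ Z ∈ SwitchingSignal.withDwell K τ, Z.num = w.length ∧
      Z.time w.length = wordTime w ∧ Z.value w.length = σ ∧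
      ∀ F R, switchProd (n := n) F R Z w.length = wordFlow F R w := by
  induction w with
  | nil =>
    intro σ hσ
    refine ⟨⟨0, fun _ => 0, fun _ => σ, rfl, fun k hk => ?_, fun h => ?_⟩, ⟨fun k _ => hσ, ?_⟩,
      rfl, rfl, rfl, fun _ _ => rfl⟩
    · simp at hk
    · simp at h
    · intro k hk
      simp at hk
  | cons l w ih =>
    intro σ hσ
    rw [isDwellWord_cons] at hw
    -- The signal built from the shorter word ends in the mode `l.1`, kept forever. One more
    -- switching, after a stay of duration `l.2`, is recorded at index m + 1.
    obtain ⟨Z, ⟨hZK, hZτ⟩, hnum, htime, hval, hprod⟩ := ih hw.2 l.1 hw.1.1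
    set m := w.length
    have hlast : ∀ k : ℕ, ((k + 1 : ℕ) : ℕ∞) ≤ ((m + 1 : ℕ) : ℕ∞) →
        ((k + 1 : ℕ) : ℕ∞) ≤ Z.num ∨ k = m := fun k hk => by
      rw [hnum]
      have : k + 1 ≤ m + 1 := by exact_mod_cast hk
      rcases Nat.lt_or_ge k m with h | h
      · left; exact_mod_cast h
      · right; omega
    have hle : ∀ k : ℕ, (k : ℕ∞) ≤ Z.num → k ≠ m + 1 := fun k hk => by
      rw [hnum] at hk
      have : k ≤ m := by exact_mod_cast hk
      omega
    have hstep : ∀ k : ℕ, ((k + 1 : ℕ) : ℕ∞) ≤ ((m + 1 : ℕ) : ℕ∞) →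
        Function.update Z.time (m + 1) (l.2 + wordTime w) k + τ ≤
          Function.update Z.time (m + 1) (l.2 + wordTime w) (k + 1) := fun k hk => by
      rcases hlast k hk with h | rfl
      · have h1 : (k : ℕ∞) ≤ Z.num := le_trans (by exact_mod_cast Nat.le_succ k) h
        rw [Function.update_of_ne (hle _ h1), Function.update_of_ne (hle _ h)]
        exact hZτ k h
      · rw [Function.update_of_ne (by omega), Function.update_self, htime]
        linarith [hw.1.2]
    refine ⟨⟨(m + 1 : ℕ), Function.update Z.time (m + 1) (l.2 + wordTime w),
      Function.update Z.value (m + 1) σ, ?_, fun k hk => ?_, fun h => ?_⟩, ⟨fun k hk => ?_, hstep⟩,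
      rfl, ?_, ?_, fun F R => ?_⟩
    · rw [Function.update_of_ne (by omega), Z.time_zero]
    · linarith [hstep k hk]
    · exact absurd h (ENat.natCast_ne_top _)
    · have hk' : k ≤ m + 1 := by
        exact_mod_cast (show (k : ℕ∞) ≤ ((m + 1 : ℕ) : ℕ∞) from hk)
      rcases Nat.lt_or_ge k (m + 1) with h | h
      · simp only [Function.update_of_ne h.ne]
        refine hZK k ?_
        rw [hnum]
        exact_mod_cast Nat.lt_succ_iff.mp h
      · have : k = m + 1 := by omega
        simp [this, hσ]
    · simp [m]
    · simp [m]
    · rw [List.length_cons, switchProd, wordFlow_cons, ← hprod F R]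
      congr 1
      · simp only [m, Function.update_self]
        rw [Function.update_of_ne (by omega), Function.update_of_ne (by omega)]
        rw [hval, htime]
        congr 2
        ring
      · refine switchProd_congr (fun j hj => ?_) fun j hj => ?_
        · exact Function.update_of_ne (by omega) ..
        · exact Function.update_of_ne (by omega) ..

/-- A word followed by a stay of duration `s` in a mode is the flow of a signal. -/
theorem exists_hybridFlow_eq (hτ : 0 < τ) {w : List (α × ℝ)} (hw : IsDwellWord K τ w) {σ : α}
    (hσ : σ ∈ K) {s : ℝ} (hs : 0 ≤ s) :
    ∃ Z ∈ SwitchingSignal.withDwell K τ,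
      ∀ F R, hybridFlow (n := n) F R Z (wordTime w + s) = F σ s * wordFlow F R w := by
  obtain ⟨Z, hZ, hnum, htime, hval, hprod⟩ := exists_signal_of_word (n := n) hτ w hw σ hσ
  refine ⟨Z, hZ, fun F R => ?_⟩
  have hidx : Z.index (wordTime w + s) = w.length := by
    refine Z.index_eq hnum.ge (by rw [htime]; linarith) fun h => ?_
    rw [hnum] at h
    have : w.length + 1 ≤ w.length := by exact_mod_cast h
    omega
  rw [hybridFlow, SwitchingSignal.eval, hidx, htime, hval, hprod]
  congr 2
  ring

/-- The flow at a switching time is the flow of a word. -/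
theorem exists_word_of_signal {Z : SwitchingSignal α} (hZ : Z ∈ SwitchingSignal.withDwell K τ)
    (k : ℕ) (hk : (k : ℕ∞) ≤ Z.num) :
    ∃ w, IsDwellWord K τ w ∧ wordTime w = Z.time k ∧
      ∀ F R, switchProd (n := n) F R Z k = wordFlow F R w := by
  induction k with
  | zero => exact ⟨[], isDwellWord_nil, by simp [Z.time_zero], fun _ _ => rfl⟩
  | succ k ih =>
    have hk' : (k : ℕ∞) ≤ Z.num := le_trans (by exact_mod_cast Nat.le_succ k) hk
    obtain ⟨w, hw, ht, hp⟩ := ih hk'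
    refine ⟨(Z.value k, Z.time (k + 1) - Z.time k) :: w, isDwellWord_cons.mpr
      ⟨⟨hZ.1 k hk', by have := hZ.2 k hk; simp only; linarith⟩, hw⟩, by simp [ht], fun F R => ?_⟩
    rw [switchProd, hp, wordFlow_cons]

theorem norm_exp_smul_le_of_norm_le {X : Matrix n n ℝ} {C s t : ℝ}
    (h : ‖X‖ ≤ C * Real.exp (s + t)) : ‖Real.exp (-s) • X‖ ≤ C * Real.exp t := by
  rw [norm_smul, Real.norm_of_nonneg (Real.exp_pos _).le]
  calc Real.exp (-s) * ‖X‖ ≤ Real.exp (-s) * (C * Real.exp (s + t)) := by gcongr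
    _ = C * Real.exp t * (Real.exp (-s) * Real.exp s) := by rw [Real.exp_add]; ring
    _ = C * Real.exp t := by rw [← Real.exp_add]; simp

end HybridFlow

/-! ### Upper semicontinuity of the growth rate, by an extremal norm -/

section UpperSemicontinuity

open scoped Matrix.Norms.L2Operator
open Matrix

variable {α n : Type*} [Fintype n] [DecidableEq n]
  {F G : α → ℝ → Matrix n n ℝ} {R : α → Matrix n n ℝ} {K : Set α} {τ : ℝ}

/-- A growth bound for the flows of signals is a growth bound for the products of words. -/
theorem exists_word_bound [Nonempty n] (hτ : 0 < τ) {CR : ℝ} (hR : ∀ σ ∈ K, ‖R σ‖ ≤ CR)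
    (hG : ∀ t₁, ∃ C, ∀ σ ∈ K, ∀ s, 0 ≤ s → s ≤ t₁ → ‖G σ s‖ ≤ C) {μ C t₀ : ℝ}
    (h : ∀ Z ∈ SwitchingSignal.withDwell K τ, ∀ t, t₀ ≤ t →
      ‖hybridFlow G R Z t‖ ≤ C * Real.exp (μ * t)) :
    ∃ C₀, 1 ≤ C₀ ∧ (∀ w, IsDwellWord K τ w → ‖wordFlow G R w‖ ≤ C₀ * Real.exp (μ * wordTime w)) ∧
      ∀ w, IsDwellWord K τ w → ∀ σ ∈ K, ∀ s, 0 ≤ s →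
        ‖G σ s * wordFlow G R w‖ ≤ C₀ * Real.exp (μ * (wordTime w + s)) := by
  obtain ⟨CG, hCG⟩ := hG t₀
  set b := max 1 (max CR 0 * max CG 0)
  have hb1 : 1 ≤ b := le_max_left _ _
  have hshort : ∀ w, IsDwellWord K τ w → wordTime w ≤ t₀ → ‖wordFlow G R w‖ ≤ b ^ w.length := by
    intro w
    induction w with
    | nil => simp
    | cons l w ih =>
      intro hw ht
      rw [isDwellWord_cons] at hw
      rw [wordTime_cons] at ht
      have h0 := hw.2.wordTime_nonneg hτ.le
      have hl : 0 ≤ l.2 := hτ.le.trans hw.1.2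
      rw [wordFlow_cons, List.length_cons, pow_succ']
      refine (norm_mul_le _ _).trans ?_
      gcongr
      · refine le_trans ?_ (le_max_right _ _)
        refine (norm_mul_le _ _).trans ?_
        gcongr
        · exact (hR _ hw.1.1).trans (le_max_left _ _)
        · exact (hCG _ hw.1.1 _ hl (by linarith)).trans (le_max_left _ _)
      · exact ih hw.2 (by linarith)
  -- The dwell time bounds the number of letters of a word that lasts at most t₀.
  set m := ⌈t₀ / τ⌉₊
  have hexp : ∀ t, 0 ≤ t → t ≤ t₀ → 1 ≤ Real.exp (|μ| * t₀) * Real.exp (μ * t) := by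
    intro t ht htt
    rw [← Real.exp_add, Real.one_le_exp_iff]
    have h1 : |μ| * t ≤ |μ| * t₀ := by gcongr
    have h2 : -|μ| * t ≤ μ * t := by gcongr; exact neg_abs_le μ
    linarith
  set C₁ := max C 0 + max CG 0 * b ^ m * Real.exp (|μ| * t₀)
  have hC₁ : 0 ≤ C₁ := by positivity
  have hmain : ∀ w, IsDwellWord K τ w → ∀ σ ∈ K, ∀ s, 0 ≤ s →
      ‖G σ s * wordFlow G R w‖ ≤ C₁ * Real.exp (μ * (wordTime w + s)) := by
    intro w hw σ hσ s hs
    have hw0 := hw.wordTime_nonneg hτ.le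
    rcases le_total t₀ (wordTime w + s) with ht | ht
    · obtain ⟨Z, hZ, hZf⟩ := exists_hybridFlow_eq (n := n) hτ hw hσ hs
      rw [← hZf G R]
      refine (h Z hZ _ ht).trans ?_
      gcongr
      refine (le_max_left C 0).trans (le_add_of_nonneg_right (by positivity))
    · have hlen : w.length ≤ m := by
        have h1 := hw.length_mul_le
        have h2 : (w.length : ℝ) ≤ t₀ / τ := by
          rw [le_div_iff₀ hτ]; linarith
        exact_mod_cast h2.trans (Nat.le_ceil _)
      calc _ ≤ ‖G σ s‖ * ‖wordFlow G R w‖ := norm_mul_le _ _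
        _ ≤ max CG 0 * b ^ m := by
          gcongr
          · exact (hCG σ hσ s hs (by linarith)).trans (le_max_left _ _)
          · exact (hshort w hw (by linarith)).trans (pow_le_pow_right₀ hb1 hlen)
        _ ≤ max CG 0 * b ^ m * (Real.exp (|μ| * t₀) * Real.exp (μ * (wordTime w + s))) :=
          le_mul_of_one_le_right (by positivity) (hexp _ (by linarith) ht)
        _ = max CG 0 * b ^ m * Real.exp (|μ| * t₀) * Real.exp (μ * (wordTime w + s)) := by ring
        _ ≤ _ := by
          gcongr
          exact le_add_of_nonneg_left (le_max_right _ _)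
  -- The summand 1 serves the empty word, C₁ a product that ends in a stay, and `max CR 0 * C₁` one
  -- that ends in a jump.
  refine ⟨1 + C₁ + max CR 0 * C₁, by have : 0 ≤ max CR 0 * C₁ := by positivity
                                     linarith, fun w hw => ?_, fun w hw σ hσ s hs => ?_⟩
  · cases w with
    | nil =>
      have : 0 ≤ max CR 0 * C₁ := by positivity
      simp; linarith
    | cons l w =>
      rw [isDwellWord_cons] at hw
      rw [wordFlow_cons, mul_assoc, wordTime_cons, add_comm l.2]
      calc _ ≤ ‖R l.1‖ * ‖G l.1 l.2 * wordFlow G R w‖ := norm_mul_le _ _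
        _ ≤ max CR 0 * (C₁ * Real.exp (μ * (wordTime w + l.2))) := by
          gcongr
          · exact (hR _ hw.1.1).trans (le_max_left _ _)
          · exact hmain w hw.2 _ hw.1.1 _ (hτ.le.trans hw.1.2)
        _ = (max CR 0 * C₁) * Real.exp (μ * (wordTime w + l.2)) := by ring
        _ ≤ _ := by
          gcongr
          linarith
  · refine (hmain w hw σ hσ s hs).trans ?_
    gcongr
    have : 0 ≤ max CR 0 * C₁ := by positivity
    linarith

/-- The normalized products that can follow a state: after a jump (`none`), or during a stay in a
mode (`some σ`). -/
inductive Continuation (G : α → ℝ → Matrix n n ℝ) (R : α → Matrix n n ℝ) (K : Set α) (τ μ : ℝ) :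
    Option α → Matrix n n ℝ → Prop
  | one (o : Option α) (ho : ∀ σ ∈ o, σ ∈ K) : Continuation G R K τ μ o 1
  | stay {σ : α} {c : Matrix n n ℝ} (s : ℝ) (hs : 0 ≤ s) (hc : Continuation G R K τ μ (some σ) c) :
      Continuation G R K τ μ (some σ) (Real.exp (-(μ * s)) • (c * G σ s))
  | dwell {σ : α} {c : Matrix n n ℝ} (s : ℝ) (hs : τ ≤ s) (hσ : σ ∈ K)
      (hc : Continuation G R K τ μ (some σ) c) :
      Continuation G R K τ μ none (Real.exp (-(μ * s)) • (c * G σ s))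
  | jump {c : Matrix n n ℝ} (σ : α) (hσ : σ ∈ K) (hc : Continuation G R K τ μ none c) :
      Continuation G R K τ μ (some σ) (c * R σ)

/-- Induction moves the factors of `c` one by one into the past, which remains admissible. In a
state `some σ` the past must already contain a stay of duration at least τ in σ, since otherwise the
next jump would produce a forbidden word. -/
theorem Continuation.word_bound {μ C₀ : ℝ} (hτ : 0 < τ)
    (hadd : ∀ σ ∈ K, ∀ s t, G σ (s + t) = G σ s * G σ t)
    (hw1 : ∀ w, IsDwellWord K τ w → ‖wordFlow G R w‖ ≤ C₀ * Real.exp (μ * wordTime w))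
    (hw2 : ∀ w, IsDwellWord K τ w → ∀ σ ∈ K, ∀ s, 0 ≤ s →
        ‖G σ s * wordFlow G R w‖ ≤ C₀ * Real.exp (μ * (wordTime w + s)))
    {o : Option α} {c : Matrix n n ℝ} (hc : Continuation G R K τ μ o c) :
    (∀ σ ∈ o, σ ∈ K ∧ ∀ w, IsDwellWord K τ w → ∀ s, τ ≤ s →
      ‖c * (G σ s * wordFlow G R w)‖ ≤ C₀ * Real.exp (μ * (wordTime w + s))) ∧
    (o = none → ∀ w, IsDwellWord K τ w →
      ‖c * wordFlow G R w‖ ≤ C₀ * Real.exp (μ * wordTime w)) := by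
  induction hc with
  | one o ho =>
    refine ⟨fun σ hσ => ⟨ho σ hσ, fun w hw s hs => ?_⟩, fun _ w hw => ?_⟩
    · rw [one_mul]; exact hw2 w hw σ (ho σ hσ) s (hτ.le.trans hs)
    · rw [one_mul]; exact hw1 w hw
  | @stay σ c s hs hc ih =>
    refine ⟨fun σ' hσ' => ?_, fun h => by simp at h⟩
    obtain rfl : σ = σ' := by simpa using hσ'
    obtain ⟨hK, ih⟩ := ih.1 σ rfl
    refine ⟨hK, fun w hw t ht => ?_⟩
    rw [smul_mul_assoc, mul_assoc, ← mul_assoc (G σ s), ← hadd σ hK]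
    refine norm_exp_smul_le_of_norm_le ((ih w hw (s + t) (by linarith)).trans (le_of_eq ?_))
    congr 2; ring
  | @dwell σ c s hs hσ hc ih =>
    refine ⟨fun σ' hσ' => by simp at hσ', fun _ w hw => ?_⟩
    obtain ⟨hK, ih⟩ := ih.1 σ rfl
    rw [smul_mul_assoc, mul_assoc]
    refine norm_exp_smul_le_of_norm_le ((ih w hw s hs).trans (le_of_eq ?_))
    congr 2; ring
  | @jump c σ hσ hc ih =>
    refine ⟨fun σ' hσ' => ?_, fun h => by simp at h⟩
    obtain rfl : σ = σ' := by simpa using hσ'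
    refine ⟨hσ, fun w hw s hs => ?_⟩
    have := ih.2 rfl ((σ, s) :: w) (isDwellWord_cons.mpr ⟨⟨hσ, hs⟩, hw⟩)
    simpa [mul_assoc, add_comm] using this

/-- The bound must hold on all vectors and not just on those reached by the limit flow, because the
errors made below are arbitrary. After a jump, `word_bound` with the empty past gives C₀. During a
stay, the remaining stays merge into one (C₀), followed by a jump (CR) and a continuation after that
jump (C₀). -/
theorem Continuation.norm_le [Nonempty n] {μ C₀ CR : ℝ} (hτ : 0 < τ) (hC₀ : 1 ≤ C₀) (hCR : 1 ≤ CR)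
    (hR : ∀ σ ∈ K, ‖R σ‖ ≤ CR)
    (hadd : ∀ σ ∈ K, ∀ s t, G σ (s + t) = G σ s * G σ t)
    (hw1 : ∀ w, IsDwellWord K τ w → ‖wordFlow G R w‖ ≤ C₀ * Real.exp (μ * wordTime w))
    (hw2 : ∀ w, IsDwellWord K τ w → ∀ σ ∈ K, ∀ s, 0 ≤ s →
        ‖G σ s * wordFlow G R w‖ ≤ C₀ * Real.exp (μ * (wordTime w + s)))
    {o : Option α} {c : Matrix n n ℝ} (hc : Continuation G R K τ μ o c) :
    ‖c‖ ≤ C₀ * CR * C₀ ∧ ∀ σ ∈ o, σ ∈ K ∧ ∀ s, 0 ≤ s →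
      ‖c * G σ s‖ ≤ C₀ * CR * C₀ * Real.exp (μ * s) := by
  have hG0 : ∀ σ ∈ K, ∀ s, 0 ≤ s → ‖G σ s‖ ≤ C₀ * Real.exp (μ * s) := fun σ hσ s hs => by
    simpa using hw2 [] isDwellWord_nil σ hσ s hs
  have h1 : 1 ≤ C₀ * CR := one_le_mul_of_one_le_of_one_le hC₀ hCR
  have h2 : C₀ ≤ C₀ * CR * C₀ := le_mul_of_one_le_left (by linarith) h1
  have h3 : C₀ * CR ≤ C₀ * CR * C₀ := le_mul_of_one_le_right (by linarith) hC₀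
  have hnone : ∀ c, Continuation G R K τ μ none c → ‖c‖ ≤ C₀ := fun c hc => by
    simpa using (hc.word_bound hτ hadd hw1 hw2).2 rfl [] isDwellWord_nil
  induction hc with
  | one o ho =>
    refine ⟨by rw [norm_one]; linarith, fun σ hσ => ⟨ho σ hσ, fun s hs => ?_⟩⟩
    rw [one_mul]
    exact (hG0 σ (ho σ hσ) s hs).trans (by gcongr)
  | @stay σ c s hs hc ih =>
    obtain ⟨hK, ih⟩ := ih.2 σ rfl
    refine ⟨?_, fun σ' hσ' => ?_⟩
    · simpa using norm_exp_smul_le_of_norm_le (t := 0) (by simpa using ih s hs)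
    · obtain rfl : σ = σ' := by simpa using hσ'
      refine ⟨hK, fun t ht => ?_⟩
      rw [smul_mul_assoc, mul_assoc, ← hadd σ hK]
      refine norm_exp_smul_le_of_norm_le ((ih (s + t) (by linarith)).trans (le_of_eq ?_))
      congr 2; ring
  | @dwell σ c s hs hσ hc ih =>
    exact ⟨(hnone _ (.dwell s hs hσ hc)).trans h2, fun σ' hσ' => by simp at hσ'⟩
  | @jump c σ hσ hc ih =>
    have hcR : ‖c * R σ‖ ≤ C₀ * CR := by
      refine (norm_mul_le _ _).trans ?_
      gcongr
      · exact hnone c hc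
      · exact hR σ hσ
    refine ⟨hcR.trans h3, fun σ' hσ' => ?_⟩
    obtain rfl : σ = σ' := by simpa using hσ'
    refine ⟨hσ, fun s hs => ?_⟩
    calc _ ≤ ‖c * R σ‖ * ‖G σ s‖ := norm_mul_le _ _
      _ ≤ C₀ * CR * (C₀ * Real.exp (μ * s)) := by
        gcongr
        exact hG0 σ hσ s hs
      _ = _ := by ring

/-- **Upper semicontinuity of the growth rate.** -/
theorem exists_growth_bound_of_close [Nonempty n] (hτ : 0 < τ) {CR : ℝ} (hR : ∀ σ ∈ K, ‖R σ‖ ≤ CR)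
    (hadd : ∀ σ ∈ K, ∀ s t, G σ (s + t) = G σ s * G σ t)
    (hG : ∀ t₁, ∃ C, ∀ σ ∈ K, ∀ s, 0 ≤ s → s ≤ t₁ → ‖G σ s‖ ≤ C) {μ C t₀ : ℝ}
    (h : ∀ Z ∈ SwitchingSignal.withDwell K τ, ∀ t, t₀ ≤ t →
      ‖hybridFlow G R Z t‖ ≤ C * Real.exp (μ * t)) {μ₁ : ℝ} (hμ : μ < μ₁) :
    ∃ η > 0, ∀ F : α → ℝ → Matrix n n ℝ, (∀ σ ∈ K, ∀ s t, F σ (s + t) = F σ s * F σ t) →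
      (∃ CF, ∀ σ ∈ K, ∀ s, 0 ≤ s → s ≤ τ → ‖F σ s‖ ≤ CF) →
      (∀ σ ∈ K, ∀ s, τ ≤ s → s ≤ 2 * τ → ‖F σ s - G σ s‖ ≤ η) →
      ∃ C', ∀ Z ∈ SwitchingSignal.withDwell K τ, ∀ t, 0 ≤ t →
        ‖hybridFlow F R Z t‖ ≤ C' * Real.exp (μ₁ * t) := by
  obtain ⟨C₀, hC₀, hw1, hw2⟩ := exists_word_bound hτ hR hG h
  set C₁ := C₀ * max CR 1 * C₀
  have hC₁ : 0 < C₁ := by positivity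
  have hcont : ∀ {o c}, Continuation G R K τ μ o c → ‖c‖ ≤ C₁ := fun hc =>
    (hc.norm_le hτ hC₀ (le_max_right CR 1) (fun σ hσ => (hR σ hσ).trans (le_max_left _ _))
      hadd hw1 hw2).1
  -- A lower bound for e^{μ₁ s} − e^{μ s} on [τ, 2τ]. An error δ / C₁ in the flow, seen through
  -- continuations of norm at most C₁, fits in this gap.
  set δ := Real.exp (-(|μ| * (2 * τ))) * ((μ₁ - μ) * τ)
  have hδ : 0 < δ := mul_pos (Real.exp_pos _) (mul_pos (by linarith) hτ)
  refine ⟨δ / C₁, by positivity, fun F hFadd ⟨CF, hCF⟩ hFG => ?_⟩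
  have hgap : ∀ s, τ ≤ s → s ≤ 2 * τ →
      Real.exp (μ * s) + δ ≤ Real.exp (μ₁ * s) := fun s hs hs2 => by
    have h1 : (μ₁ - μ) * τ + 1 ≤ Real.exp ((μ₁ - μ) * s) := by
      refine le_trans ?_ (Real.add_one_le_exp _)
      gcongr
    have h2 : Real.exp (-(|μ| * (2 * τ))) ≤ Real.exp (μ * s) := by
      rw [Real.exp_le_exp]
      have h3 : |μ| * s ≤ |μ| * (2 * τ) := by gcongr
      have h4 : -|μ| * s ≤ μ * s :=
        mul_le_mul_of_nonneg_right (neg_abs_le μ) (hτ.le.trans hs)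
      linarith
    have h5 : 0 ≤ (μ₁ - μ) * τ := (mul_pos (by linarith) hτ).le
    calc Real.exp (μ * s) + δ ≤ Real.exp (μ * s) + Real.exp (μ * s) * ((μ₁ - μ) * τ) := by
          gcongr
          exact mul_le_mul_of_nonneg_right h2 h5
      _ = Real.exp (μ * s) * ((μ₁ - μ) * τ + 1) := by ring
      _ ≤ Real.exp (μ * s) * Real.exp ((μ₁ - μ) * s) := by gcongr
      _ = Real.exp (μ₁ * s) := by rw [← Real.exp_add]; congr 1; ring
  have hshort : ∀ σ ∈ K, ∀ s, τ ≤ s → s ≤ 2 * τ → ∀ o : Option α, (∀ c,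
      Continuation G R K τ μ (some σ) c →
        Continuation G R K τ μ o (Real.exp (-(μ * s)) • (c * G σ s))) →
      (∃ c, Continuation G R K τ μ o c ∧ c = 1) → ∀ V b,
      (∀ c, Continuation G R K τ μ o c → ‖c * V‖ ≤ b) →
      ∀ c, Continuation G R K τ μ (some σ) c → ‖c * (F σ s * V)‖ ≤ Real.exp (μ₁ * s) * b := by
    rintro σ hσ s hs hs2 o ho ⟨_, h1, rfl⟩ V b hV c hc
    have hVb : ‖V‖ ≤ b := by simpa using hV 1 h1
    have hb : 0 ≤ b := (norm_nonneg _).trans hVb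
    -- The limit flow is absorbed into the continuation, so that part costs only e^{μs}. The
    -- difference F − G is estimated crudely, with ‖V‖ ≤ b because the identity is a continuation.
    have e1 : c * (F σ s * V) = Real.exp (μ * s) • (Real.exp (-(μ * s)) • (c * G σ s) * V) +
        c * (F σ s - G σ s) * V := by
      rw [smul_mul_assoc, smul_smul, ← Real.exp_add, add_neg_cancel, Real.exp_zero, one_smul,
        mul_sub, sub_mul, ← mul_assoc]
      abel
    rw [e1]
    calc _ ≤ Real.exp (μ * s) * b + C₁ * (δ / C₁) * b := by
          refine (norm_add_le _ _).trans (add_le_add ?_ ?_)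
          · rw [norm_smul, Real.norm_of_nonneg (Real.exp_pos _).le]
            gcongr
            exact hV _ (ho c hc)
          · refine (norm_mul_le _ _).trans ?_
            gcongr
            refine (norm_mul_le _ _).trans ?_
            gcongr
            · exact hcont hc
            · exact hFG σ hσ s hs hs2
      _ = (Real.exp (μ * s) + δ) * b := by field_simp
      _ ≤ _ := by
        gcongr
        exact hgap s hs hs2
  -- A stay is cut into pieces of length τ, except that the earliest piece has length in [τ, 2τ].
  -- That earliest piece is a `dwell`, the later ones are `stay`.
  have hlong : ∀ σ ∈ K, ∀ V b, (∀ c, Continuation G R K τ μ none c → ‖c * V‖ ≤ b) →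
      ∀ m : ℕ, ∀ s, τ ≤ s → s ≤ (m + 2) * τ →
      ∀ c, Continuation G R K τ μ (some σ) c → ‖c * (F σ s * V)‖ ≤ Real.exp (μ₁ * s) * b := by
    intro σ hσ V b hV m
    induction m with
    | zero =>
      intro s hs hs2
      exact hshort σ hσ s hs (by simpa using hs2) none (fun c hc => .dwell s hs hσ hc)
        ⟨1, .one _ (by simp), rfl⟩ V b hV
    | succ m ih =>
      intro s hs hsm
      rcases le_total s (2 * τ) with hs2 | hs2
      · exact hshort σ hσ s hs hs2 none (fun c hc => .dwell s hs hσ hc)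
          ⟨1, .one _ (by simp), rfl⟩ V b hV
      · push_cast at hsm
        have ih' := ih (s - τ) (by linarith) (by linarith)
        have := hshort σ hσ τ le_rfl (by linarith) (some σ) (fun c hc => .stay τ hτ.le hc)
          ⟨1, .one _ (by simpa using hσ), rfl⟩ _ _ ih'
        intro c hc
        have e := hFadd σ hσ τ (s - τ)
        rw [add_sub_cancel] at e
        rw [e, mul_assoc]
        refine (this c hc).trans (le_of_eq ?_)
        rw [← mul_assoc, ← Real.exp_add]
        congr 2; ring
  have hlong' : ∀ σ ∈ K, ∀ V b, (∀ c, Continuation G R K τ μ none c → ‖c * V‖ ≤ b) →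
      ∀ s, τ ≤ s →
      ∀ c, Continuation G R K τ μ (some σ) c → ‖c * (F σ s * V)‖ ≤ Real.exp (μ₁ * s) * b := by
    intro σ hσ V b hV s hs
    refine hlong σ hσ V b hV ⌈s / τ⌉₊ s hs ?_
    have := Nat.le_ceil (s / τ)
    rw [div_le_iff₀ hτ] at this
    linarith
  have hword : ∀ w, IsDwellWord K τ w → ∀ c, Continuation G R K τ μ none c →
      ‖c * wordFlow F R w‖ ≤ C₁ * Real.exp (μ₁ * wordTime w) := by
    intro w
    induction w with
    | nil => intro _ c hc; simpa using hcont hc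
    | cons l w ih =>
      intro hw c hc
      rw [isDwellWord_cons] at hw
      have := hlong' l.1 hw.1.1 _ _ (ih hw.2) l.2 hw.1.2 _ (.jump l.1 hw.1.1 hc)
      rw [wordFlow_cons, wordTime_cons]
      calc _ = ‖c * R l.1 * (F l.1 l.2 * wordFlow F R w)‖ := by simp only [mul_assoc]
        _ ≤ _ := this
        _ = _ := by rw [mul_add, Real.exp_add]; ring
  -- The last stay may be shorter than τ, where F and G need not be close; there the bound CF is
  -- used, once.
  refine ⟨C₁ * (1 + max CF 0 * Real.exp (|μ₁| * τ)), fun Z hZ t ht => ?_⟩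
  obtain ⟨hi1, hi2, -⟩ := Z.index_spec ht
  obtain ⟨w, hw, hwt, hwp⟩ := exists_word_of_signal (n := n) hZ _ hi1
  have hσ : Z.eval t ∈ K := hZ.1 _ hi1
  rw [hybridFlow, hwp, ← hwt]
  have hbound := hword w hw
  set σ := Z.eval t
  have hs : 0 ≤ t - wordTime w := by rw [hwt]; linarith
  rcases le_total τ (t - wordTime w) with hτs | hτs
  · have := hlong' σ hσ _ _ hbound _ hτs 1 (.one _ (by simpa using hσ))
    rw [one_mul] at this
    calc _ ≤ _ := this
      _ = C₁ * 1 * Real.exp (μ₁ * t) := by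
        rw [mul_left_comm, ← Real.exp_add, mul_one]; congr 2; ring
      _ ≤ _ := by
        gcongr
        exact le_add_of_nonneg_right (by positivity)
  · have h1 : ‖wordFlow F R w‖ ≤ C₁ * Real.exp (μ₁ * wordTime w) := by
      simpa using hbound 1 (.one _ (by simp))
    have h2 : Real.exp (μ₁ * wordTime w) ≤ Real.exp (|μ₁| * τ) * Real.exp (μ₁ * t) := by
      rw [← Real.exp_add, Real.exp_le_exp]
      have h3 : |μ₁| * (t - wordTime w) ≤ |μ₁| * τ := by gcongr
      have h4 : -|μ₁| * (t - wordTime w) ≤ μ₁ * (t - wordTime w) := by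
        gcongr
        exact neg_abs_le μ₁
      linarith
    calc _ ≤ max CF 0 * (C₁ * (Real.exp (|μ₁| * τ) * Real.exp (μ₁ * t))) := by
          refine (norm_mul_le _ _).trans ?_
          gcongr
          · exact (hCF σ hσ _ hs hτs).trans (le_max_left _ _)
          · exact h1.trans (by gcongr)
      _ = C₁ * (max CF 0 * Real.exp (|μ₁| * τ)) * Real.exp (μ₁ * t) := by ring
      _ ≤ _ := by
        gcongr
        linarith

end UpperSemicontinuity

/-! ### Lower semicontinuity of the growth rate, by Berger–Wang -/

section LowerSemicontinuity

open scoped Matrix.Norms.L2Operator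
open Matrix

variable {α n : Type*} [Fintype n] [DecidableEq n]
  {F G : α → ℝ → Matrix n n ℝ} {R : α → Matrix n n ℝ} {K : Set α} {τ : ℝ}

theorem Matrix.div_mem_complexSpectrum {A : Matrix n n ℝ} {c : ℝ} (hc : c ≠ 0) {z : ℂ}
    (hz : z ∈ (c • A).complexSpectrum) : z / c ∈ A.complexSpectrum := by
  unfold complexSpectrum at *
  have h1 : (c • A).map (algebraMap ℝ ℂ) = (c : ℂ) • A.map (algebraMap ℝ ℂ) := by
    ext i j; simp
  have hc' : (c : ℂ) ≠ 0 := by exact_mod_cast hc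
  rw [h1, Matrix.mem_spectrum_iff_exists_mulVec] at hz
  obtain ⟨v, hv, h⟩ := hz
  refine Matrix.mem_spectrum_iff_exists_mulVec.mpr ⟨v, hv, ?_⟩
  rw [Matrix.smul_mulVec] at h
  rw [div_eq_inv_mul, mul_smul, ← h, smul_smul, inv_mul_cancel₀ hc', one_smul]

theorem Matrix.norm_le_of_mem_complexSpectrum_exp_smul {A : Matrix n n ℝ} {s b : ℝ}
    (h : ∀ z ∈ A.complexSpectrum, ‖z‖ ≤ Real.exp b) {z : ℂ}
    (hz : z ∈ (Real.exp s • A).complexSpectrum) : ‖z‖ ≤ Real.exp (s + b) := by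
  have := h _ (Matrix.div_mem_complexSpectrum (Real.exp_pos s).ne' hz)
  rw [norm_div, Complex.norm_real, Real.norm_of_nonneg (Real.exp_pos s).le,
    div_le_iff₀ (Real.exp_pos s)] at this
  rw [add_comm, Real.exp_add]
  exact this

theorem wordFlow_append (w w' : List (α × ℝ)) :
    wordFlow F R (w ++ w') = wordFlow F R w * wordFlow F R w' := by
  simp [wordFlow]

/-- If the spectral radii of all products are at most `e ^ (μ t)`, then the growth rate is
at most `μ`. -/
theorem exists_growth_bound_of_complexSpectrum_le [Nonempty n] [TopologicalSpace α]
    (hK : IsCompact K) (hτ : 0 < τ) {CR : ℝ} (hR : ∀ σ ∈ K, ‖R σ‖ ≤ CR)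
    (hadd : ∀ σ ∈ K, ∀ s t, G σ (s + t) = G σ s * G σ t)
    (hG : ∃ C, ∀ σ ∈ K, ∀ s, 0 ≤ s → s ≤ τ → ‖G σ s‖ ≤ C)
    (hcont : ContinuousOn (fun σ => G σ τ) K) {μ μ₂ : ℝ} (hμ : μ < μ₂)
    (h1 : ∀ σ ∈ K, ∀ z ∈ (G σ τ).complexSpectrum, ‖z‖ ≤ Real.exp (μ * τ))
    (h2 : ∀ w, IsDwellWord K τ w →
      ∀ z ∈ (wordFlow G R w).complexSpectrum, ‖z‖ ≤ Real.exp (μ * wordTime w)) :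
    ∃ C, ∀ Z ∈ SwitchingSignal.withDwell K τ, ∀ t, 0 ≤ t →
      ‖hybridFlow G R Z t‖ ≤ C * Real.exp (μ₂ * t) := by
  -- Two margins are needed: μ < ν makes the normalized modes strictly contracting in spectral
  -- radius, and ν < μ₂ leaves room for the rate r > 1 in Berger–Wang.
  obtain ⟨ν, hν, hν₂⟩ := exists_between hμ
  obtain ⟨CG, hCG⟩ := hG
  obtain ⟨C, ρ, hC, hρ0, hρ1, hpow⟩ := exists_norm_pow_le_of_isCompact hK
    (b := fun σ => Real.exp (-(ν * τ)) • G σ τ) (by have h := hcont.const_smul (Real.exp (-(ν * τ))); exact h) (fun σ hσ z hz => by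
      refine (Matrix.norm_le_of_mem_complexSpectrum_exp_smul (h1 σ hσ) hz).trans_lt ?_
      rw [Real.exp_lt_one_iff]
      nlinarith)
  have hstep : ∀ σ ∈ K, ∀ k : ℕ, ∀ r, G σ (k * τ + r) = G σ τ ^ k * G σ r := by
    intro σ hσ k r
    induction k with
    | zero => simp
    | succ k ih =>
      rw [pow_succ', mul_assoc, ← ih, ← hadd σ hσ]
      congr 1; push_cast; ring
  set C₁ := C * max CG 0 * Real.exp (|ν| * τ)
  have hC₁ : 0 ≤ C₁ := by positivity
  -- Durations have no upper bound, so the boundedness of the normalized letters, which Berger–Wang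
  -- requires, has to come from the spectral condition on the modes.
  have hmode : ∀ σ ∈ K, ∀ s, 0 ≤ s → ‖G σ s‖ ≤ C₁ * Real.exp (ν * s) := by
    intro σ hσ s hs
    set k := ⌊s / τ⌋₊
    have hk : k * τ ≤ s := by
      rw [← le_div_iff₀ hτ]; exact Nat.floor_le (by positivity)
    have hk' : s < (k + 1) * τ := by
      rw [← div_lt_iff₀ hτ]; exact Nat.lt_floor_add_one _
    have e1 : G σ s = Real.exp (ν * (k * τ)) •
        ((Real.exp (-(ν * τ)) • G σ τ) ^ k * G σ (s - k * τ)) := by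
      have := hstep σ hσ k (s - k * τ)
      rw [add_sub_cancel] at this
      rw [this, smul_pow, ← Real.exp_nat_mul, smul_mul_assoc, smul_smul, ← Real.exp_add]
      rw [show ν * (k * τ) + k * -(ν * τ) = 0 by ring, Real.exp_zero, one_smul]
    rw [e1, norm_smul, Real.norm_of_nonneg (Real.exp_pos _).le]
    have h3 : Real.exp (ν * (k * τ)) ≤ Real.exp (|ν| * τ) * Real.exp (ν * s) := by
      rw [← Real.exp_add, Real.exp_le_exp]
      have h3 : |ν| * (s - k * τ) ≤ |ν| * τ := by gcongr; linarith
      have h4 : -|ν| * (s - k * τ) ≤ ν * (s - k * τ) :=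
        mul_le_mul_of_nonneg_right (neg_abs_le ν) (by linarith)
      linarith
    calc _ ≤ (Real.exp (|ν| * τ) * Real.exp (ν * s)) * (C * 1 * max CG 0) := by
          gcongr
          refine (norm_mul_le _ _).trans ?_
          gcongr
          · refine (hpow σ hσ k).trans ?_
            gcongr
            exact pow_le_one₀ hρ0.le hρ1.le
          · exact (hCG σ hσ _ (by linarith) (by linarith)).trans (le_max_left _ _)
      _ = _ := by ring
  let ι := {l : α × ℝ // l.1 ∈ K ∧ τ ≤ l.2}
  let a : ι → Matrix n n ℝ := fun l => Real.exp (-(ν * l.1.2)) • (R l.1.1 * G l.1.1 l.1.2)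
  have ha : ∀ w : List ι, IsDwellWord K τ (w.map Subtype.val) ∧ (w.map a).prod =
      Real.exp (-(ν * wordTime (w.map Subtype.val))) • wordFlow G R (w.map Subtype.val) := by
    intro w
    induction w with
    | nil => simp [isDwellWord_nil]
    | cons l w ih =>
      refine ⟨isDwellWord_cons.mpr ⟨l.2, ih.1⟩, ?_⟩
      simp only [List.map_cons, List.prod_cons, wordTime_cons, wordFlow_cons, ih.2]
      rw [smul_mul_smul_comm, ← Real.exp_add]
      congr 2; ring
  -- With r = e^{(μ₂ - ν)τ}, the power of r given by the length of a word is at most e^{(μ₂ - ν)t}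
  -- for its duration t, as each letter lasts at least τ.
  obtain ⟨C₂, hC₂⟩ := Matrix.berger_wang a (β := max CR 0 * C₁) (fun l => by
      have hl : 0 ≤ l.1.2 := hτ.le.trans l.2.2
      refine (norm_exp_smul_le_of_norm_le (t := 0) (C := max CR 0 * C₁) ?_).trans (by simp)
      rw [add_zero]
      refine (norm_mul_le _ _).trans ?_
      rw [mul_assoc]
      gcongr
      · exact (hR _ l.2.1).trans (le_max_left _ _)
      · exact hmode _ l.2.1 _ hl) (fun w z hz => by
      obtain ⟨hw, he⟩ := ha w
      rw [he] at hz
      refine (Matrix.norm_le_of_mem_complexSpectrum_exp_smul (h2 _ hw) hz).trans ?_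
      rw [Real.exp_le_one_iff]
      have := hw.wordTime_nonneg hτ.le
      nlinarith) (r := Real.exp ((μ₂ - ν) * τ)) (Real.one_lt_exp_iff.mpr
        (mul_pos (by linarith) hτ))
  have hword : ∀ w, IsDwellWord K τ w →
      ‖wordFlow G R w‖ ≤ max C₂ 0 * Real.exp (μ₂ * wordTime w) := by
    intro w hw
    obtain ⟨w', rfl⟩ : ∃ w' : List ι, w'.map Subtype.val = w :=
      ⟨w.attach.map fun l => ⟨l.1, hw l.1 l.2⟩, by
        rw [List.map_map]
        exact List.attach_map_subtype_val w⟩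
    have e1 : wordFlow G R (w'.map Subtype.val) =
        Real.exp (ν * wordTime (w'.map Subtype.val)) • (w'.map a).prod := by
      rw [(ha w').2, smul_smul, ← Real.exp_add, add_neg_cancel, Real.exp_zero, one_smul]
    have h3 := hw.length_mul_le
    rw [e1, norm_smul, Real.norm_of_nonneg (Real.exp_pos _).le]
    rw [List.length_map] at h3
    calc _ ≤ Real.exp (ν * wordTime (w'.map Subtype.val)) *
          (max C₂ 0 * Real.exp ((μ₂ - ν) * wordTime (w'.map Subtype.val))) := by
          gcongr
          refine (hC₂ w').trans ?_
          rw [← Real.exp_nat_mul]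
          refine mul_le_mul (le_max_left _ _) (Real.exp_le_exp.mpr ?_) (Real.exp_pos _).le
            (le_max_right _ _)
          rw [mul_left_comm]
          exact mul_le_mul_of_nonneg_left h3 (by linarith)
      _ = _ := by
          rw [mul_left_comm, ← Real.exp_add]
          congr 2; ring
  refine ⟨C₁ * max C₂ 0, fun Z hZ t ht => ?_⟩
  obtain ⟨hi1, hi2, -⟩ := Z.index_spec ht
  obtain ⟨w, hw, hwt, hwp⟩ := exists_word_of_signal (n := n) hZ _ hi1
  rw [hybridFlow, hwp, ← hwt]
  have hs : 0 ≤ t - wordTime w := by rw [hwt]; linarith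
  calc _ ≤ (C₁ * Real.exp (ν * (t - wordTime w))) * (max C₂ 0 * Real.exp (μ₂ * wordTime w)) := by
        refine (norm_mul_le _ _).trans ?_
        gcongr
        · exact hmode _ (hZ.1 _ hi1) _ hs
        · exact hword w hw
    _ ≤ (C₁ * Real.exp (μ₂ * (t - wordTime w))) * (max C₂ 0 * Real.exp (μ₂ * wordTime w)) := by
        gcongr
    _ = C₁ * max C₂ 0 * (Real.exp (μ₂ * (t - wordTime w)) * Real.exp (μ₂ * wordTime w)) := by ring
    _ = _ := by
        rw [← Real.exp_add]
        congr 2; ring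

/-- A large spectral value of the flow of a mode gives signals with large flow. -/
theorem exists_signal_of_mode_complexSpectrum (hτ : 0 < τ)
    (hadd : ∀ σ ∈ K, ∀ s t, F σ (s + t) = F σ s * F σ t) (hzero : ∀ σ ∈ K, F σ 0 = 1)
    {μ : ℝ} {σ : α} (hσ : σ ∈ K) {z : ℂ} (hz : z ∈ (F σ τ).complexSpectrum)
    (hzμ : Real.exp (μ * τ) < ‖z‖) :
    ∃ c > 0, ∃ T > 0, ∀ k : ℕ, ∃ Z ∈ SwitchingSignal.withDwell K τ,
      c * Real.exp (μ * (k * T)) ≤ ‖hybridFlow F R Z (k * T)‖ := by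
  obtain ⟨c, hc, h⟩ := Matrix.exists_pow_norm_le_norm_pow (n := n)
  have hpow : ∀ k : ℕ, F σ (k * τ) = F σ τ ^ k := by
    intro k
    induction k with
    | zero => simp [hzero σ hσ]
    | succ k ih =>
      have : ((k + 1 : ℕ) : ℝ) * τ = τ + k * τ := by push_cast; ring
      rw [this, hadd σ hσ, pow_succ', ih]
  refine ⟨c⁻¹, inv_pos.mpr hc, τ, hτ, fun k => ?_⟩
  obtain ⟨Z, hZ, hZf⟩ := exists_hybridFlow_eq (n := n) hτ (isDwellWord_nil (K := K)) hσ
    (s := k * τ) (by positivity)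
  refine ⟨Z, hZ, ?_⟩
  have e := hZf F R
  rw [wordTime_nil, zero_add, wordFlow_nil, mul_one] at e
  rw [e, hpow, inv_mul_le_iff₀ hc]
  refine le_trans ?_ (h _ z hz k)
  rw [mul_left_comm, Real.exp_nat_mul]
  gcongr

/-- A large spectral value of the flow of a word gives signals with large flow. -/
theorem exists_signal_of_word_complexSpectrum (hτ : 0 < τ)
    (hzero : ∀ σ ∈ K, F σ 0 = 1) {μ : ℝ} {w : List (α × ℝ)} (hw : IsDwellWord K τ w) {z : ℂ}
    (hz : z ∈ (wordFlow F R w).complexSpectrum) (hzμ : Real.exp (μ * wordTime w) < ‖z‖) :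
    ∃ c > 0, ∃ T > 0, ∀ k : ℕ, ∃ Z ∈ SwitchingSignal.withDwell K τ,
      c * Real.exp (μ * (k * T)) ≤ ‖hybridFlow F R Z (k * T)‖ := by
  obtain ⟨c, hc, h⟩ := Matrix.exists_pow_norm_le_norm_pow (n := n)
  cases w with
  | nil =>
    -- The empty word has duration 0 and spectrum {1}, which the strict inequality excludes; hence
    -- the period is positive.
    exfalso
    obtain ⟨v, hv, hvz⟩ := Matrix.mem_spectrum_iff_exists_mulVec.mp hz
    rw [wordFlow_nil, Matrix.map_one _ (map_zero _) (map_one _), Matrix.one_mulVec] at hvz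
    obtain ⟨i, hi⟩ := Function.ne_iff.mp hv
    have h1 := congrFun hvz i
    have h2 : z = 1 := by
      refine mul_right_cancel₀ hi ?_
      rw [one_mul]; exact h1.symm
    simp [h2] at hzμ
  | cons l w =>
    set w' := l :: w with hw'
    have hσ : l.1 ∈ K := (hw l (by simp [hw'])).1
    have hT : 0 < wordTime w' := by
      have := hw.length_mul_le
      refine lt_of_lt_of_le ?_ this
      simp only [hw', List.length_cons]
      positivity
    refine ⟨c⁻¹, inv_pos.mpr hc, wordTime w', hT, fun k => ?_⟩
    have hrep : ∀ k : ℕ, ∃ u, IsDwellWord K τ u ∧ wordTime u = k * wordTime w' ∧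
        wordFlow F R u = wordFlow F R w' ^ k := by
      intro k
      induction k with
      | zero => exact ⟨[], isDwellWord_nil, by simp, by simp⟩
      | succ k ih =>
        obtain ⟨u, hu1, hu2, hu3⟩ := ih
        refine ⟨w' ++ u, ?_, ?_, ?_⟩
        · intro x hx
          rcases List.mem_append.mp hx with hx | hx
          · exact hw x hx
          · exact hu1 x hx
        · have : wordTime (w' ++ u) = wordTime w' + wordTime u := by simp [wordTime]
          rw [this, hu2]; push_cast; ring
        · rw [wordFlow_append, hu3, pow_succ']
    obtain ⟨u, hu1, hu2, hu3⟩ := hrep k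
    -- The word ends with a jump, so the signal enters some mode at that instant; this stay of
    -- duration 0 contributes the identity.
    obtain ⟨Z, hZ, hZf⟩ := exists_hybridFlow_eq (n := n) hτ hu1 hσ le_rfl
    refine ⟨Z, hZ, ?_⟩
    have e := hZf F R
    rw [add_zero, hu2, hzero _ hσ, one_mul, hu3] at e
    rw [e, inv_mul_le_iff₀ hc]
    refine le_trans ?_ (h _ z hz k)
    rw [mul_left_comm, Real.exp_nat_mul]
    gcongr

/-- **Lower semicontinuity of the growth rate.** -/
theorem eventually_exists_signal_of_tendsto [Nonempty n] [TopologicalSpace α]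
    (hK : IsCompact K) (hτ : 0 < τ) {CR : ℝ} (hR : ∀ σ ∈ K, ‖R σ‖ ≤ CR)
    (hadd : ∀ σ ∈ K, ∀ s t, G σ (s + t) = G σ s * G σ t)
    (hG : ∃ C, ∀ σ ∈ K, ∀ s, 0 ≤ s → s ≤ τ → ‖G σ s‖ ≤ C)
    (hcont : ContinuousOn (fun σ => G σ τ) K) {μ μ₂ : ℝ} (hμ : μ < μ₂)
    (hgrow : ¬ ∃ C, ∀ Z ∈ SwitchingSignal.withDwell K τ, ∀ t, 0 ≤ t →
      ‖hybridFlow G R Z t‖ ≤ C * Real.exp (μ₂ * t))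
    {ι : Type*} {l : Filter ι} {Φ : ι → α → ℝ → Matrix n n ℝ}
    (hΦadd : ∀ i, ∀ σ ∈ K, ∀ s t, Φ i σ (s + t) = Φ i σ s * Φ i σ t)
    (hΦzero : ∀ i, ∀ σ ∈ K, Φ i σ 0 = 1)
    (hlim : ∀ σ ∈ K, ∀ s, τ ≤ s → Tendsto (fun i => Φ i σ s) l (𝓝 (G σ s))) :
    ∀ᶠ i in l, ∃ c > 0, ∃ T > 0, ∀ k : ℕ, ∃ Z ∈ SwitchingSignal.withDwell K τ,
      c * Real.exp (μ * (k * T)) ≤ ‖hybridFlow (Φ i) R Z (k * T)‖ := by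
  -- Modes are tested separately from words: every letter of a word contains a jump, which may
  -- annihilate the growth achieved during an uninterrupted stay.
  by_cases h1 : ∀ σ ∈ K, ∀ z ∈ (G σ τ).complexSpectrum, ‖z‖ ≤ Real.exp (μ * τ)
  · by_cases h2 : ∀ w, IsDwellWord K τ w →
      ∀ z ∈ (wordFlow G R w).complexSpectrum, ‖z‖ ≤ Real.exp (μ * wordTime w)
    · exact absurd (exists_growth_bound_of_complexSpectrum_le hK hτ hR hadd hG hcont hμ h1 h2) hgrow
    · push Not at h2
      obtain ⟨w, hw, z, hz, hzμ⟩ := h2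
      have hwlim : ∀ w, IsDwellWord K τ w →
          Tendsto (fun i => wordFlow (Φ i) R w) l (𝓝 (wordFlow G R w)) := by
        intro w
        induction w with
        | nil => intro _; simpa using tendsto_const_nhds
        | cons x w ih =>
          intro hw
          rw [isDwellWord_cons] at hw
          simp only [wordFlow_cons]
          exact (tendsto_const_nhds.mul (hlim _ hw.1.1 _ hw.1.2)).mul (ih hw.2)
      filter_upwards [Matrix.eventually_exists_complexSpectrum_gt (hwlim w hw) hz hzμ]
        with i ⟨y, hy, hyμ⟩
      exact exists_signal_of_word_complexSpectrum hτ (hΦzero i) hw hy hyμ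
  · push Not at h1
    obtain ⟨σ, hσ, z, hz, hzμ⟩ := h1
    filter_upwards [Matrix.eventually_exists_complexSpectrum_gt (hlim σ hσ τ le_rfl) hz hzμ]
      with i ⟨y, hy, hyμ⟩
    exact exists_signal_of_mode_complexSpectrum hτ (hΦadd i) (hΦzero i) hσ hy hyμ

end LowerSemicontinuity

/-! ### Lyapunov exponents and the conclusion -/

section Lyapunov

open scoped Matrix.Norms.L2Operator
open Matrix

theorem ennreal_log_div_le_iff {E : Type*} [SeminormedAddCommGroup E] (x : E) {μ t : ℝ}
    (ht : 0 < t) : ENNReal.log ‖x‖ₑ / (t : EReal) ≤ μ ↔ ‖x‖ ≤ Real.exp (μ * t) := by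
  rw [EReal.div_le_iff_le_mul (by exact_mod_cast ht) (EReal.coe_ne_top t), ← EReal.coe_mul,
    ← EReal.log_exp ((t * μ : ℝ) : EReal), ENNReal.log_le_log_iff, EReal.exp_coe,
    ← ofReal_norm, ENNReal.ofReal_le_ofReal_iff (Real.exp_pos _).le, mul_comm]

theorem le_ennreal_log_div_iff {E : Type*} [SeminormedAddCommGroup E] (x : E) {μ t : ℝ}
    (ht : 0 < t) : (μ : EReal) ≤ ENNReal.log ‖x‖ₑ / (t : EReal) ↔ Real.exp (μ * t) ≤ ‖x‖ := by
  rw [EReal.le_div_iff_mul_le (by exact_mod_cast ht) (EReal.coe_ne_top t), ← EReal.coe_mul,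
    ← EReal.log_exp ((μ * t : ℝ) : EReal), ENNReal.log_le_log_iff, EReal.exp_coe,
    ← ofReal_norm, ENNReal.ofReal_le_ofReal_iff (norm_nonneg _)]

namespace ImpulsiveSystem

variable {α : Type*} {S : ImpulsiveSystem α} {K : Set α} {τ μ : ℝ}

theorem norm_flow_le_of_lyapunovExponent_lt (h : S.lyapunovExponent K τ < μ) :
    ∃ t₀, ∀ Z ∈ SwitchingSignal.withDwell K τ, ∀ t, t₀ ≤ t →
      ‖S.flow Z t‖ ≤ Real.exp (μ * t) := by
  obtain ⟨t₀, ht₀⟩ := ((Filter.eventually_lt_of_limsup_lt h).and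
    (eventually_gt_atTop 0)).exists_forall_of_atTop
  refine ⟨t₀, fun Z hZ t ht => ?_⟩
  obtain ⟨h1, h2⟩ := ht₀ t ht
  exact (ennreal_log_div_le_iff _ h2).mp ((le_iSup₂ (f := fun Z _ =>
    ENNReal.log ‖(S.flow Z t).toEuclideanLin.toContinuousLinearMap‖ₑ / (t : EReal)) Z hZ).trans
    h1.le)

/-- For every μ' > μ, the factor e^{(μ' - μ)t} eventually absorbs the constant. -/
theorem lyapunovExponent_le_of_norm_flow_le {C : ℝ}
    (h : ∀ Z ∈ SwitchingSignal.withDwell K τ, ∀ t, 0 ≤ t →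
      ‖S.flow Z t‖ ≤ C * Real.exp (μ * t)) : S.lyapunovExponent K τ ≤ μ := by
  refine EReal.le_of_forall_lt_iff_le.mp fun μ' hμ' => ?_
  have hμ : μ < μ' := by exact_mod_cast hμ'
  have hlim : Tendsto (fun t : ℝ => Real.exp ((μ' - μ) * t)) atTop atTop :=
    Real.tendsto_exp_atTop.comp (tendsto_id.const_mul_atTop (by linarith))
  refine limsup_le_of_le (by isBoundedDefault) ?_
  filter_upwards [hlim.eventually_ge_atTop C, eventually_gt_atTop 0] with t ht ht0
  refine iSup₂_le fun Z hZ => (ennreal_log_div_le_iff _ ht0).mpr ?_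
  refine (h Z hZ t ht0.le).trans ?_
  calc _ ≤ Real.exp ((μ' - μ) * t) * Real.exp (μ * t) := by gcongr
    _ = _ := by rw [← Real.exp_add]; ring_nf

/-- A limsup is bounded below along the times kT, the only ones that a periodically repeated word or
mode controls. -/
theorem le_lyapunovExponent_of_le_norm_flow {c T : ℝ} (hc : 0 < c) (hT : 0 < T)
    (h : ∀ k : ℕ, ∃ Z ∈ SwitchingSignal.withDwell K τ,
      c * Real.exp (μ * (k * T)) ≤ ‖S.flow Z (k * T)‖) : μ ≤ S.lyapunovExponent K τ := by
  refine EReal.ge_of_forall_gt_iff_ge.mp fun μ' hμ' => ?_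
  have hμ : μ' < μ := by exact_mod_cast hμ'
  have htime : Tendsto (fun k : ℕ => (k : ℝ) * T) atTop atTop :=
    tendsto_natCast_atTop_atTop.atTop_mul_const hT
  have hlim : Tendsto (fun t : ℝ => Real.exp ((μ - μ') * t)) atTop atTop :=
    Real.tendsto_exp_atTop.comp (tendsto_id.const_mul_atTop (by linarith))
  refine le_limsup_of_frequently_le ?_ (by isBoundedDefault)
  refine htime.frequently (Eventually.frequently ?_)
  filter_upwards [(hlim.comp htime).eventually_ge_atTop c⁻¹, htime.eventually_gt_atTop 0]
    with k hk hk0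
  obtain ⟨Z, hZ, hle⟩ := h k
  refine le_trans ((le_ennreal_log_div_iff _ hk0).mpr ?_) (le_iSup₂ (f := fun Z _ =>
    ENNReal.log ‖(S.flow Z (k * T)).toEuclideanLin.toContinuousLinearMap‖ₑ / ((k * T : ℝ) : EReal))
    Z hZ)
  refine le_trans ?_ hle
  have h1 : 1 ≤ c * Real.exp ((μ - μ') * (k * T)) := by
    rw [← div_le_iff₀' hc, one_div]; exact hk
  calc Real.exp (μ' * (k * T)) = 1 * Real.exp (μ' * (k * T)) := (one_mul _).symm
    _ ≤ c * Real.exp ((μ - μ') * (k * T)) * Real.exp (μ' * (k * T)) := by gcongr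
    _ = _ := by rw [mul_assoc, ← Real.exp_add]; ring_nf

variable {n : Type*} [Fintype n] [DecidableEq n] {F : α → ℝ → Matrix n n ℝ} {R : α → Matrix n n ℝ}
  {U : ∀ a, Matrix (S.Idx a) n ℝ} {V : ∀ a, Matrix n (S.Idx a) ℝ} {Z : SwitchingSignal α}

/-- In each step, the V of the jump, the exponential and the U of the current mode regroup into F.
-/
theorem switchFlow_mul_of_factorization
    (hF : ∀ a ∈ K, ∀ s, F a s = V a * NormedSpace.exp (s • S.gen a) * U a)
    (hjump : ∀ a ∈ K, ∀ b ∈ K, S.jump a b = U b * R a * V a) (k : ℕ)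
    (hk : ∀ j ≤ k, Z.value j ∈ K) :
    S.switchFlow Z k * U (Z.value 0) = U (Z.value k) * switchProd F R Z k := by
  induction k with
  | zero => simp [switchFlow, switchProd]
  | succ k ih =>
    have h1 := hk k (by omega)
    have h2 := hk (k + 1) le_rfl
    simp only [switchFlow, switchProd, hF _ h1, hjump _ h1 _ h2, Matrix.mul_assoc,
      ih fun j hj => hk j (by omega)]

/-- If the modes of a hybrid system in `ℝⁿ` factor through those of an impulsive system, then so
do the flows. -/
theorem flow_eq_of_factorization (hZ : Z ∈ SwitchingSignal.withDwell K τ)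
    (hUV : ∀ a ∈ K, U a * V a = 1)
    (hF : ∀ a ∈ K, ∀ s, F a s = V a * NormedSpace.exp (s • S.gen a) * U a)
    (hjump : ∀ a ∈ K, ∀ b ∈ K, S.jump a b = U b * R a * V a) {t : ℝ} (ht : 0 ≤ t) :
    S.flow Z t = U (Z.eval t) * hybridFlow F R Z t * V (Z.value 0) ∧
      hybridFlow F R Z t = V (Z.eval t) * S.flow Z t * U (Z.value 0) := by
  have hi := (Z.index_spec ht).1
  have hK : ∀ j ≤ Z.index t, Z.value j ∈ K := fun j hj =>
    hZ.1 j (le_trans (by exact_mod_cast hj) hi)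
  have hsw := switchFlow_mul_of_factorization hF hjump _ hK
  have h0 := hUV _ (hK 0 (by omega))
  have hi' : U (Z.eval t) * V (Z.eval t) = 1 := hUV _ (hK _ le_rfl)
  have e : hybridFlow F R Z t = V (Z.eval t) * S.flow Z t * U (Z.value 0) := by
    change F (Z.value (Z.index t)) _ * _ =
      V (Z.value (Z.index t)) * S.pieceFlow Z (Z.index t) t * U (Z.value 0)
    rw [pieceFlow, hF _ (hK _ le_rfl)]
    simp only [Matrix.mul_assoc, hsw]
  refine ⟨?_, e⟩
  rw [e, Matrix.mul_assoc, Matrix.mul_assoc, h0, Matrix.mul_one, ← Matrix.mul_assoc,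
    hi', Matrix.one_mul]

end ImpulsiveSystem

theorem perturbedSystem_switchFlow (d : ℕ) (ε : ℝ) (Z : SwitchingSignal (SPMode d)) (k : ℕ) :
    (perturbedSystem d ε).switchFlow Z k =
      switchProd (fun σ s => NormedSpace.exp (s • σ.velocity ε)) SPMode.R Z k := by
  induction k with
  | zero => rfl
  | succ k ih =>
    rw [switchProd, mul_assoc, ← ih]
    rfl

theorem perturbedSystem_flow (d : ℕ) (ε : ℝ) (Z : SwitchingSignal (SPMode d)) (t : ℝ) :
    (perturbedSystem d ε).flow Z t =
      hybridFlow (fun σ s => NormedSpace.exp (s • σ.velocity ε)) SPMode.R Z t := by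
  rw [hybridFlow, ← perturbedSystem_switchFlow]
  rfl

variable {d : ℕ} {K : Set (SPMode d)}

theorem SPMode.submatrix_val_eq (σ σ' : SPMode d) (Q : Matrix (Fin d) (Fin d) ℝ) :
    (Q.submatrix Subtype.val Subtype.val : Matrix σ'.Slow σ.Slow ℝ) =
      σ'.slowInclᵀ * Q * σ.slowIncl := by
  ext i j
  simp [SPMode.slowIncl, mul_apply, one_apply]

theorem SPMode.norm_slowIncl_le (σ : SPMode d) : ‖σ.slowIncl‖ ≤ 1 := by
  have h1 : σ.slowInclᴴ * σ.slowIncl = 1 := σ.transpose_mul_slowIncl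
  have h2 := Matrix.l2_opNorm_conjTranspose_mul_self σ.slowIncl
  rw [h1] at h2
  have h3 : ‖(1 : Matrix σ.Slow σ.Slow ℝ)‖ ≤ 1 := by
    have h4 := Matrix.l2_opNorm_conjTranspose_mul_self (1 : Matrix σ.Slow σ.Slow ℝ)
    rw [conjTranspose_one, mul_one] at h4
    by_contra! h5
    nlinarith
  nlinarith

theorem SPMode.norm_transpose_slowIncl_le (σ : SPMode d) : ‖σ.slowInclᵀ‖ ≤ 1 :=
  (Matrix.l2_opNorm_conjTranspose σ.slowIncl).trans_le σ.norm_slowIncl_le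

/-- The two flows determine each other through U = (I 0)T and V = T⁻¹(I 0)ᵀ, evaluated at the
initial and current modes only, and these are bounded on the compact set. Each inequality serves one
of the two semicontinuities. -/
theorem SPMode.exists_norm_reducedSystem_le [Nonempty (Fin d)] (hK : IsCompact K)
    (hD : ∀ σ ∈ K, σ.D.IsHurwitz) {τ : ℝ} :
    ∃ C > 0, ∀ Z ∈ SwitchingSignal.withDwell K τ, ∀ t, 0 ≤ t →
      ‖(reducedSystem d).flow Z t‖ ≤ C * ‖hybridFlow SPMode.limitFlow SPMode.R Z t‖ ∧
      ‖hybridFlow SPMode.limitFlow SPMode.R Z t‖ ≤ C * ‖(reducedSystem d).flow Z t‖ := by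
  obtain ⟨a, ha⟩ := hK.exists_bound_of_continuousOn (continuousOn_T hD)
  obtain ⟨b, hb⟩ := hK.exists_bound_of_continuousOn (continuousOn_T_inv hD)
  set m := max (max a b) 1
  have hm : 0 < m := lt_max_of_lt_right one_pos
  refine ⟨m * m, by positivity, fun Z hZ t ht => ?_⟩
  let U : ∀ σ : SPMode d, Matrix ((reducedSystem d).Idx σ) (Fin d) ℝ := fun σ => σ.slowInclᵀ * σ.T
  let V : ∀ σ : SPMode d, Matrix (Fin d) ((reducedSystem d).Idx σ) ℝ := fun σ => σ.T⁻¹ * σ.slowIncl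
  have hU : ∀ σ ∈ K, ‖U σ‖ ≤ m := fun σ hσ => by
    refine (Matrix.l2_opNorm_mul _ _).trans ?_
    have h1 := σ.norm_transpose_slowIncl_le
    have h2 : ‖σ.T‖ ≤ m := (ha σ hσ).trans ((le_max_left _ _).trans (le_max_left _ _))
    exact (mul_le_mul h1 h2 (norm_nonneg _) zero_le_one).trans_eq (one_mul m)
  have hV : ∀ σ ∈ K, ‖V σ‖ ≤ m := fun σ hσ => by
    refine (Matrix.l2_opNorm_mul _ _).trans ?_
    have h1 := σ.norm_slowIncl_le
    have h2 : ‖σ.T⁻¹‖ ≤ m := (hb σ hσ).trans ((le_max_right _ _).trans (le_max_left _ _))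
    exact (mul_le_mul h2 h1 (norm_nonneg _) hm.le).trans_eq (mul_one m)
  obtain ⟨e1, e2⟩ := ImpulsiveSystem.flow_eq_of_factorization (S := reducedSystem d) (U := U)
    (V := V) (F := limitFlow) (R := R) hZ
    (fun σ hσ => by
      change σ.slowInclᵀ * σ.T * (σ.T⁻¹ * σ.slowIncl) = 1
      rw [Matrix.mul_assoc, ← Matrix.mul_assoc σ.T, T_mul_inv (hD σ hσ), Matrix.one_mul,
        transpose_mul_slowIncl])
    (fun σ hσ s => σ.limitFlow_eq (hD σ hσ) s)
    (fun σ hσ σ' hσ' => by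
      change submatrix _ _ _ = σ'.slowInclᵀ * σ'.T * σ.R * (σ.T⁻¹ * σ.slowIncl)
      rw [submatrix_val_eq]
      simp only [Matrix.mul_assoc])
    ht
  have hi := hZ.1 _ (Z.index_spec ht).1
  have h0 := hZ.1 0 (by simp)
  constructor
  · rw [e1]
    refine (Matrix.l2_opNorm_mul _ _).trans ?_
    have h1 := hU _ hi
    have h2 := hV _ h0
    have h3 := Matrix.l2_opNorm_mul (U (Z.eval t)) (hybridFlow SPMode.limitFlow SPMode.R Z t)
    calc _ ≤ m * ‖hybridFlow SPMode.limitFlow SPMode.R Z t‖ * m := by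
          gcongr
          refine h3.trans ?_
          gcongr
          exact h1
      _ = _ := by ring
  · rw [e2]
    refine (Matrix.l2_opNorm_mul _ _).trans ?_
    have h1 := hV _ hi
    have h2 := hU _ h0
    have h3 := Matrix.l2_opNorm_mul (V (Z.eval t)) ((reducedSystem d).flow Z t)
    calc _ ≤ m * ‖(reducedSystem d).flow Z t‖ * m := by
          gcongr
          refine h3.trans ?_
          gcongr
          exact h1
      _ = _ := by ring

theorem SPMode.exp_velocity_add (σ : SPMode d) (ε s t : ℝ) :
    NormedSpace.exp ((s + t) • σ.velocity ε) =
      NormedSpace.exp (s • σ.velocity ε) * NormedSpace.exp (t • σ.velocity ε) := by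
  rw [add_smul]
  exact Matrix.exp_add_of_commute _ _ (((Commute.refl _).smul_left _).smul_right _)

-- Reals μ < μ₁ are inserted between the reduced exponent and `a`: μ bounds the growth of the limit
-- flow and μ₁ that of its perturbations. Reasoning with such reals also covers a reduced exponent
-- equal to −∞.
open SPMode in
theorem eventually_lyapunovExponent_perturbedSystem_lt [Nonempty (Fin d)] (hK : IsCompact K)
    (hD : ∀ σ ∈ K, σ.D.IsHurwitz) {τ : ℝ} (hτ : 0 < τ) {a : EReal}
    (ha : (reducedSystem d).lyapunovExponent K τ < a) :
    ∀ᶠ ε in 𝓝[>] (0 : ℝ), (perturbedSystem d ε).lyapunovExponent K τ < a := by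
  obtain ⟨μ₁, h1, hμ₁⟩ := EReal.lt_iff_exists_real_btwn.mp ha
  obtain ⟨μ, h2, hμ⟩ := EReal.lt_iff_exists_real_btwn.mp h1
  obtain ⟨CR, hR⟩ := hK.exists_bound_of_continuousOn (continuous_R (d := d)).continuousOn
  obtain ⟨t₀, ht₀⟩ := ImpulsiveSystem.norm_flow_le_of_lyapunovExponent_lt h2
  obtain ⟨C, hC, hred⟩ := exists_norm_reducedSystem_le (τ := τ) hK hD
  obtain ⟨η, hη, hclose⟩ := exists_growth_bound_of_close (G := limitFlow) (C := C)
    (t₀ := max t₀ 0) (μ := μ) hτ hR (fun σ hσ s t => limitFlow_add (hD σ hσ) s t)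
    (fun t₁ => (exists_norm_limitFlow_le hK hD t₁).imp fun _ h => h.2)
    (fun Z hZ t ht => (hred Z hZ t ((le_max_right _ _).trans ht)).2.trans (by
      gcongr
      exact ht₀ Z hZ t ((le_max_left _ _).trans ht))) (μ₁ := μ₁) (by exact_mod_cast hμ)
  -- Closeness is needed on [τ, 2τ] only, uniformly in the mode; it holds as soon as k ε ≤ η.
  obtain ⟨CF, k, hCF, hk, hest⟩ := exists_flow_estimates hK hD hτ (2 * τ)
  have hlim : Tendsto (fun ε : ℝ => k * ε) (𝓝[>] 0) (𝓝 0) := by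
    have : Tendsto (fun ε : ℝ => k * ε) (𝓝 0) (𝓝 (k * 0)) := tendsto_id.const_mul k
    rw [mul_zero] at this
    exact this.mono_left nhdsWithin_le_nhds
  filter_upwards [hlim.eventually_le_const hη, self_mem_nhdsWithin] with ε hε hε0
  obtain ⟨C', hC'⟩ := hclose (fun σ s => NormedSpace.exp (s • σ.velocity ε))
    (fun σ _ s t => σ.exp_velocity_add ε s t)
    ⟨CF, fun σ hσ s hs hsτ => (hest σ hσ ε hε0 s hs (by linarith)).1⟩
    (fun σ hσ s hs hsτ => ((hest σ hσ ε hε0 s (hτ.le.trans hs) hsτ).2 hs).trans hε)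
  refine lt_of_le_of_lt (ImpulsiveSystem.lyapunovExponent_le_of_norm_flow_le (C := C')
    fun Z hZ t ht => ?_) hμ₁
  rw [perturbedSystem_flow]
  exact hC' Z hZ t ht

-- An exponent above μ₂ rules out any bound C e^{μ₂t} for the limit flow. The growth is then
-- witnessed by one word or one mode, so convergence for each fixed mode and duration suffices.
open SPMode in
theorem eventually_lt_lyapunovExponent_perturbedSystem [Nonempty (Fin d)] (hK : IsCompact K)
    (hD : ∀ σ ∈ K, σ.D.IsHurwitz) {τ : ℝ} (hτ : 0 < τ) {a : EReal}
    (ha : a < (reducedSystem d).lyapunovExponent K τ) :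
    ∀ᶠ ε in 𝓝[>] (0 : ℝ), a < (perturbedSystem d ε).lyapunovExponent K τ := by
  obtain ⟨μ, hμa, h1⟩ := EReal.lt_iff_exists_real_btwn.mp ha
  obtain ⟨μ₂, hμ, h2⟩ := EReal.lt_iff_exists_real_btwn.mp h1
  obtain ⟨CR, hR⟩ := hK.exists_bound_of_continuousOn (continuous_R (d := d)).continuousOn
  obtain ⟨C, hC, hred⟩ := exists_norm_reducedSystem_le (τ := τ) hK hD
  have hgrow : ¬ ∃ C', ∀ Z ∈ SwitchingSignal.withDwell K τ, ∀ t, 0 ≤ t →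
      ‖hybridFlow limitFlow R Z t‖ ≤ C' * Real.exp (μ₂ * t) := by
    rintro ⟨C', hC'⟩
    refine not_le_of_gt h2 (ImpulsiveSystem.lyapunovExponent_le_of_norm_flow_le (C := C * C')
      fun Z hZ t ht => (hred Z hZ t ht).1.trans ?_)
    rw [mul_assoc]
    gcongr
    exact hC' Z hZ t ht
  have hlim : ∀ σ ∈ K, ∀ s, τ ≤ s → Tendsto
      (fun ε : ℝ => NormedSpace.exp (s • σ.velocity ε)) (𝓝[>] 0) (𝓝 (σ.limitFlow s)) := by
    intro σ hσ s hs
    obtain ⟨CF, k, hCF, hk, hest⟩ := exists_flow_estimates hK hD hτ s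
    have hlim : Tendsto (fun ε : ℝ => k * ε) (𝓝[>] 0) (𝓝 0) := by
      have : Tendsto (fun ε : ℝ => k * ε) (𝓝 0) (𝓝 (k * 0)) := tendsto_id.const_mul k
      rw [mul_zero] at this
      exact this.mono_left nhdsWithin_le_nhds
    rw [tendsto_iff_norm_sub_tendsto_zero]
    refine squeeze_zero' (Eventually.of_forall fun _ => norm_nonneg _) ?_ hlim
    filter_upwards [self_mem_nhdsWithin] with ε hε
    exact (hest σ hσ ε hε s (hτ.le.trans hs) le_rfl).2 hs
  filter_upwards [eventually_exists_signal_of_tendsto (G := limitFlow) (R := R) hK hτ hR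
    (fun σ hσ s t => limitFlow_add (hD σ hσ) s t)
    ((exists_norm_limitFlow_le hK hD τ).imp fun _ h => h.2) (continuousOn_limitFlow hD τ)
    (by exact_mod_cast hμ : μ < μ₂) hgrow
    (Φ := fun ε σ s => NormedSpace.exp (s • σ.velocity ε))
    (fun ε σ _ s t => σ.exp_velocity_add ε s t) (fun ε σ _ => by simp) hlim]
    with ε ⟨c, hc, T, hT, h⟩
  refine lt_of_lt_of_le hμa (ImpulsiveSystem.le_lyapunovExponent_of_le_norm_flow hc hT fun k => ?_)
  obtain ⟨Z, hZ, hle⟩ := h k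
  exact ⟨Z, hZ, by rw [perturbedSystem_flow]; exact hle⟩

end Lyapunov

end

theorem mainTheorem3 (d : ℕ) (hd : 2 ≤ d) (K : Set (SPMode d)) (hK : IsCompact K)
    (hD : ∀ σ ∈ K, σ.D.IsHurwitz) (τ : ℝ) (hτ : 0 < τ) :
    Filter.Tendsto (fun ε : ℝ => (perturbedSystem d ε).lyapunovExponent K τ)
      (nhdsWithin 0 (Set.Ioi 0)) (nhds ((reducedSystem d).lyapunovExponent K τ)) := by
  have : Nonempty (Fin d) := ⟨⟨0, by omega⟩⟩
  exact tendsto_order.mpr ⟨fun a ha => eventually_lt_lyapunovExponent_perturbedSystem hK hD hτ ha,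
    fun a ha => eventually_lyapunovExponent_perturbedSystem_lt hK hD hτ ha⟩
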